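/- Let $X$ be a compact smooth manifold with boundary, of dimension $n+1$, and let $g$ be an asymptotically hyperbolic metric on its interior $X^\circ$: for a boundary defining function $x$, the metric $x^2g$ extends to a smooth Riemannian metric on $X$, and $|dx|_{x^2g}=1$ on $\partial X$. Let $p(z,\zeta)=g^{ij}(z)\zeta_i\zeta_j-1$ on $T^*X^\circ$. Let $\Lambda\subset T^*X^\circ\times T^*X^\circ$ be the forward bicharacteristic relation, i.e. the set of $((z,\zeta),(z',-\zeta'))$ such that $p(z',\zeta')=0$ and $(z,\zeta)$ is reached from $(z',\zeta')$ by flowing forward (for a time $\ge 0$) along the Hamilton vector field of $p$. Let $p_L((z,\zeta),(z',\zeta'))=p(z,\zeta)$ be the left Hamiltonian. Let $X^2_0$ be the $0$-blown-up double space (the boundary of the diagonal of $X\times X$ is blown up). Fix $y_0\in\partial X$ and coordinates $(x,y)\in[0,\infty)\times\mathbb R^n$ of $X$ near $y_0$, where now $x$ denotes the first coordinate, a local boundary defining function; write $(x,y)$, $(x',y')$ for these coordinates in the left and right factors. Near the interior of the front face, $X^2_0$ has coordinates $$\rho=x',\qquad y,\qquad s=\frac{x}{x'}>0,\qquad Y=\frac{y'-y}{x'},$$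 the front face being $\rho=0$; the interior of its fibre over $y_0$ is $F^\circ_{y_0}=\{(s,Y): s>0,\ Y\in\mathbb R^n\}$, and it meets the lifted diagonal in the point $e=(1,0)$. Let ${}^\Phi T^*X^2_0$ be the lift to $X^2_0$ of ${}^0T^*X\times{}^0T^*X$ (where ${}^0T^*X$ is the bundle whose sections are the forms $\alpha/x$, $\alpha$ a smooth one-form on $X$); near the interior of the front face it has the frame $dy_i/\rho,\ ds,\ dY_i,\ d\rho/\rho$. Embed $T^*F^\circ_{y_0}$ in it by sending $\sigma\,ds+N\cdot dY$ at $(s,Y)$ to the covector with the same expression at the point $(\rho=0,y_0,s,Y)$. Let $\Lambda_+$ be the closure of $\Lambda$ in ${}^\Phi T^*X^2_0$ and $\Lambda_{y_0}=\Lambda_+\cap T^*F^\circ_{y_0}$. Then there is a Riemannian metric $G$ on $F^\circ_{y_0}$ such that: 1. $p_L$ extends by continuity to $T^*F^\circ_{y_0}$, as the Hamiltonian $(s,Y;\zeta)\mapsto|\zeta|^2_{G^{-1}(s,Y)}-1$; 2. $G$ is an exact hyperbolic metric: it is the pull-back of the metric $(ds^2+|dY|^2)/s^2$ of the upper half space by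 a linear isomorphism of $\mathbb R^{n+1}$ that preserves the coordinate $s$; 3. the Riemannian distance $\Psi=d_G(e,\cdot)$ is smooth on $F^\circ_{y_0}\setminus\{e\}$, and over $F^\circ_{y_0}\setminus\{e\}$ the set $\Lambda_{y_0}$ is exactly the graph of $d\Psi$, while over $e$ it is the unit cosphere $\{\zeta\in T^*_eF^\circ_{y_0}:|\zeta|_{G^{-1}(e)}=1\}$; 4. $\Lambda_{y_0}$ is the forward flowout (times $\ge0$) of that unit cosphere under the Hamilton flow of $|\zeta|^2_{G^{-1}}-1$ on $T^*F^\circ_{y_0}$. -/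

import Mathlib

open Set Filter Topology MeasureTheory
open scoped Manifold ContDiff Gradient

noncomputable section

namespace ZeroGeometry

/-- Coordinate space of dimension `n + 1`. The coordinate of index `0` is the one transversal to the
boundary (`x`, `x'`, `s`, or its dual variable), the coordinates of index `i.succ` are the
tangential ones (`y`, `y'`, `Y`, or their dual variables). -/
abbrev Coord (n : ℕ) : Type := EuclideanSpace ℝ (Fin (n + 1))

/-- The standard basis vector of index `i`. -/
abbrev basisVec {n : ℕ} (i : Fin (n + 1)) : Coord n := EuclideanSpace.single i (1 : ℝ)

/-- The covector `v ↦ ∑ i, p i * v i`. -/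
abbrev covec {n : ℕ} (p : Coord n) : Coord n →L[ℝ] ℝ := innerSL ℝ p

/-- The dual quadratic form `∑ i j, g^{ij} ζ_i ζ_j` of a bilinear form `B`, where `(g^{ij})` is the
inverse of the matrix `(B (e_i, e_j))`; its value does not depend on the basis. -/
def coNormSq {n : ℕ} (B : Coord n →L[ℝ] Coord n →L[ℝ] ℝ) (ζ : Coord n →L[ℝ] ℝ) : ℝ :=
  ∑ i, ∑ j, (Matrix.of fun i j => B (basisVec i) (basisVec j))⁻¹ i j *
    ζ (basisVec i) * ζ (basisVec j)

/-! ### Hamilton's equations on coordinate space -/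

/-- Hamilton's equations `q' = ∂H/∂p`, `p' = -∂H/∂q` at time `t`, for a curve `(q, p)`
parametrized by the set of times `S`. -/
def HamiltonAt {n : ℕ} (H : Coord n → Coord n → ℝ) (S : Set ℝ) (q p : ℝ → Coord n) (t : ℝ) :
    Prop :=
  HasDerivWithinAt q (∇ (fun p' => H (q t) p') (p t)) S t ∧
    HasDerivWithinAt p (-(∇ (fun q' => H q' (p t)) (q t))) S t

/-! ### Riemannian metrics on the open half space `{z | 0 < z 0}` -/

section HalfSpace

variable {n : ℕ}

/-- The Hamiltonian `G^{ij}(z) ζ_i ζ_j - 1` of a metric `G` on the half space. -/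
def halfSpaceHam (G : Coord n → Coord n →L[ℝ] Coord n →L[ℝ] ℝ) (z ζ : Coord n) : ℝ :=
  coNormSq (G z) (covec ζ) - 1

/-- `G` is the hyperbolic metric of the upper half space model, up to a linear change of coordinates
`A` which preserves the half space together with its defining function `z ↦ z 0`: it is the
pull-back by `A` of the metric `|dz|² / (z 0)²`. -/
def IsHyperbolic (G : Coord n → Coord n →L[ℝ] Coord n →L[ℝ] ℝ) : Prop :=
  ∃ A : Coord n ≃L[ℝ] Coord n, (∀ z, A z 0 = z 0) ∧
    ∀ z, 0 < z 0 → ∀ v w, G z v w = inner ℝ (A v) (A w) / (A z 0) ^ 2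

/-- The Riemannian distance of the half space with metric `G`: the infimum of the lengths of the
`C^1` curves from `a` to `b` in the half space. -/
def riemDist (G : Coord n → Coord n →L[ℝ] Coord n →L[ℝ] ℝ) (a b : Coord n) : ℝ :=
  sInf {L : ℝ | ∃ c : ℝ → Coord n, ContDiffOn ℝ 1 c (Icc 0 1) ∧ (∀ t ∈ Icc (0 : ℝ) 1, 0 < c t 0) ∧
    c 0 = a ∧ c 1 = b ∧
    L = ∫ t in (0 : ℝ)..1, √(G (c t) (derivWithin c (Icc 0 1) t) (derivWithin c (Icc 0 1) t))}

/-- The forward Hamiltonian flowout, in the cotangent bundle of the half space, from the cosphere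
`{ζ | |ζ|_G = 1}` over the point `a`. -/
def flowout (G : Coord n → Coord n →L[ℝ] Coord n →L[ℝ] ℝ) (a : Coord n) :
    Set (Coord n × Coord n) :=
  {w | ∃ T : ℝ, 0 ≤ T ∧ ∃ q p : ℝ → Coord n,
    (∀ t ∈ Icc 0 T, 0 < q t 0 ∧ HamiltonAt (halfSpaceHam G) (Icc 0 T) q p t) ∧
    q 0 = a ∧ halfSpaceHam G a (p 0) = 0 ∧ q T = w.1 ∧ p T = w.2}

end HalfSpace

/-! ### Asymptotically hyperbolic metrics and the forward bicharacteristic relation -/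

section Manifold

variable {n : ℕ} {X : Type*} [TopologicalSpace X] [ChartedSpace (EuclideanHalfSpace (n + 1)) X]

variable (n X) in
/-- The cotangent bundle of a manifold with boundary `X` of dimension `n + 1`. -/
abbrev Cotangent : Type _ :=
  Bundle.TotalSpace (Coord n →L[ℝ] ℝ) (fun p : X => TangentSpace (𝓡∂ (n + 1)) p →L[ℝ] ℝ)

variable (n X) in
/-- A field of bilinear forms on the tangent spaces of `X`. Metrics on the interior of `X` are given
by such fields; their values on the boundary play no role. -/
abbrev BilinField : Type _ :=
  ∀ p : X, TangentSpace (𝓡∂ (n + 1)) p →L[ℝ] TangentSpace (𝓡∂ (n + 1)) p →L[ℝ] ℝ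

/-- `x` is a (smooth) boundary defining function of `X`. -/
structure IsBoundaryDefining (x : X → ℝ) : Prop where
  smooth : ContMDiff (𝓡∂ (n + 1)) 𝓘(ℝ, ℝ) ∞ x
  nonneg : ∀ p, 0 ≤ x p
  eq_zero_iff : ∀ p, x p = 0 ↔ p ∈ (𝓡∂ (n + 1)).boundary X
  mfderiv_ne_zero : ∀ p ∈ (𝓡∂ (n + 1)).boundary X, mfderiv (𝓡∂ (n + 1)) 𝓘(ℝ, ℝ) x p ≠ 0

/-- The metric `g` on the interior of `X` is asymptotically hyperbolic: for a boundary defining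
function `x`, the metric `x² g` extends to a smooth Riemannian metric on `X`, for which `|dx| = 1`
at the boundary. -/
def IsAsymptoticallyHyperbolic [IsManifold (𝓡∂ (n + 1)) ∞ X] (g : BilinField n X) : Prop :=
  ∃ (x : X → ℝ) (gbar : Bundle.ContMDiffRiemannianMetric (𝓡∂ (n + 1)) ∞ (Coord n)
      (fun p : X => TangentSpace (𝓡∂ (n + 1)) p)),
    IsBoundaryDefining (n := n) x ∧
    (∀ p ∈ (𝓡∂ (n + 1)).interior X, gbar.inner p = x p ^ 2 • g p) ∧
    ∀ p ∈ (𝓡∂ (n + 1)).boundary X,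
      coNormSq (gbar.inner p) (mfderiv (𝓡∂ (n + 1)) 𝓘(ℝ, ℝ) x p) = 1

/-- The Hamiltonian `g^{ij} ζ_i ζ_j - 1` on the cotangent bundle of the interior of `X`. -/
def symbol (g : BilinField n X) (w : Cotangent n X) : ℝ :=
  coNormSq (g w.proj) w.snd - 1

/-- The point of the cotangent bundle with canonical coordinates `(q, p)` in the chart `φ`, that is,
the covector `∑ i, p i dφ_i` at the point with coordinates `q`. -/
def ofCoord (φ : OpenPartialHomeomorph X (EuclideanHalfSpace (n + 1))) (q p : Coord n) :
    Cotangent n X :=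
  ⟨(φ.extend (𝓡∂ (n + 1))).symm q,
    (covec p).comp (mfderiv (𝓡∂ (n + 1)) 𝓘(ℝ, Coord n) (φ.extend (𝓡∂ (n + 1)))
      ((φ.extend (𝓡∂ (n + 1))).symm q))⟩

/-- The curve `c`, with set of times `S`, is an integral curve of the Hamilton vector field of the
Hamiltonian of `g` in the cotangent bundle of the interior of `X`: around each time it satisfies
Hamilton's equations in canonical coordinates. -/
def IsHamiltonCurve (g : BilinField n X) (S : Set ℝ) (c : ℝ → Cotangent n X) : Prop :=
  ∀ t ∈ S, ∃ φ ∈ IsManifold.maximalAtlas (𝓡∂ (n + 1)) ∞ X, ∃ q p : ℝ → Coord n,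
    q t ∈ interior (φ.extend (𝓡∂ (n + 1))).target ∧
    (∀ᶠ τ in 𝓝[S] t, c τ = ofCoord φ (q τ) (p τ)) ∧
    HamiltonAt (fun q' p' => symbol g (ofCoord φ q' p')) S q p t

/-- The forward bicharacteristic relation: the set of `((z, ζ), (z', -ζ'))` such that `(z', ζ')` is
in the characteristic variety and `(z, ζ)` is obtained by flowing from `(z', ζ')` along an integral
curve of the Hamilton vector field in the forward direction. -/
def forwardRelation (g : BilinField n X) : Set (Cotangent n X × Cotangent n X) :=
  {w | ∃ T : ℝ, 0 ≤ T ∧ ∃ c : ℝ → Cotangent n X, IsHamiltonCurve g (Icc 0 T) c ∧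
    symbol g (c 0) = 0 ∧ w.1 = c T ∧ w.2 = ⟨(c 0).proj, -(c 0).snd⟩}

/-! ### Coordinates on the `Φ`-cotangent bundle near the front face -/

/-- Passage from canonical coordinates on `T^*X × T^*X` to coordinates on the `Φ`-cotangent bundle
of the `0`-blown-up double space, over a neighbourhood of the interior of the front face.

Let `q = (x, y)`, `p = (ξ, η)` be canonical coordinates in the left factor, and `q' = (x', y')`,
`p' = (ξ', η')` those in the right factor. The coordinates on the blown-up space are the
projective ones, `b = (ρ, y)` and `z = (s, Y)`, where
`ρ = x'`, `s = x / x'`, `Y = (y' - y) / x'`;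
the front face is `ρ = 0`, its interior is `ρ = 0, s > 0`, and its fibre over a boundary point is
given by fixing `y`. The fibre coordinates `β = (ω, μ)` and `ζ = (σ, N)` of the `Φ`-cotangent bundle
are those with respect to its frame `dρ / ρ, dy_i / ρ, ds, dY_i`:
`ξ dx + η · dy + ξ' dx' + η' · dy' = ω dρ / ρ + μ · dy / ρ + σ ds + N · dY`.
The result is `(b, z, β, ζ)`. -/
def phiCoord (w : (Coord n × Coord n) × (Coord n × Coord n)) :
    (Coord n × Coord n) × (Coord n × Coord n) :=
  let q := w.1.1
  let p := w.1.2
  let q' := w.2.1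
  let p' := w.2.2
  ((WithLp.toLp 2 (Fin.cons (q' 0) fun i : Fin n => q i.succ),
    WithLp.toLp 2 (Fin.cons (q 0 / q' 0) fun i : Fin n => (q' i.succ - q i.succ) / q' 0)),
   (WithLp.toLp 2 (Fin.cons
      (q 0 * p 0 + q' 0 * p' 0 + ∑ i : Fin n, (q' i.succ - q i.succ) * p' i.succ)
      fun i : Fin n => q' 0 * (p i.succ + p' i.succ)),
    WithLp.toLp 2 (Fin.cons (q' 0 * p 0) fun i : Fin n => q' 0 * p' i.succ)))

/-- The set of canonical coordinates `((q, p), (q', p'))` of the points of `T^*X° × T^*X°` over the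
domain of the chart `φ` in both factors. -/
def coordDomain (φ : OpenPartialHomeomorph X (EuclideanHalfSpace (n + 1))) :
    Set ((Coord n × Coord n) × (Coord n × Coord n)) :=
  {w | w.1.1 ∈ interior (φ.extend (𝓡∂ (n + 1))).target ∧
    w.2.1 ∈ interior (φ.extend (𝓡∂ (n + 1))).target}

/-- The point `(b, z, 0, ζ)` of the `Φ`-cotangent bundle over the fibre `F_{y₀}` of the front face,
in the coordinates given by `φ`. The map `(z, ζ) ↦ frontPoint φ y₀ z ζ` is the natural inclusion
of `T^*F_{y₀}°`, the dual of the restriction to `F_{y₀}°` of vector fields tangent to the fibres. -/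
def frontPoint (φ : OpenPartialHomeomorph X (EuclideanHalfSpace (n + 1))) (y₀ : X)
    (z ζ : Coord n) : (Coord n × Coord n) × (Coord n × Coord n) :=
  ((φ.extend (𝓡∂ (n + 1)) y₀, z), (0, ζ))

/-- The Lagrangian `Λ_{y₀}`, as a subset of the cotangent bundle of
`F_{y₀}° = {z = (s, Y) | 0 < s}`: the inverse image, under the inclusion of `T^*F_{y₀}°` in the
`Φ`-cotangent bundle, of the closure of the forward bicharacteristic relation. -/
def frontLagrangian (g : BilinField n X)
    (φ : OpenPartialHomeomorph X (EuclideanHalfSpace (n + 1))) (y₀ : X) :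
    Set (Coord n × Coord n) :=
  {v | 0 < v.1 0 ∧ frontPoint φ y₀ v.1 v.2 ∈ closure (phiCoord ''
    {w | w ∈ coordDomain φ ∧
      (ofCoord φ w.1.1 w.1.2, ofCoord φ w.2.1 w.2.2) ∈ forwardRelation g})}

/-- The filter of points of `T^*X° × T^*X°` (in canonical coordinates) which converge, in the
`Φ`-cotangent bundle, to the point `(z, ζ)` of `T^*F_{y₀}°`. -/
def towardsFront (φ : OpenPartialHomeomorph X (EuclideanHalfSpace (n + 1))) (y₀ : X)
    (z ζ : Coord n) : Filter ((Coord n × Coord n) × (Coord n × Coord n)) :=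
  comap phiCoord (𝓝 (frontPoint φ y₀ z ζ)) ⊓ 𝓟 (coordDomain φ)

end Manifold

/-- The point `e = (s = 1, Y = 0)` where the lifted diagonal meets a fibre of the front face. -/
abbrev diagPoint (n : ℕ) : Coord n := basisVec 0

end ZeroGeometry

end

open Set Filter Topology MeasureTheory
open scoped Manifold ContDiff Gradient

set_option linter.unusedSectionVars false

noncomputable section

namespace ZeroGeometry

/-! ### Dual quadratic forms and their operators. -/

section

variable {n : ℕ}

/-! In a chart with transversal coordinate `q 0`, the Hamiltonian of `g` is `(q 0)² ⟪K(q) p, p⟫ -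
1`, where `K` is `(r / q 0)²` times the dual of the metric `x² g` and `r` is the defining function
in the chart. At the boundary point `K` tends to an operator `k`, `q 0 • DK` tends to `0`, and the
normalisation `|dx| = 1` says exactly that `k₀₀ = 1` (`exists_isZeroLimit`). With the rescaled
momentum `π = q 0 • p`, Hamilton's equations read `q' = 2 (q 0) Kπ` and `π' =` a force in which `q`
enters only through `K` and `q 0 • DK` (`HamiltonAt.rescaled`). Near the boundary point they are a
small perturbation of a system invariant under tangential translations and dilations: the geodesic
flow of a hyperbolic half space, which is solved by hyperbolic functions (`modelPos`, `modelMom`).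
By Grönwall, trajectories that start near the boundary point follow these curves for bounded times,
once positions are rescaled by the initial height (`IsZeroLimit.tracks`).

Points of `T^*F°` are those where the `dρ/ρ` and `dy/ρ` components of the covector vanish. These
components are the changes in the dilation and translation momenta, which the limiting flow
conserves; their vanishing determines the starting covector `startCov z ζ` from the end point. Along
a sequence in `Λ` that converges to `(z, ζ)` the rescaled starting momenta therefore converge, and
if the travel times are bounded, a subsequence shows that `(z, ζ)` lies on an explicit curve
(`exists_model_of_mem`).

The main difficulty is to bound these times, as a bicharacteristic might wander through `X` and
return (`exists_time_bound`). A trajectory that moves steeply enough towards the boundary keeps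
doing so: its height decays exponentially, and its total displacement is bounded by a multiple of
its height (`IsFrontModel.trap`). Unless it starts vertically upwards, a trajectory near the
boundary point is caught in this way after a fixed time, at an arbitrarily small fraction of its
initial height (`IsFrontModel.fall`); this contradicts the convergence of the ratio of heights to `z
0 > 0`. If it starts vertically upwards in the limit, then it also arrives vertically upwards, and
the argument applies to the reversed trajectory. Conversely, `exists_trajectory` supplies
bicharacteristics that converge to every point of the explicit curves (`model_mem`).

The rest is hyperbolic geometry. As `k₀₀ = 1`, there is a height-preserving `A` with `AᵀA = k⁻¹`
(`exists_frame`), and the metric is the pull-back by `A`. The function `C = 1 + |A(z - e)|² / (2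
z₀)` has differential of norm `√(C² - 1)`, so `arcosh C` bounds lengths from below; the explicit
curves attain the bound, and their covectors are the differential of the distance. Because `Y = (y'
- y) / x'` points against the displacement from start to end, the operator used is the reflection of
`k` in the tangential directions. -/

lemma sum_apply_smul_basisVec (v : Coord n) : ∑ i, v i • basisVec i = v := by
  have h := (EuclideanSpace.basisFun (Fin (n + 1)) ℝ).sum_repr v
  simpa using h

/-- The dual quadratic form of `B`, evaluated at the covector dual to `v`, is `B v v`. -/
lemma coNormSq_apply_self {B : Coord n →L[ℝ] Coord n →L[ℝ] ℝ} (hs : ∀ v w, B v w = B w v)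
    (hp : ∀ v, v ≠ 0 → 0 < B v v) (v : Coord n) : coNormSq B (B v) = B v v := by
  set b : Matrix (Fin (n + 1)) (Fin (n + 1)) ℝ :=
    Matrix.of fun i j => B (basisVec i) (basisVec j) with hb
  have key (u : Coord n) (i) : (b.mulVec u.ofLp) i = B u (basisVec i) := by
    conv_rhs => rw [← sum_apply_smul_basisVec u]
    simp only [Matrix.mulVec, dotProduct, hb, Matrix.of_apply, map_sum, map_smul,
      sum_apply, smul_apply, smul_eq_mul]
    exact Finset.sum_congr rfl fun j _ => by rw [hs, mul_comm]
  have key2 (u w : Coord n) : ∑ i, w i * B u (basisVec i) = B u w := by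
    conv_rhs => rw [← sum_apply_smul_basisVec w]
    simp
  have hu : IsUnit b := by
    rw [← Matrix.mulVec_injective_iff_isUnit]
    intro x y hxy
    by_contra hne
    have hne' : WithLp.toLp 2 (x - y) ≠ (0 : Coord n) := by
      intro h
      apply hne
      have := congrArg WithLp.ofLp h
      simpa [sub_eq_zero] using this
    have h0 := hp _ hne'
    have h1 : ∀ i, B (WithLp.toLp 2 (x - y)) (basisVec i) = 0 := by
      intro i
      rw [← key]
      simp only [Matrix.mulVec_sub]
      simp [hxy]
    rw [← key2, Finset.sum_eq_zero fun i _ => by rw [h1, mul_zero]] at h0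
    exact lt_irrefl _ h0
  have hdet : IsUnit b.det := (Matrix.isUnit_iff_isUnit_det b).1 hu
  have h1 : coNormSq B (B v) = dotProduct (b.mulVec v.ofLp) (b⁻¹.mulVec (b.mulVec v.ofLp)) := by
    rw [show b.mulVec v.ofLp = fun i => B v (basisVec i) from funext (key v)]
    simp only [coNormSq, dotProduct, Matrix.mulVec, ← hb, Finset.mul_sum]
    exact Finset.sum_congr rfl fun i _ => Finset.sum_congr rfl fun j _ => by ring
  rw [h1, Matrix.mulVec_mulVec, Matrix.nonsing_inv_mul _ hdet, Matrix.one_mulVec, dotProduct,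
    ← key2]
  exact Finset.sum_congr rfl fun i _ => by rw [key, mul_comm]

/-- The operator `Γ` with `⟪Γ v, w⟫ = B v w`. -/
def gramOp (B : Coord n →L[ℝ] Coord n →L[ℝ] ℝ) : Coord n →L[ℝ] Coord n :=
  InnerProductSpace.continuousLinearMapOfBilin B

lemma inner_gramOp (B : Coord n →L[ℝ] Coord n →L[ℝ] ℝ) (v w : Coord n) :
    inner ℝ (gramOp B v) w = B v w :=
  InnerProductSpace.continuousLinearMapOfBilin_apply B v w

lemma gramOp_isInvertible {B : Coord n →L[ℝ] Coord n →L[ℝ] ℝ}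
    (hp : ∀ v, v ≠ 0 → 0 < B v v) : (gramOp B).IsInvertible := by
  have hinj : Function.Injective (gramOp B : Coord n →ₗ[ℝ] Coord n) := by
    rw [← LinearMap.ker_eq_bot, LinearMap.ker_eq_bot']
    intro v hv
    by_contra h
    have := hp v h
    rw [← inner_gramOp] at this
    have hv' : gramOp B v = 0 := hv
    simp [hv'] at this
  exact ⟨(LinearEquiv.ofInjectiveEndo _ hinj).toContinuousLinearEquiv, by ext v : 1; rfl⟩

/-- The inverse of the operator representing `B`: it represents the dual quadratic form. -/
def sharpOp (B : Coord n →L[ℝ] Coord n →L[ℝ] ℝ) : Coord n →L[ℝ] Coord n := (gramOp B).inverse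

lemma gramOp_sharpOp {B : Coord n →L[ℝ] Coord n →L[ℝ] ℝ} (hp : ∀ v, v ≠ 0 → 0 < B v v)
    (p : Coord n) : gramOp B (sharpOp B p) = p := by
  obtain ⟨e, he⟩ := gramOp_isInvertible hp
  simp [sharpOp, ← he]

lemma apply_sharpOp {B : Coord n →L[ℝ] Coord n →L[ℝ] ℝ} (hp : ∀ v, v ≠ 0 → 0 < B v v)
    (p w : Coord n) : B (sharpOp B p) w = inner ℝ p w := by
  rw [← inner_gramOp, gramOp_sharpOp hp]

lemma inner_sharpOp_comm {B : Coord n →L[ℝ] Coord n →L[ℝ] ℝ} (hs : ∀ v w, B v w = B w v)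
    (hp : ∀ v, v ≠ 0 → 0 < B v v) (p w : Coord n) :
    inner ℝ (sharpOp B p) w = inner ℝ p (sharpOp B w) := by
  rw [← apply_sharpOp hp p, hs, apply_sharpOp hp, real_inner_comm]

lemma inner_sharpOp_pos {B : Coord n →L[ℝ] Coord n →L[ℝ] ℝ} (hp : ∀ v, v ≠ 0 → 0 < B v v)
    {p : Coord n} (hne : p ≠ 0) : 0 < inner ℝ (sharpOp B p) p := by
  rw [real_inner_comm, ← apply_sharpOp hp]
  apply hp
  intro h
  apply hne
  rw [← gramOp_sharpOp hp p, h, map_zero]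

/-- Raising the index with `sharpOp` replaces the inverse Gram matrix by an operator, which can be
differentiated and passed to the limit. -/
lemma coNormSq_covec {B : Coord n →L[ℝ] Coord n →L[ℝ] ℝ} (hs : ∀ v w, B v w = B w v)
    (hp : ∀ v, v ≠ 0 → 0 < B v v) (p : Coord n) :
    coNormSq B (covec p) = inner ℝ (sharpOp B p) p := by
  have h : covec p = B (sharpOp B p) := by
    ext w
    simp [apply_sharpOp hp]
  rw [h, coNormSq_apply_self hs hp, apply_sharpOp hp, real_inner_comm]

lemma inner_basisVec (v : Coord n) (i : Fin (n + 1)) : inner ℝ v (basisVec i) = v i := by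
  simp [basisVec, EuclideanSpace.inner_single_right]

lemma gramOp_contDiffOn {f : Coord n → Coord n →L[ℝ] Coord n →L[ℝ] ℝ} {s : Set (Coord n)}
    {m : WithTop ℕ∞} (hf : ∀ v w, ContDiffOn ℝ m (fun q => f q v w) s) :
    ContDiffOn ℝ m (fun q => gramOp (f q)) s := by
  rw [contDiffOn_clm_apply]
  intro v
  rw [contDiffOn_euclidean]
  intro i
  refine (hf v (basisVec i)).congr fun q _ => ?_
  rw [← inner_basisVec, inner_gramOp]

lemma sharpOp_contDiffOn {f : Coord n → Coord n →L[ℝ] Coord n →L[ℝ] ℝ} {s : Set (Coord n)}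
    {m : WithTop ℕ∞} (hf : ∀ v w, ContDiffOn ℝ m (fun q => f q v w) s)
    (hp : ∀ q ∈ s, ∀ v, v ≠ 0 → 0 < f q v v) :
    ContDiffOn ℝ m (fun q => sharpOp (f q)) s := by
  intro q hq
  obtain ⟨e, he⟩ := gramOp_isInvertible (hp q hq)
  have h := contDiffAt_map_inverse (𝕜 := ℝ) (n := m) e
  rw [he] at h
  exact h.comp_contDiffWithinAt q (gramOp_contDiffOn hf q hq)

end

/-! ### The metric in a chart, up to the boundary. -/

section

variable {n : ℕ} {X : Type*} [TopologicalSpace X] [ChartedSpace (EuclideanHalfSpace (n + 1)) X]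

lemma extend_target_eq (φ : OpenPartialHomeomorph X (EuclideanHalfSpace (n + 1))) :
    (φ.extend (𝓡∂ (n + 1))).target =
      (𝓡∂ (n + 1)).symm ⁻¹' φ.target ∩ {q : Coord n | 0 ≤ q 0} := by
  rw [φ.extend_target, range_modelWithCornersEuclideanHalfSpace]

lemma isOpen_symm_preimage_target (φ : OpenPartialHomeomorph X (EuclideanHalfSpace (n + 1))) :
    IsOpen ((𝓡∂ (n + 1)).symm ⁻¹' φ.target : Set (Coord n)) :=
  φ.open_target.preimage (𝓡∂ (n + 1)).continuous_symm

lemma interior_extend_target (φ : OpenPartialHomeomorph X (EuclideanHalfSpace (n + 1))) :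
    interior (φ.extend (𝓡∂ (n + 1))).target =
      (φ.extend (𝓡∂ (n + 1))).target ∩ {q : Coord n | 0 < q 0} := by
  have h := interior_range_modelWithCornersEuclideanHalfSpace (n + 1)
  rw [φ.extend_target, interior_inter, (isOpen_symm_preimage_target φ).interior_eq, h,
    range_modelWithCornersEuclideanHalfSpace]
  ext q
  simp only [mem_inter_iff, mem_ofPred_eq]
  constructor
  · rintro ⟨h1, h2⟩
    exact ⟨⟨h1, h2.le⟩, h2⟩
  · rintro ⟨⟨h1, _⟩, h2⟩
    exact ⟨h1, h2⟩

lemma uniqueDiffOn_extend_target (φ : OpenPartialHomeomorph X (EuclideanHalfSpace (n + 1))) :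
    UniqueDiffOn ℝ (φ.extend (𝓡∂ (n + 1))).target := by
  rw [φ.extend_target, inter_comm]
  exact (𝓡∂ (n + 1)).uniqueDiffOn.inter (isOpen_symm_preimage_target φ)

lemma extend_target_eq_image (φ : OpenPartialHomeomorph X (EuclideanHalfSpace (n + 1))) :
    (φ.extend (𝓡∂ (n + 1))).target = (𝓡∂ (n + 1)) '' φ.target := by
  rw [φ.extend_target, ModelWithCorners.image_eq]

lemma extend_symm_mem_source {φ : OpenPartialHomeomorph X (EuclideanHalfSpace (n + 1))}
    {q : Coord n} (hq : q ∈ (φ.extend (𝓡∂ (n + 1))).target) :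
    (φ.extend (𝓡∂ (n + 1))).symm q ∈ φ.source := by
  have := (φ.extend (𝓡∂ (n + 1))).map_target hq
  rwa [φ.extend_source] at this

lemma extend_mem_target {φ : OpenPartialHomeomorph X (EuclideanHalfSpace (n + 1))}
    {x : X} (hx : x ∈ φ.source) : φ.extend (𝓡∂ (n + 1)) x ∈ (φ.extend (𝓡∂ (n + 1))).target := by
  apply (φ.extend (𝓡∂ (n + 1))).map_source
  rwa [φ.extend_source]

lemma extend_leftInv {φ : OpenPartialHomeomorph X (EuclideanHalfSpace (n + 1))}
    {x : X} (hx : x ∈ φ.source) :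
    (φ.extend (𝓡∂ (n + 1))).symm (φ.extend (𝓡∂ (n + 1)) x) = x := by
  apply (φ.extend (𝓡∂ (n + 1))).left_inv
  rwa [φ.extend_source]

variable [IsManifold (𝓡∂ (n + 1)) ∞ X]

lemma contMDiffOn_extend_symm_target {φ : OpenPartialHomeomorph X (EuclideanHalfSpace (n + 1))}
    (hφ : φ ∈ IsManifold.maximalAtlas (𝓡∂ (n + 1)) ∞ X) :
    ContMDiffOn 𝓘(ℝ, Coord n) (𝓡∂ (n + 1)) ∞ (φ.extend (𝓡∂ (n + 1))).symm
      (φ.extend (𝓡∂ (n + 1))).target := by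
  rw [extend_target_eq_image]
  exact contMDiffOn_extend_symm hφ

/-- The derivative of the inverse of the chart `φ`. -/
def chartFrame (φ : OpenPartialHomeomorph X (EuclideanHalfSpace (n + 1))) (q : Coord n) :
    Coord n →L[ℝ] TangentSpace (𝓡∂ (n + 1)) ((φ.extend (𝓡∂ (n + 1))).symm q) :=
  mfderivWithin 𝓘(ℝ, Coord n) (𝓡∂ (n + 1)) (φ.extend (𝓡∂ (n + 1))).symm
    (φ.extend (𝓡∂ (n + 1))).target q

/-- The derivative of the inverse chart is taken within the target, which is not open at boundary
points; unique differentiability there still lets the chain rule identify it as an inverse. -/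
lemma mfderiv_chartFrame {φ : OpenPartialHomeomorph X (EuclideanHalfSpace (n + 1))}
    (hφ : φ ∈ IsManifold.maximalAtlas (𝓡∂ (n + 1)) ∞ X) {q : Coord n}
    (hq : q ∈ (φ.extend (𝓡∂ (n + 1))).target) (v : Coord n) :
    mfderiv (𝓡∂ (n + 1)) 𝓘(ℝ, Coord n) (φ.extend (𝓡∂ (n + 1)))
      ((φ.extend (𝓡∂ (n + 1))).symm q) (chartFrame φ q v) = v := by
  have U : UniqueMDiffWithinAt 𝓘(ℝ, Coord n) (φ.extend (𝓡∂ (n + 1))).target q :=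
    (uniqueDiffOn_extend_target φ).uniqueMDiffOn q hq
  have h1 : MDifferentiableAt (𝓡∂ (n + 1)) 𝓘(ℝ, Coord n) (φ.extend (𝓡∂ (n + 1)))
      ((φ.extend (𝓡∂ (n + 1))).symm q) :=
    (φ.contMDiffAt_extend hφ (extend_symm_mem_source hq)).mdifferentiableAt (by simp)
  have h2 := (contMDiffOn_extend_symm_target hφ q hq).mdifferentiableWithinAt (by simp)
  have h3 := mfderiv_comp_mfderivWithin q h1 h2 U
  have h4 : mfderivWithin 𝓘(ℝ, Coord n) 𝓘(ℝ, Coord n)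
      ((φ.extend (𝓡∂ (n + 1))) ∘ (φ.extend (𝓡∂ (n + 1))).symm) (φ.extend (𝓡∂ (n + 1))).target q =
      ContinuousLinearMap.id ℝ _ := by
    rw [← mfderivWithin_id U]
    apply mfderivWithin_congr
    · intro z hz
      exact (φ.extend (𝓡∂ (n + 1))).right_inv hz
    · exact (φ.extend (𝓡∂ (n + 1))).right_inv hq
  rw [h4] at h3
  exact (DFunLike.congr_fun h3 v).symm

lemma chartFrame_mfderiv {φ : OpenPartialHomeomorph X (EuclideanHalfSpace (n + 1))}
    (hφ : φ ∈ IsManifold.maximalAtlas (𝓡∂ (n + 1)) ∞ X) {q : Coord n}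
    (hq : q ∈ (φ.extend (𝓡∂ (n + 1))).target)
    (v : TangentSpace (𝓡∂ (n + 1)) ((φ.extend (𝓡∂ (n + 1))).symm q)) :
    chartFrame φ q (mfderiv (𝓡∂ (n + 1)) 𝓘(ℝ, Coord n) (φ.extend (𝓡∂ (n + 1)))
      ((φ.extend (𝓡∂ (n + 1))).symm q) v) = v := by
  have hx := extend_symm_mem_source hq
  have U : UniqueMDiffWithinAt (𝓡∂ (n + 1)) φ.source ((φ.extend (𝓡∂ (n + 1))).symm q) :=
    φ.open_source.uniqueMDiffWithinAt hx
  have h1 : MDifferentiableAt (𝓡∂ (n + 1)) 𝓘(ℝ, Coord n) (φ.extend (𝓡∂ (n + 1)))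
      ((φ.extend (𝓡∂ (n + 1))).symm q) :=
    (φ.contMDiffAt_extend hφ hx).mdifferentiableAt (by simp)
  have h2 := (contMDiffOn_extend_symm_target hφ q hq).mdifferentiableWithinAt (by simp)
  have h3 := mfderivWithin_comp_of_eq (u := (φ.extend (𝓡∂ (n + 1))).target) (s := φ.source) h2
    (h1.mdifferentiableWithinAt) (fun z hz => extend_mem_target hz) U
    ((φ.extend (𝓡∂ (n + 1))).right_inv hq)
  have h4 : mfderivWithin (𝓡∂ (n + 1)) (𝓡∂ (n + 1))
      ((φ.extend (𝓡∂ (n + 1))).symm ∘ (φ.extend (𝓡∂ (n + 1)))) φ.source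
      ((φ.extend (𝓡∂ (n + 1))).symm q) = ContinuousLinearMap.id ℝ _ := by
    rw [← mfderivWithin_id U]
    exact mfderivWithin_congr (fun z hz => extend_leftInv hz) (extend_leftInv hx)
  rw [h4, mfderivWithin_eq_mfderiv U h1] at h3
  exact (DFunLike.congr_fun h3 v).symm

abbrev SmoothMetric (n : ℕ) (X : Type*) [TopologicalSpace X]
    [ChartedSpace (EuclideanHalfSpace (n + 1)) X] [IsManifold (𝓡∂ (n + 1)) ∞ X] : Type _ :=
  Bundle.ContMDiffRiemannianMetric (𝓡∂ (n + 1)) ∞ (Coord n)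
      (fun p : X => TangentSpace (𝓡∂ (n + 1)) p)

/-- The metric `gbar` in the chart `φ`. -/
def chartMetric (gbar : SmoothMetric n X)
    (φ : OpenPartialHomeomorph X (EuclideanHalfSpace (n + 1))) (q : Coord n) :
    Coord n →L[ℝ] Coord n →L[ℝ] ℝ :=
  (ContinuousLinearMap.precomp ℝ (chartFrame φ q)).comp
    ((gbar.inner ((φ.extend (𝓡∂ (n + 1))).symm q)).comp (chartFrame φ q))

lemma chartMetric_symm (gbar : SmoothMetric n X)
    (φ : OpenPartialHomeomorph X (EuclideanHalfSpace (n + 1))) (q v w : Coord n) :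
    chartMetric gbar φ q v w = chartMetric gbar φ q w v :=
  gbar.symm _ _ _

lemma chartMetric_pos (gbar : SmoothMetric n X)
    {φ : OpenPartialHomeomorph X (EuclideanHalfSpace (n + 1))}
    (hφ : φ ∈ IsManifold.maximalAtlas (𝓡∂ (n + 1)) ∞ X) {q : Coord n}
    (hq : q ∈ (φ.extend (𝓡∂ (n + 1))).target) (v : Coord n) (hv : v ≠ 0) :
    0 < chartMetric gbar φ q v v := by
  apply gbar.pos
  intro h
  apply hv
  refine (mfderiv_chartFrame hφ hq v).symm.trans ?_
  exact (congrArg (mfderiv (𝓡∂ (n + 1)) 𝓘(ℝ, Coord n) (φ.extend (𝓡∂ (n + 1)))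
    ((φ.extend (𝓡∂ (n + 1))).symm q)) h).trans (map_zero _)

lemma chartFrame_contMDiffOn {φ : OpenPartialHomeomorph X (EuclideanHalfSpace (n + 1))}
    (hφ : φ ∈ IsManifold.maximalAtlas (𝓡∂ (n + 1)) ∞ X) (v : Coord n) :
    ContMDiffOn 𝓘(ℝ, Coord n) ((𝓡∂ (n + 1)).prod 𝓘(ℝ, Coord n)) ∞
      (fun q => Bundle.TotalSpace.mk' (Coord n) (E := fun p : X => TangentSpace (𝓡∂ (n + 1)) p)
        ((φ.extend (𝓡∂ (n + 1))).symm q) (chartFrame φ q v))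
      (φ.extend (𝓡∂ (n + 1))).target := by
  have h1 := (contMDiffOn_extend_symm_target hφ).contMDiffOn_tangentMapWithin (m := ∞) (by simp)
    (uniqueDiffOn_extend_target φ).uniqueMDiffOn
  have h2 : ContMDiff 𝓘(ℝ, Coord n) 𝓘(ℝ, Coord n).tangent ∞
      (fun q : Coord n => (⟨q, v⟩ : TangentBundle 𝓘(ℝ, Coord n) (Coord n))) := by
    exact contMDiff_vectorSpace_iff_contDiff.2 contDiff_const
  exact h1.comp h2.contMDiffOn fun q hq => hq

lemma chartMetric_contDiffOn (gbar : SmoothMetric n X)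
    {φ : OpenPartialHomeomorph X (EuclideanHalfSpace (n + 1))}
    (hφ : φ ∈ IsManifold.maximalAtlas (𝓡∂ (n + 1)) ∞ X) (v w : Coord n) :
    ContDiffOn ℝ ∞ (fun q => chartMetric gbar φ q v w) (φ.extend (𝓡∂ (n + 1))).target := by
  rw [← contMDiffOn_iff_contDiffOn]
  have h := ContMDiffOn.clm_bundle_apply₂ (F₁ := Coord n) (F₂ := Coord n) (F₃ := ℝ)
    (E₃ := Bundle.Trivial X ℝ)
    (gbar.contMDiff.comp_contMDiffOn (contMDiffOn_extend_symm_target hφ))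
    (chartFrame_contMDiffOn hφ v) (chartFrame_contMDiffOn hφ w)
  intro q hq
  have h' := h q hq
  rw [Bundle.contMDiffWithinAt_totalSpace] at h'
  exact h'.2

end

/-! ### The symbol and the defining function in a chart. -/

section

variable {n : ℕ} {X : Type*} [TopologicalSpace X] [ChartedSpace (EuclideanHalfSpace (n + 1)) X]
  [IsManifold (𝓡∂ (n + 1)) ∞ X]

/-- The covector is dual, with respect to `g`, to `a` times the image of `sharpOp p` under the
frame, so `coNormSq_apply_self` evaluates it. It serves twice: with `a = x²` at interior points, and
with `g = gbar`, `a = 1` at a boundary point. -/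
lemma coNormSq_covec_comp_mfderiv (gbar : SmoothMetric n X)
    {φ : OpenPartialHomeomorph X (EuclideanHalfSpace (n + 1))}
    (hφ : φ ∈ IsManifold.maximalAtlas (𝓡∂ (n + 1)) ∞ X) {q : Coord n}
    (hq : q ∈ (φ.extend (𝓡∂ (n + 1))).target) {g : BilinField n X} {a : ℝ} (ha : 0 < a)
    (hg : gbar.inner ((φ.extend (𝓡∂ (n + 1))).symm q) = a • g ((φ.extend (𝓡∂ (n + 1))).symm q))
    (p : Coord n) :
    coNormSq (g ((φ.extend (𝓡∂ (n + 1))).symm q))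
      ((covec p).comp (mfderiv (𝓡∂ (n + 1)) 𝓘(ℝ, Coord n) (φ.extend (𝓡∂ (n + 1)))
        ((φ.extend (𝓡∂ (n + 1))).symm q))) =
      a * inner ℝ (sharpOp (chartMetric gbar φ q) p) p := by
  have hpos := chartMetric_pos gbar hφ hq
  have hB (v w : TangentSpace (𝓡∂ (n + 1)) ((φ.extend (𝓡∂ (n + 1))).symm q)) :
      gbar.inner ((φ.extend (𝓡∂ (n + 1))).symm q) v w =
        a * g ((φ.extend (𝓡∂ (n + 1))).symm q) v w := by
    rw [hg]; rfl
  have hs (v w : TangentSpace (𝓡∂ (n + 1)) ((φ.extend (𝓡∂ (n + 1))).symm q)) :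
      g ((φ.extend (𝓡∂ (n + 1))).symm q) v w = g ((φ.extend (𝓡∂ (n + 1))).symm q) w v := by
    have := gbar.symm ((φ.extend (𝓡∂ (n + 1))).symm q) v w
    rw [hB, hB] at this
    exact mul_left_cancel₀ ha.ne' this
  have hp (v : TangentSpace (𝓡∂ (n + 1)) ((φ.extend (𝓡∂ (n + 1))).symm q)) (hv : v ≠ 0) :
      0 < g ((φ.extend (𝓡∂ (n + 1))).symm q) v v := by
    have := gbar.pos ((φ.extend (𝓡∂ (n + 1))).symm q) v hv
    rw [hB] at this
    exact pos_of_mul_pos_right this ha.le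
  set v := sharpOp (chartMetric gbar φ q) p with hv
  have hTv (w : TangentSpace (𝓡∂ (n + 1)) ((φ.extend (𝓡∂ (n + 1))).symm q)) :
      gbar.inner ((φ.extend (𝓡∂ (n + 1))).symm q) (chartFrame φ q v) w =
      covec p (mfderiv (𝓡∂ (n + 1)) 𝓘(ℝ, Coord n) (φ.extend (𝓡∂ (n + 1)))
        ((φ.extend (𝓡∂ (n + 1))).symm q) w) := by
    conv_lhs => rw [← chartFrame_mfderiv hφ hq w]
    exact apply_sharpOp hpos p _
  have hcov : (covec p).comp (mfderiv (𝓡∂ (n + 1)) 𝓘(ℝ, Coord n) (φ.extend (𝓡∂ (n + 1)))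
        ((φ.extend (𝓡∂ (n + 1))).symm q)) =
      g ((φ.extend (𝓡∂ (n + 1))).symm q) (a • chartFrame φ q v) := by
    ext w
    refine (hTv w).symm.trans ?_
    rw [hB, map_smul]
    rfl
  refine (congrArg (coNormSq (g ((φ.extend (𝓡∂ (n + 1))).symm q))) hcov).trans ?_
  refine (coNormSq_apply_self (B := g ((φ.extend (𝓡∂ (n + 1))).symm q)) hs hp
    (a • chartFrame φ q v)).trans ?_
  have h1 : g ((φ.extend (𝓡∂ (n + 1))).symm q) (a • chartFrame φ q v) (a • chartFrame φ q v) =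
      a * (a * g ((φ.extend (𝓡∂ (n + 1))).symm q) (chartFrame φ q v) (chartFrame φ q v)) := by
    rw [map_smul, map_smul]
    rfl
  refine h1.trans ?_
  rw [← hB, hTv]
  congr 1
  refine (congrArg (covec p) (mfderiv_chartFrame hφ hq v)).trans ?_
  simp [real_inner_comm]

/-- The interior is defined through preferred charts. For another chart of the atlas one uses that a
map with surjective derivative sends interior points to interior points; the same principle, applied
to the chart itself, gives the converse. -/
lemma extend_symm_mem_interior {φ : OpenPartialHomeomorph X (EuclideanHalfSpace (n + 1))}
    (hφ : φ ∈ IsManifold.maximalAtlas (𝓡∂ (n + 1)) ∞ X) {q : Coord n}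
    (hq : q ∈ interior (φ.extend (𝓡∂ (n + 1))).target) :
    (φ.extend (𝓡∂ (n + 1))).symm q ∈ (𝓡∂ (n + 1)).interior X := by
  have hq' := interior_subset hq
  have hn := mem_interior_iff_mem_nhds.1 hq
  have h1 : MDifferentiableAt 𝓘(ℝ, Coord n) (𝓡∂ (n + 1)) (φ.extend (𝓡∂ (n + 1))).symm q :=
    ((contMDiffOn_extend_symm_target hφ q hq').mdifferentiableWithinAt
      (by simp)).mdifferentiableAt hn
  refine h1.isInteriorPoint_of_surjective_mfderiv ?_ BoundarylessManifold.isInteriorPoint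
  rw [← mfderivWithin_eq_mfderiv ((uniqueDiffOn_extend_target φ).uniqueMDiffOn q hq') h1]
  exact fun v => ⟨_, chartFrame_mfderiv hφ hq' v⟩

lemma extend_pos_of_mem_interior {φ : OpenPartialHomeomorph X (EuclideanHalfSpace (n + 1))}
    (hφ : φ ∈ IsManifold.maximalAtlas (𝓡∂ (n + 1)) ∞ X) {x : X} (hx : x ∈ φ.source)
    (hi : x ∈ (𝓡∂ (n + 1)).interior X) : 0 < φ.extend (𝓡∂ (n + 1)) x 0 := by
  have hd : φ.MDifferentiable (𝓡∂ (n + 1)) (𝓡∂ (n + 1)) :=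
    ⟨(contMDiffOn_of_mem_maximalAtlas hφ).mdifferentiableOn (by simp),
      (contMDiffOn_symm_of_mem_maximalAtlas hφ).mdifferentiableOn (by simp)⟩
  have h := (hd.mdifferentiableAt hx).isInteriorPoint_of_surjective_mfderiv
    (hd.mfderiv_surjective hx) hi
  have h2 := interior_range_modelWithCornersEuclideanHalfSpace (n + 1)
  rw [ModelWithCorners.isInteriorPoint_iff] at h
  have h3 := (interior_mono (extChartAt_target_subset_range _)) h
  rw [h2] at h3
  exact h3

/-- The boundary defining function `x` in the chart `φ`. -/
def chartDefining (x : X → ℝ) (φ : OpenPartialHomeomorph X (EuclideanHalfSpace (n + 1)))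
    (q : Coord n) : ℝ := x ((φ.extend (𝓡∂ (n + 1))).symm q)

section

variable {x : X → ℝ} (hx : IsBoundaryDefining (n := n) x)
  {φ : OpenPartialHomeomorph X (EuclideanHalfSpace (n + 1))}
  (hφ : φ ∈ IsManifold.maximalAtlas (𝓡∂ (n + 1)) ∞ X)

include hx hφ

lemma chartDefining_contDiffOn :
    ContDiffOn ℝ ∞ (chartDefining x φ) (φ.extend (𝓡∂ (n + 1))).target := by
  rw [← contMDiffOn_iff_contDiffOn]
  exact hx.smooth.comp_contMDiffOn (contMDiffOn_extend_symm_target hφ)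

lemma chartDefining_pos {q : Coord n} (hq : q ∈ interior (φ.extend (𝓡∂ (n + 1))).target) :
    0 < chartDefining x φ q := by
  refine lt_of_le_of_ne (hx.nonneg _) fun h => ?_
  have h1 := (hx.eq_zero_iff _).1 h.symm
  rw [← ModelWithCorners.compl_interior] at h1
  exact h1 (extend_symm_mem_interior hφ hq)

lemma chartDefining_eq_zero {q : Coord n} (hq : q ∈ (φ.extend (𝓡∂ (n + 1))).target)
    (h0 : q 0 = 0) : chartDefining x φ q = 0 := by
  refine (hx.eq_zero_iff _).2 ?_
  rw [← ModelWithCorners.compl_interior]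
  intro hi
  have := extend_pos_of_mem_interior hφ (extend_symm_mem_source hq) hi
  rw [(φ.extend (𝓡∂ (n + 1))).right_inv hq, h0] at this
  exact lt_irrefl _ this

end

end

/-! ### Boundary limits of quotients by the transversal coordinate. -/

section

variable {n : ℕ}

lemma norm_smul_add_smul_le {V : Type*} [NormedAddCommGroup V] [NormedSpace ℝ V] (a b : ℝ)
    (u w : V) : ‖a • u + b • w‖ ≤ ‖a‖ * ‖u‖ + ‖b‖ * ‖w‖ :=
  (norm_add_le _ _).trans_eq (by rw [norm_smul, norm_smul])

section Limit

variable {U : Set (Coord n)} {q₀ : Coord n} {r : Coord n → ℝ} {F : Type*} [NormedAddCommGroup F]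
  [NormedSpace ℝ F] {M : Coord n → F}

lemma openHalfSpace_subset : {q : Coord n | 0 < q 0} ⊆ {q : Coord n | 0 ≤ q 0} := by
  intro q hq
  have h : 0 < q 0 := hq
  exact h.le

lemma uniqueDiffOn_inter_halfSpace (hU : IsOpen U) :
    UniqueDiffOn ℝ (U ∩ {q : Coord n | 0 ≤ q 0}) := by
  rw [inter_comm, ← range_modelWithCornersEuclideanHalfSpace]
  exact (𝓡∂ (n + 1)).uniqueDiffOn.inter hU

lemma inter_halfSpace_mem_nhds (hU : IsOpen U) {q : Coord n} (hq : q ∈ U) (h0 : 0 < q 0) :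
    U ∩ {q : Coord n | 0 ≤ q 0} ∈ 𝓝 q := by
  have hc : Continuous fun q : Coord n => q 0 := by fun_prop
  exact inter_mem (hU.mem_nhds hq)
    (mem_of_superset ((isOpen_lt continuous_const hc).mem_nhds h0) openHalfSpace_subset)

/-- A line in a tangential direction stays in the boundary hyperplane on both sides of `q₀`, so a
derivative within the half space suffices to differentiate the zero function along it. -/
lemma fderivWithin_tangential (hU : IsOpen U) (hq₀ : q₀ ∈ U) (h0 : q₀ 0 = 0)
    (hr : DifferentiableWithinAt ℝ r (U ∩ {q : Coord n | 0 ≤ q 0}) q₀)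
    (hr0 : ∀ q ∈ U, q 0 = 0 → r q = 0) {v : Coord n} (hv : v 0 = 0) :
    fderivWithin ℝ r (U ∩ {q : Coord n | 0 ≤ q 0}) q₀ v = 0 := by
  have hline : HasDerivAt (fun t : ℝ => q₀ + t • v) v 0 := by
    simpa using ((hasDerivAt_id (0 : ℝ)).smul_const v).const_add q₀
  have hcont : ContinuousAt (fun t : ℝ => q₀ + t • v) 0 := hline.continuousAt
  have hmem : ∀ᶠ t : ℝ in 𝓝 0, q₀ + t • v ∈ U := by
    apply hcont.preimage_mem_nhds
    simpa using hU.mem_nhds hq₀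
  have h1 : HasFDerivWithinAt r (fderivWithin ℝ r (U ∩ {q : Coord n | 0 ≤ q 0}) q₀)
      (U ∩ {q : Coord n | 0 ≤ q 0}) (q₀ + (0 : ℝ) • v) := by
    simpa using hr.hasFDerivWithinAt
  have hmaps : MapsTo (fun t : ℝ => q₀ + t • v) {t : ℝ | q₀ + t • v ∈ U}
      (U ∩ {q : Coord n | 0 ≤ q 0}) := fun t ht => ⟨ht, by simp [h0, hv]⟩
  have h2 := h1.comp_hasDerivWithinAt (0 : ℝ) hline.hasDerivWithinAt hmaps
  have h3 := h2.hasDerivAt hmem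
  have h4 : HasDerivAt (r ∘ fun t : ℝ => q₀ + t • v) 0 0 := by
    refine (hasDerivAt_const (0 : ℝ) (0 : ℝ)).congr_of_eventuallyEq ?_
    filter_upwards [hmem] with t ht
    exact hr0 _ ht (by simp [h0, hv])
  exact h3.unique h4

lemma fderivWithin_eq_smul_proj (hU : IsOpen U) (hq₀ : q₀ ∈ U) (h0 : q₀ 0 = 0)
    (hr : DifferentiableWithinAt ℝ r (U ∩ {q : Coord n | 0 ≤ q 0}) q₀)
    (hr0 : ∀ q ∈ U, q 0 = 0 → r q = 0) :
    fderivWithin ℝ r (U ∩ {q : Coord n | 0 ≤ q 0}) q₀ =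
      fderivWithin ℝ r (U ∩ {q : Coord n | 0 ≤ q 0}) q₀ (basisVec 0) •
        (EuclideanSpace.proj 0 : Coord n →L[ℝ] ℝ) := by
  ext v
  have h := fderivWithin_tangential hU hq₀ h0 hr hr0 (v := v - v 0 • basisVec 0) (by simp)
  rw [map_sub, map_smul, sub_eq_zero] at h
  simp [h, mul_comm]

/-- Mean value inequality on the vertical segment from the foot `q - q 0 • basisVec 0`, where `r`
vanishes, to `q`; near `q₀` the derivative differs little from its value at `q₀`. -/
lemma tendsto_div_coord (hU : IsOpen U) (hq₀ : q₀ ∈ U) (h0 : q₀ 0 = 0)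
    (hr : ContDiffOn ℝ ∞ r (U ∩ {q : Coord n | 0 ≤ q 0}))
    (hr0 : ∀ q ∈ U, q 0 = 0 → r q = 0) :
    Tendsto (fun q => r q / q 0) (𝓝[{q : Coord n | 0 < q 0}] q₀)
      (𝓝 (fderivWithin ℝ r (U ∩ {q : Coord n | 0 ≤ q 0}) q₀ (basisVec 0))) := by
  set S := U ∩ {q : Coord n | 0 ≤ q 0} with hS
  have hqS : q₀ ∈ S := ⟨hq₀, h0.ge⟩
  have hcont := (hr.continuousOn_fderivWithin (uniqueDiffOn_inter_halfSpace hU) (by simp)) q₀ hqS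
  rw [Metric.tendsto_nhds]
  intro ε hε
  obtain ⟨δ, hδ, hδ'⟩ := Metric.continuousWithinAt_iff.1 hcont (ε / 2) (by positivity)
  obtain ⟨δ₁, hδ₁, hδ₁'⟩ := Metric.isOpen_iff.1 hU q₀ hq₀
  -- Half the radius, because the foot of `q` can be twice as far from `q₀` in the estimate below.
  have hball : Metric.ball q₀ (min δ δ₁ / 2) ∈ 𝓝 q₀ := Metric.ball_mem_nhds _ (by positivity)
  filter_upwards [mem_nhdsWithin_of_mem_nhds hball, self_mem_nhdsWithin] with q hq hq0
  have hq0' : 0 < q 0 := hq0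
  set s := Metric.ball q₀ (min δ δ₁) ∩ {q : Coord n | 0 ≤ q 0} with hs
  have hconv : Convex ℝ s := (convex_ball _ _).inter
    (convex_halfSpace_ge (f := fun q : Coord n => q 0) ⟨fun _ _ => rfl, fun _ _ => rfl⟩ 0)
  have hsS : s ⊆ S := fun z hz =>
    ⟨hδ₁' (Metric.ball_subset_ball (min_le_right _ _) hz.1), hz.2⟩
  have hd : ∀ z ∈ s, HasFDerivWithinAt r (fderivWithin ℝ r S z) s z := fun z hz =>
    ((hr.differentiableOn (by simp)) z (hsS hz)).hasFDerivWithinAt.mono hsS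
  have hb : ∀ z ∈ s, ‖fderivWithin ℝ r S z - fderivWithin ℝ r S q₀‖ ≤ ε / 2 := fun z hz => by
    rw [← dist_eq_norm]
    exact (hδ' (hsS hz) (lt_of_lt_of_le hz.1 (min_le_left _ _))).le
  have hqd : ‖q - q₀‖ < min δ δ₁ / 2 := by rwa [← dist_eq_norm]
  have hq0n : |q 0| ≤ ‖q - q₀‖ := by
    have := PiLp.norm_apply_le (q - q₀) 0
    simpa [h0] using this
  have hqs : q ∈ s := ⟨by rw [mem_ball_iff_norm]; linarith [norm_nonneg (q - q₀)], hq0'.le⟩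
  have hq's : q - q 0 • basisVec 0 ∈ s := by
    refine ⟨?_, by simp⟩
    rw [mem_ball_iff_norm]
    calc ‖q - q 0 • basisVec 0 - q₀‖ = ‖(q - q₀) - q 0 • (basisVec 0 : Coord n)‖ := by
          congr 1; abel
      _ ≤ ‖q - q₀‖ + ‖q 0 • (basisVec 0 : Coord n)‖ := norm_sub_le _ _
      _ = ‖q - q₀‖ + |q 0| := by simp [norm_smul]
      _ < min δ δ₁ := by linarith
  have key := hconv.norm_image_sub_le_of_norm_hasFDerivWithin_le' hd hb hq's hqs
  rw [hr0 _ (hsS hq's).1 (by simp), sub_sub_cancel, map_smul, norm_smul] at key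
  rw [Real.dist_eq, div_sub' hq0'.ne', abs_div, abs_of_pos hq0', div_lt_iff₀ hq0']
  have hk : |r q - q 0 * fderivWithin ℝ r S q₀ (basisVec 0)| ≤ ε / 2 * q 0 := by
    simpa [abs_of_pos hq0'] using key
  calc _ ≤ ε / 2 * q 0 := hk
    _ < ε * q 0 := by nlinarith

/-- The family of vectors `(r / q₀)² M`, for a function `r` which vanishes at the boundary. -/
def normalOp (r : Coord n → ℝ) (M : Coord n → F) (q : Coord n) : F := (r q / q 0) ^ 2 • M q

lemma tendsto_normalOp (hU : IsOpen U) (hq₀ : q₀ ∈ U) (h0 : q₀ 0 = 0)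
    (hr : ContDiffOn ℝ ∞ r (U ∩ {q : Coord n | 0 ≤ q 0}))
    (hr0 : ∀ q ∈ U, q 0 = 0 → r q = 0) (hM : ContDiffOn ℝ ∞ M (U ∩ {q : Coord n | 0 ≤ q 0})) :
    Tendsto (normalOp r M) (𝓝[{q : Coord n | 0 < q 0}] q₀)
      (𝓝 (fderivWithin ℝ r (U ∩ {q : Coord n | 0 ≤ q 0}) q₀ (basisVec 0) ^ 2 • M q₀)) := by
  have hsub : 𝓝[{q : Coord n | 0 < q 0}] q₀ ≤ 𝓝[U ∩ {q : Coord n | 0 ≤ q 0}] q₀ := by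
    rw [nhdsWithin_inter_of_mem (mem_nhdsWithin_of_mem_nhds (hU.mem_nhds hq₀))]
    exact nhdsWithin_mono _ openHalfSpace_subset
  exact ((tendsto_div_coord hU hq₀ h0 hr hr0).pow 2).smul
    ((hM.continuousOn q₀ ⟨hq₀, h0.ge⟩).mono_left hsub)

/-- The only singular term is `q 0 • D(r / q 0) = Dr - (r / q 0) dq₀`, and both parts tend to `c
dq₀` with the same `c`. Smoothness of `r / q 0` up to the boundary is thus not needed. -/
lemma tendsto_smul_fderiv_normalOp (hU : IsOpen U) (hq₀ : q₀ ∈ U) (h0 : q₀ 0 = 0)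
    (hr : ContDiffOn ℝ ∞ r (U ∩ {q : Coord n | 0 ≤ q 0}))
    (hr0 : ∀ q ∈ U, q 0 = 0 → r q = 0) (hM : ContDiffOn ℝ ∞ M (U ∩ {q : Coord n | 0 ≤ q 0})) :
    Tendsto (fun q => q 0 • fderiv ℝ (normalOp r M) q) (𝓝[{q : Coord n | 0 < q 0}] q₀) (𝓝 0) := by
  set S := U ∩ {q : Coord n | 0 ≤ q 0} with hS
  have hqS : q₀ ∈ S := ⟨hq₀, h0.ge⟩
  have hsub : 𝓝[{q : Coord n | 0 < q 0}] q₀ ≤ 𝓝[S] q₀ := by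
    rw [hS, nhdsWithin_inter_of_mem (mem_nhdsWithin_of_mem_nhds (hU.mem_nhds hq₀))]
    exact nhdsWithin_mono _ openHalfSpace_subset
  have hu := uniqueDiffOn_inter_halfSpace hU
  set c := fderivWithin ℝ r S q₀ (basisVec 0) with hc
  have hDr : Tendsto (fderivWithin ℝ r S) (𝓝[{q : Coord n | 0 < q 0}] q₀)
      (𝓝 (c • (EuclideanSpace.proj 0 : Coord n →L[ℝ] ℝ))) := by
    rw [hc, ← fderivWithin_eq_smul_proj hU hq₀ h0 (hr.differentiableOn (by simp) q₀ hqS) hr0]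
    exact ((hr.continuousOn_fderivWithin hu (by simp)) q₀ hqS).mono_left hsub
  have hDM : Tendsto (fderivWithin ℝ M S) (𝓝[{q : Coord n | 0 < q 0}] q₀)
      (𝓝 (fderivWithin ℝ M S q₀)) :=
    ((hM.continuousOn_fderivWithin hu (by simp)) q₀ hqS).mono_left hsub
  have hDMn : Tendsto (fun q => ‖fderivWithin ℝ M S q‖) (𝓝[{q : Coord n | 0 < q 0}] q₀)
      (𝓝 ‖fderivWithin ℝ M S q₀‖) :=
    Filter.Tendsto.norm  hDM
  have hα := tendsto_div_coord hU hq₀ h0 hr hr0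
  have hM0 : Tendsto M (𝓝[{q : Coord n | 0 < q 0}] q₀) (𝓝 (M q₀)) :=
    (hM.continuousOn q₀ hqS).mono_left hsub
  have hx : Tendsto (fun q : Coord n => q 0) (𝓝[{q : Coord n | 0 < q 0}] q₀) (𝓝 0) := by
    have : Continuous fun q : Coord n => q 0 := by fun_prop
    rw [← h0]
    exact this.continuousAt.mono_left nhdsWithin_le_nhds
  have h1 := ((hDr.sub (hα.smul_const (EuclideanSpace.proj 0 : Coord n →L[ℝ] ℝ))).norm).mul
    hM0.norm
  have h2 := ((hα.const_mul 2).norm.mul h1).add (((hα.pow 2).mul hx).norm.mul hDMn)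
  rw [sub_self, norm_zero, zero_mul, mul_zero, mul_zero, norm_zero, zero_mul, add_zero] at h2
  rw [tendsto_zero_iff_norm_tendsto_zero ]
  refine squeeze_zero' (Eventually.of_forall fun _ => norm_nonneg _) ?_ h2
  filter_upwards [self_mem_nhdsWithin, mem_nhdsWithin_of_mem_nhds (hU.mem_nhds hq₀)] with q hq hqU
  have hq0 : 0 < q 0 := hq
  have hn : S ∈ 𝓝 q := inter_halfSpace_mem_nhds hU hqU hq0
  have hqS' : q ∈ S := mem_of_mem_nhds hn
  have hr' : HasFDerivAt r (fderivWithin ℝ r S q) q :=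
    (hr.differentiableOn (by simp) q hqS').hasFDerivWithinAt.hasFDerivAt hn
  have hM' : HasFDerivAt M (fderivWithin ℝ M S q) q :=
    (hM.differentiableOn (by simp) q hqS').hasFDerivWithinAt.hasFDerivAt hn
  have hp : HasFDerivAt (fun q : Coord n => q 0) (EuclideanSpace.proj 0 : Coord n →L[ℝ] ℝ) q :=
    (EuclideanSpace.proj 0 : Coord n →L[ℝ] ℝ).hasFDerivAt
  have hdiv : HasFDerivAt (fun q => r q / q 0) ((q 0)⁻¹ • (fderivWithin ℝ r S q -
      (r q / q 0) • (EuclideanSpace.proj 0 : Coord n →L[ℝ] ℝ))) q := by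
    have hi : HasFDerivAt (fun q : Coord n => (q 0)⁻¹) _ q :=
      (hasDerivAt_inv hq0.ne').comp_hasFDerivAt q hp
    have h := hr'.mul hi
    simp only [div_eq_mul_inv]
    refine h.congr_fderiv ?_
    ext v
    simp
    field_simp
    ring
  have hder : HasFDerivAt (normalOp r M) _ q := (hdiv.pow 2).smul hM'
  have heq : q 0 • fderiv ℝ (normalOp r M) q = (2 * (r q / q 0)) • (fderivWithin ℝ r S q -
      (r q / q 0) • (EuclideanSpace.proj 0 : Coord n →L[ℝ] ℝ)).smulRight (M q) +
      ((r q / q 0) ^ 2 * q 0) • fderivWithin ℝ M S q := by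
    rw [hder.fderiv]
    ext v : 1
    simp only [smul_apply, add_apply, ContinuousLinearMap.smulRight_apply, smul_smul, smul_add,
      smul_eq_mul]
    rw [add_comm]
    congr 2
    · simp
      field_simp
    · exact mul_comm _ _
  rw [heq]
  refine (norm_smul_add_smul_le _ _ _ _).trans_eq ?_
  rw [ContinuousLinearMap.norm_smulRight_apply]

end Limit

end

/-! ### The coefficient operator near a boundary point. -/

section

variable {n : ℕ}

/-- The Hamiltonian `q₀² ⟪K(q) p, p⟫ - 1` on a region `Ω` of the open half space. -/
def zeroHam (K : Coord n → Coord n →L[ℝ] Coord n) (q p : Coord n) : ℝ :=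
  q 0 ^ 2 * inner ℝ (K q p) p - 1

/-- `K` is a smooth family of symmetric operators on the open subset `Ω` of the half space. -/
structure IsZeroFamily (Ω : Set (Coord n)) (K : Coord n → Coord n →L[ℝ] Coord n) : Prop where
  isOpen : IsOpen Ω
  pos : ∀ q ∈ Ω, 0 < q 0
  smooth : ContDiffOn ℝ ∞ K Ω
  symm : ∀ q ∈ Ω, ∀ v w, inner ℝ (K q v) w = inner ℝ v (K q w)

/-- `k` is a symmetric positive definite operator with `k₀₀ = 1`. -/
structure IsModelOp (k : Coord n →L[ℝ] Coord n) : Prop where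
  symm : ∀ v w, inner ℝ (k v) w = inner ℝ v (k w)
  pos : ∀ v, v ≠ 0 → 0 < inner ℝ (k v) v
  normal : inner ℝ (k (basisVec 0)) (basisVec 0) = 1

/-- The family `K` on `Ω` tends to `k` at the boundary point `q₀`. -/
structure IsZeroLimit (Ω : Set (Coord n)) (K : Coord n → Coord n →L[ℝ] Coord n) (q₀ : Coord n)
    (k : Coord n →L[ℝ] Coord n) : Prop where
  zero : q₀ 0 = 0
  mem_nhds : Ω ∈ 𝓝[{q : Coord n | 0 < q 0}] q₀
  model : IsModelOp k
  tendsto : Tendsto K (𝓝[{q : Coord n | 0 < q 0}] q₀) (𝓝 k)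
  tendsto_fderiv : Tendsto (fun q => q 0 • fderiv ℝ K q) (𝓝[{q : Coord n | 0 < q 0}] q₀) (𝓝 0)

variable {X : Type*} [TopologicalSpace X] [ChartedSpace (EuclideanHalfSpace (n + 1)) X]
  [IsManifold (𝓡∂ (n + 1)) ∞ X]

/-- The family of operators which represents the metric `x⁻² gbar` in the chart `φ`. -/
def chartOp (gbar : SmoothMetric n X) (x : X → ℝ)
    (φ : OpenPartialHomeomorph X (EuclideanHalfSpace (n + 1))) : Coord n → Coord n →L[ℝ] Coord n :=
  normalOp (chartDefining x φ) fun q => sharpOp (chartMetric gbar φ q)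

lemma sharpOp_chartMetric_contDiffOn (gbar : SmoothMetric n X)
    {φ : OpenPartialHomeomorph X (EuclideanHalfSpace (n + 1))}
    (hφ : φ ∈ IsManifold.maximalAtlas (𝓡∂ (n + 1)) ∞ X) :
    ContDiffOn ℝ ∞ (fun q => sharpOp (chartMetric gbar φ q)) (φ.extend (𝓡∂ (n + 1))).target :=
  sharpOp_contDiffOn (chartMetric_contDiffOn gbar hφ) fun _ hq => chartMetric_pos gbar hφ hq

lemma chartOp_isZeroFamily (gbar : SmoothMetric n X) {x : X → ℝ}
    (hx : IsBoundaryDefining (n := n) x) {φ : OpenPartialHomeomorph X (EuclideanHalfSpace (n + 1))}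
    (hφ : φ ∈ IsManifold.maximalAtlas (𝓡∂ (n + 1)) ∞ X) :
    IsZeroFamily (interior (φ.extend (𝓡∂ (n + 1))).target) (chartOp gbar x φ) where
  isOpen := isOpen_interior
  pos q hq := by
    rw [interior_extend_target] at hq
    exact hq.2
  smooth := by
    have hp : ContDiff ℝ ∞ fun q : Coord n => q 0 := by fun_prop
    refine ContDiffOn.smul (ContDiffOn.pow (ContDiffOn.div
      ((chartDefining_contDiffOn hx hφ).mono interior_subset) hp.contDiffOn fun q hq => ?_) 2)
      ((sharpOp_chartMetric_contDiffOn gbar hφ).mono interior_subset)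
    rw [interior_extend_target] at hq
    exact ne_of_gt hq.2
  symm q hq v w := by
    have h := inner_sharpOp_comm (chartMetric_symm gbar φ q)
      (chartMetric_pos gbar hφ (interior_subset hq)) v w
    simp [chartOp, normalOp, inner_smul_left, inner_smul_right, h]

lemma symbol_ofCoord (gbar : SmoothMetric n X) {x : X → ℝ}
    (hx : IsBoundaryDefining (n := n) x) {g : BilinField n X}
    (hg : ∀ p ∈ (𝓡∂ (n + 1)).interior X, gbar.inner p = x p ^ 2 • g p)
    {φ : OpenPartialHomeomorph X (EuclideanHalfSpace (n + 1))}
    (hφ : φ ∈ IsManifold.maximalAtlas (𝓡∂ (n + 1)) ∞ X) {q : Coord n}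
    (hq : q ∈ interior (φ.extend (𝓡∂ (n + 1))).target) (p : Coord n) :
    symbol g (ofCoord φ q p) = zeroHam (chartOp gbar x φ) q p := by
  have h := coNormSq_covec_comp_mfderiv gbar hφ (interior_subset hq)
    (pow_pos (chartDefining_pos hx hφ hq) 2) (hg _ (extend_symm_mem_interior hφ hq)) p
  have h0 : 0 < q 0 := (chartOp_isZeroFamily gbar hx hφ).pos q hq
  have h1 : symbol g (ofCoord φ q p) = chartDefining x φ q ^ 2 *
      inner ℝ (sharpOp (chartMetric gbar φ q) p) p - 1 := congrArg (· - 1) h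
  rw [h1, zeroHam, chartOp, normalOp, smul_apply, inner_smul_left]
  simp
  field_simp

lemma chart_boundary_zero {φ : OpenPartialHomeomorph X (EuclideanHalfSpace (n + 1))}
    (hφ : φ ∈ IsManifold.maximalAtlas (𝓡∂ (n + 1)) ∞ X) {y₀ : X} (hy₀φ : y₀ ∈ φ.source)
    (hy₀ : y₀ ∈ (𝓡∂ (n + 1)).boundary X) : φ.extend (𝓡∂ (n + 1)) y₀ 0 = 0 := by
  have ht := extend_mem_target hy₀φ
  by_contra h
  have h2 : φ.extend (𝓡∂ (n + 1)) y₀ ∈ interior (φ.extend (𝓡∂ (n + 1))).target := by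
    rw [interior_extend_target]
    refine ⟨ht, lt_of_le_of_ne ?_ (Ne.symm h)⟩
    rw [extend_target_eq] at ht
    exact ht.2
  have h3 := extend_symm_mem_interior hφ h2
  rw [extend_leftInv hy₀φ] at h3
  rw [← ModelWithCorners.compl_interior] at hy₀
  exact hy₀ h3

lemma mfderiv_defining {x : X → ℝ} (hx : IsBoundaryDefining (n := n) x)
    {φ : OpenPartialHomeomorph X (EuclideanHalfSpace (n + 1))}
    (hφ : φ ∈ IsManifold.maximalAtlas (𝓡∂ (n + 1)) ∞ X) {q : Coord n}
    (hq : q ∈ (φ.extend (𝓡∂ (n + 1))).target)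
    (v : TangentSpace (𝓡∂ (n + 1)) ((φ.extend (𝓡∂ (n + 1))).symm q)) :
    mfderiv (𝓡∂ (n + 1)) 𝓘(ℝ, ℝ) x ((φ.extend (𝓡∂ (n + 1))).symm q) v =
      fderivWithin ℝ (chartDefining x φ) (φ.extend (𝓡∂ (n + 1))).target q
        (mfderiv (𝓡∂ (n + 1)) 𝓘(ℝ, Coord n) (φ.extend (𝓡∂ (n + 1)))
          ((φ.extend (𝓡∂ (n + 1))).symm q) v) := by
  have U : UniqueMDiffWithinAt 𝓘(ℝ, Coord n) (φ.extend (𝓡∂ (n + 1))).target q :=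
    (uniqueDiffOn_extend_target φ).uniqueMDiffOn q hq
  have h := mfderiv_comp_mfderivWithin q
    ((hx.smooth.contMDiffAt (x := (φ.extend (𝓡∂ (n + 1))).symm q)).mdifferentiableAt (by simp))
    ((contMDiffOn_extend_symm_target hφ q hq).mdifferentiableWithinAt (by simp)) U
  rw [← mfderivWithin_eq_fderivWithin]
  refine Eq.trans ?_ (DFunLike.congr_fun h _).symm
  exact congrArg (mfderiv (𝓡∂ (n + 1)) 𝓘(ℝ, ℝ) x ((φ.extend (𝓡∂ (n + 1))).symm q))
    (chartFrame_mfderiv hφ hq v).symm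

/-- At the boundary point `dx` is `c` times the differential of the transversal coordinate, so the
limit is `c²` times the dual metric of `gbar`. The condition `|dx| = 1` becomes the normalisation in
`IsModelOp`. -/
lemma exists_isZeroLimit (gbar : SmoothMetric n X) {x : X → ℝ}
    (hx : IsBoundaryDefining (n := n) x)
    (hn : ∀ p ∈ (𝓡∂ (n + 1)).boundary X,
      coNormSq (gbar.inner p) (mfderiv (𝓡∂ (n + 1)) 𝓘(ℝ, ℝ) x p) = 1)
    {φ : OpenPartialHomeomorph X (EuclideanHalfSpace (n + 1))}
    (hφ : φ ∈ IsManifold.maximalAtlas (𝓡∂ (n + 1)) ∞ X) {y₀ : X} (hy₀φ : y₀ ∈ φ.source)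
    (hy₀ : y₀ ∈ (𝓡∂ (n + 1)).boundary X) :
    ∃ k, IsZeroLimit (interior (φ.extend (𝓡∂ (n + 1))).target) (chartOp gbar x φ)
      (φ.extend (𝓡∂ (n + 1)) y₀) k := by
  set q₀ := φ.extend (𝓡∂ (n + 1)) y₀ with hq₀
  set U : Set (Coord n) := (𝓡∂ (n + 1)).symm ⁻¹' φ.target with hU
  have hUo : IsOpen U := isOpen_symm_preimage_target φ
  have hT : (φ.extend (𝓡∂ (n + 1))).target = U ∩ {q : Coord n | 0 ≤ q 0} := extend_target_eq φ
  have hqT : q₀ ∈ (φ.extend (𝓡∂ (n + 1))).target := extend_mem_target hy₀φ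
  have h0 : q₀ 0 = 0 := chart_boundary_zero hφ hy₀φ hy₀
  have hqU : q₀ ∈ U := by rw [hT] at hqT; exact hqT.1
  have hr := chartDefining_contDiffOn hx hφ
  have hr0 : ∀ q ∈ U, q 0 = 0 → chartDefining x φ q = 0 := fun q hq h =>
    chartDefining_eq_zero hx hφ (by rw [hT]; exact ⟨hq, h.ge⟩) h
  have hM := sharpOp_chartMetric_contDiffOn gbar hφ
  set c := fderivWithin ℝ (chartDefining x φ) (φ.extend (𝓡∂ (n + 1))).target q₀ (basisVec 0)
    with hc
  have hnorm : c ^ 2 * inner ℝ (sharpOp (chartMetric gbar φ q₀) (basisVec 0)) (basisVec 0) = 1 := by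
    have hb : (φ.extend (𝓡∂ (n + 1))).symm q₀ ∈ (𝓡∂ (n + 1)).boundary X := by
      rwa [hq₀, extend_leftInv hy₀φ]
    have h1 := coNormSq_covec_comp_mfderiv gbar hφ hqT (g := gbar.inner) one_pos
      (by rw [one_smul]) (c • basisVec 0)
    have h2 : (covec (c • basisVec 0)).comp (mfderiv (𝓡∂ (n + 1)) 𝓘(ℝ, Coord n)
        (φ.extend (𝓡∂ (n + 1))) ((φ.extend (𝓡∂ (n + 1))).symm q₀)) =
        mfderiv (𝓡∂ (n + 1)) 𝓘(ℝ, ℝ) x ((φ.extend (𝓡∂ (n + 1))).symm q₀) := by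
      ext v
      refine Eq.trans ?_ (mfderiv_defining hx hφ hqT v).symm
      have h3 : fderivWithin ℝ (chartDefining x φ) (φ.extend (𝓡∂ (n + 1))).target q₀ =
          covec (c • basisVec 0) := by
        have h4 := fderivWithin_eq_smul_proj hUo hqU h0
          (by rw [← hT]; exact hr.differentiableOn (by simp) q₀ hqT) hr0
        rw [← hT] at h4
        rw [h4, ← hc]
        ext w
        change c * w 0 = inner ℝ (c • (basisVec 0 : Coord n)) w
        rw [inner_smul_left, real_inner_comm, inner_basisVec]
        rfl
      rw [h3]
      rfl
    have h5 := (congrArg (coNormSq (gbar.inner ((φ.extend (𝓡∂ (n + 1))).symm q₀))) h2).symm.trans h1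
    rw [hn _ hb] at h5
    rw [h5]
    simp [inner_smul_left, inner_smul_right]
    ring
  -- That `c` does not vanish follows from the normalisation alone.
  have hc0 : 0 < c ^ 2 := by
    refine lt_of_le_of_ne (sq_nonneg c) fun h => ?_
    rw [← h, zero_mul] at hnorm
    exact zero_ne_one hnorm
  refine ⟨c ^ 2 • sharpOp (chartMetric gbar φ q₀), h0, ?_, ⟨fun v w => ?_, fun v hv => ?_, ?_⟩,
    ?_, ?_⟩
  · rw [interior_extend_target, hT]
    filter_upwards [mem_nhdsWithin_of_mem_nhds (hUo.mem_nhds hqU), self_mem_nhdsWithin] with q h1 h2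
    exact ⟨⟨h1, openHalfSpace_subset h2⟩, h2⟩
  · have h := inner_sharpOp_comm (chartMetric_symm gbar φ q₀) (chartMetric_pos gbar hφ hqT) v w
    simp [inner_smul_left, inner_smul_right, h]
  · have h := inner_sharpOp_pos (chartMetric_pos gbar hφ hqT) hv
    simp only [smul_apply, inner_smul_left]
    exact mul_pos hc0 h
  · simpa [inner_smul_left] using hnorm
  · rw [hT] at hr hM hc
    rw [hc]
    exact tendsto_normalOp hUo hqU h0 hr hr0 hM
  · rw [hT] at hr hM
    exact tendsto_smul_fderiv_normalOp hUo hqU h0 hr hr0 hM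

end

/-! ### Hamilton's equations and changes of coordinates. -/

section

variable {n : ℕ}

lemma inner_gradient_right {H : Coord n → Coord n → ℝ} {q p : Coord n}
    (h : DifferentiableAt ℝ (Function.uncurry H) (q, p)) (w : Coord n) :
    inner ℝ (∇ (fun p' => H q p') p) w = fderiv ℝ (Function.uncurry H) (q, p) (0, w) := by
  have h1 : HasFDerivAt (fun p' => H q p') _ p :=
    h.hasFDerivAt.comp p (hasFDerivAt_prodMk_right q p)
  rw [gradient, InnerProductSpace.toDual_symm_apply, h1.fderiv]
  simp

lemma inner_gradient_left {H : Coord n → Coord n → ℝ} {q p : Coord n}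
    (h : DifferentiableAt ℝ (Function.uncurry H) (q, p)) (v : Coord n) :
    inner ℝ (∇ (fun q' => H q' p) q) v = fderiv ℝ (Function.uncurry H) (q, p) (v, 0) := by
  have h1 : HasFDerivAt (fun q' => H q' p) _ q :=
    HasFDerivAt.comp (g := Function.uncurry H) (f := fun q' => (q', p)) q h.hasFDerivAt
      (hasFDerivAt_prodMk_left q p)
  rw [gradient, InnerProductSpace.toDual_symm_apply, h1.fderiv]
  simp

/-- The form `dH = ⟪q', ·⟫ - ⟪p', ·⟫` of the equations, a contraction with the symplectic form,
avoids gradients and suits the chain rule. -/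
lemma hamiltonAt_iff {H : Coord n → Coord n → ℝ} {S : Set ℝ} {q p : ℝ → Coord n} {t : ℝ}
    (h : DifferentiableAt ℝ (Function.uncurry H) (q t, p t)) :
    HamiltonAt H S q p t ↔ ∃ q' p', HasDerivWithinAt q q' S t ∧ HasDerivWithinAt p p' S t ∧
      ∀ v w, fderiv ℝ (Function.uncurry H) (q t, p t) (v, w) = inner ℝ q' w - inner ℝ p' v := by
  constructor
  · rintro ⟨h1, h2⟩
    refine ⟨_, _, h1, h2, fun v w => ?_⟩
    have hvw : ((v, w) : Coord n × Coord n) = (v, 0) + (0, w) := by simp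
    rw [hvw, map_add, ← inner_gradient_right h, ← inner_gradient_left h, inner_neg_left]
    ring
  · rintro ⟨q', p', h1, h2, h3⟩
    have hq : ∇ (fun p' => H (q t) p') (p t) = q' := by
      refine ext_inner_right ℝ fun w => ?_
      rw [inner_gradient_right h, h3]
      simp
    have hp : -∇ (fun q' => H q' (p t)) (q t) = p' := by
      refine ext_inner_right ℝ fun v => ?_
      rw [inner_neg_left, inner_gradient_left h, h3]
      simp
    exact ⟨hq.symm ▸ h1, hp.symm ▸ h2⟩

lemma HamiltonAt.energy {H : Coord n → Coord n → ℝ} {S : Set ℝ} {q p : ℝ → Coord n} {t : ℝ}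
    (h : DifferentiableAt ℝ (Function.uncurry H) (q t, p t)) (hH : HamiltonAt H S q p t) :
    HasDerivWithinAt (fun τ => H (q τ) (p τ)) 0 S t := by
  obtain ⟨q', p', h1, h2, h3⟩ := (hamiltonAt_iff h).1 hH
  have h4 := h.hasFDerivAt.comp_hasDerivWithinAt t (h1.prodMk h2)
  rw [h3, real_inner_comm, sub_self] at h4
  exact h4

/-- The adjoint of an operator, as a linear function of the operator. -/
def adjointL (n : ℕ) : (Coord n →L[ℝ] Coord n) →L[ℝ] (Coord n →L[ℝ] Coord n) :=
  LinearMap.toContinuousLinearMap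
    { toFun := fun A => ContinuousLinearMap.adjoint A
      map_add' := fun A B => map_add _ A B
      map_smul' := fun a A => by simp }

lemma adjointL_inner (A : Coord n →L[ℝ] Coord n) (v w : Coord n) :
    inner ℝ (adjointL n A v) w = inner ℝ v (A w) :=
  ContinuousLinearMap.adjoint_inner_left A w v

/-- Hamilton's equations are invariant under the canonical transformation which is given by a
change of coordinates. -/
lemma HamiltonAt.canonical {H H' : Coord n → Coord n → ℝ} {S : Set ℝ} {t : ℝ} (ht : t ∈ S)
    {q p q₁ p₁ : ℝ → Coord n} {l k : Coord n → Coord n} {k' : Coord n →L[ℝ] Coord n}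
    (hH : DifferentiableAt ℝ (Function.uncurry H) (q t, p t))
    (hH' : DifferentiableAt ℝ (Function.uncurry H') (q₁ t, p₁ t))
    (hl : ContDiffAt ℝ 2 l (q₁ t)) (hk : HasFDerivAt k k' (q t)) (hlq : l (q₁ t) = q t)
    (h1 : ∀ v, k' (fderiv ℝ l (q₁ t) v) = v) (h2 : ∀ v, fderiv ℝ l (q₁ t) (k' v) = v)
    (hrel : ∀ᶠ z in 𝓝 (q₁ t), ∀ p, H' z (adjointL n (fderiv ℝ l z) p) = H (l z) p)
    (hq : q₁ =ᶠ[𝓝[S] t] k ∘ q)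
    (hp : p₁ =ᶠ[𝓝[S] t] fun τ => adjointL n (fderiv ℝ l (q₁ τ)) (p τ))
    (h : HamiltonAt H S q p t) : HamiltonAt H' S q₁ p₁ t := by
  rw [hamiltonAt_iff hH'] 
  obtain ⟨q', p', hq', hp', hF⟩ := (hamiltonAt_iff hH).1 h
  have hq₁ : HasDerivWithinAt q₁ (k' q') S t :=
    (hk.comp_hasDerivWithinAt t hq').congr_of_eventuallyEq_of_mem hq ht
  have hpt : p₁ t = adjointL n (fderiv ℝ l (q₁ t)) (p t) := hp.self_of_nhdsWithin ht
  have hDl : HasFDerivAt (fderiv ℝ l) (fderiv ℝ (fderiv ℝ l) (q₁ t)) (q₁ t) :=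
    ((hl.fderiv_right (m := 1) (by norm_num)).differentiableAt (by simp)).hasFDerivAt
  set D := fderiv ℝ (fderiv ℝ l) (q₁ t) with hD
  -- Symmetry of the second derivative of `l` is what makes the cotangent lift symplectic; it
  -- cancels the two terms in `D` at the end.
  have hsymm (v w : Coord n) : D v w = D w v :=
    (hl.isSymmSndFDerivAt (by simp)) v w
  have hN : HasFDerivAt (fun z => adjointL n (fderiv ℝ l z)) ((adjointL n).comp D) (q₁ t) :=
    (adjointL n).hasFDerivAt.comp (q₁ t) hDl
  have hp₁ : HasDerivWithinAt p₁ (adjointL n (D (k' q')) (p t) +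
      adjointL n (fderiv ℝ l (q₁ t)) p') S t := by
    refine HasDerivWithinAt.congr_of_eventuallyEq_of_mem ?_ hp ht
    exact (hN.comp_hasDerivWithinAt t hq₁).clm_apply hp'
  refine ⟨_, _, hq₁, hp₁, fun v w => ?_⟩
  -- Chosen so that the lift `(z, p) ↦ (z, (Dl)ᵀ p)` has derivative `(v, w)` in the direction `(v,
  -- w')`.
  set w' := adjointL n k' (w - adjointL n (D v) (p t)) with hw'
  have hNw' : adjointL n (fderiv ℝ l (q₁ t)) w' = w - adjointL n (D v) (p t) := by
    refine ext_inner_right ℝ fun u => ?_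
    rw [adjointL_inner, hw', adjointL_inner, h1]
  have hN₂ : HasFDerivAt (fun z : Coord n × Coord n => adjointL n (fderiv ℝ l z.1))
      (((adjointL n).comp D).comp (ContinuousLinearMap.fst ℝ (Coord n) (Coord n))) (q₁ t, p t) :=
    HasFDerivAt.comp (g := fun z => adjointL n (fderiv ℝ l z)) (f := Prod.fst) (q₁ t, p t) hN
      hasFDerivAt_fst
  have hl₂ : HasFDerivAt (fun z : Coord n × Coord n => l z.1)
      ((fderiv ℝ l (q₁ t)).comp (ContinuousLinearMap.fst ℝ (Coord n) (Coord n))) (q₁ t, p t) :=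
    HasFDerivAt.comp (g := l) (f := Prod.fst) (q₁ t, p t)
      (hl.differentiableAt (by simp)).hasFDerivAt hasFDerivAt_fst
  have hin₁ : HasFDerivAt (fun z : Coord n × Coord n =>
      (z.1, adjointL n (fderiv ℝ l z.1) z.2)) _ (q₁ t, p t) :=
    hasFDerivAt_fst.prodMk (hN₂.clm_apply hasFDerivAt_snd)
  have hin₂ : HasFDerivAt (fun z : Coord n × Coord n => (l z.1, z.2)) _ (q₁ t, p t) :=
    hl₂.prodMk hasFDerivAt_snd
  have hout₁ : HasFDerivAt (Function.uncurry H') (fderiv ℝ (Function.uncurry H') (q₁ t, p₁ t))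
      (q₁ t, adjointL n (fderiv ℝ l (q₁ t)) (p t)) := by
    rw [← hpt]
    exact hH'.hasFDerivAt
  have hout₂ : HasFDerivAt (Function.uncurry H) (fderiv ℝ (Function.uncurry H) (q t, p t))
      (l (q₁ t), p t) := by
    rw [hlq]
    exact hH.hasFDerivAt
  have hleft := HasFDerivAt.comp (g := Function.uncurry H') (f := fun z : Coord n × Coord n =>
      (z.1, adjointL n (fderiv ℝ l z.1) z.2)) (q₁ t, p t) hout₁ hin₁
  have hright := HasFDerivAt.comp (g := Function.uncurry H) (f := fun z : Coord n × Coord n =>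
      (l z.1, z.2)) (q₁ t, p t) hout₂ hin₂
  have heq : (Function.uncurry H' ∘ fun z : Coord n × Coord n =>
      (z.1, adjointL n (fderiv ℝ l z.1) z.2)) =ᶠ[𝓝 (q₁ t, p t)]
      Function.uncurry H ∘ fun z : Coord n × Coord n => (l z.1, z.2) := by
    have := (continuous_fst.tendsto (q₁ t, p t)).eventually hrel
    filter_upwards [this] with z hz using hz z.2
  -- Differentiating the relation `hrel` between the Hamiltonians expresses `dH'` at `(v, w)`
  -- through `dH`.
  have hkey := DFunLike.congr_fun (hleft.unique (hright.congr_of_eventuallyEq heq)) (v, w')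
  simp only [ContinuousLinearMap.comp_apply, ContinuousLinearMap.prod_apply, add_apply,
    ContinuousLinearMap.flip_apply, ContinuousLinearMap.coe_fst', ContinuousLinearMap.coe_snd',
    hNw', sub_add_cancel] at hkey
  have hqw : inner ℝ q' w' = inner ℝ (k' q') w - inner ℝ (p t) (D v (k' q')) := by
    conv_lhs => rw [real_inner_comm, ← h2 q', ← adjointL_inner, hNw', inner_sub_left,
      adjointL_inner, real_inner_comm]
  rw [hkey, hF, inner_add_left, adjointL_inner, adjointL_inner, hqw, hsymm v]
  ring

end

/-! ### Bicharacteristics in one fixed chart. -/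

section

variable {n : ℕ}

lemma zeroHam_contDiffOn {Ω : Set (Coord n)} {K : Coord n → Coord n →L[ℝ] Coord n}
    (hK : IsZeroFamily Ω K) : ContDiffOn ℝ ∞ (Function.uncurry (zeroHam K)) (Ω ×ˢ univ) := by
  have h1 : ContDiffOn ℝ ∞ (fun z : Coord n × Coord n => K z.1) (Ω ×ˢ univ) :=
    hK.smooth.comp contDiff_fst.contDiffOn fun z hz => hz.1
  have h2 : ContDiff ℝ ∞ fun z : Coord n × Coord n => z.1 0 ^ 2 := by fun_prop
  exact (h2.contDiffOn.mul ((h1.clm_apply contDiff_snd.contDiffOn).inner ℝ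
    contDiff_snd.contDiffOn)).sub contDiffOn_const

lemma IsZeroFamily.isOpen_prod {Ω : Set (Coord n)} {K : Coord n → Coord n →L[ℝ] Coord n}
    (hK : IsZeroFamily Ω K) : IsOpen (Ω ×ˢ (univ : Set (Coord n))) := hK.isOpen.prod isOpen_univ

lemma zeroHam_differentiableAt {Ω : Set (Coord n)} {K : Coord n → Coord n →L[ℝ] Coord n}
    (hK : IsZeroFamily Ω K) {q : Coord n} (hq : q ∈ Ω) (p : Coord n) :
    DifferentiableAt ℝ (Function.uncurry (zeroHam K)) (q, p) :=
  ((zeroHam_contDiffOn hK).contDiffAt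
    (hK.isOpen_prod.mem_nhds ⟨hq, mem_univ p⟩)).differentiableAt (by simp)

variable {X : Type*} [TopologicalSpace X] [ChartedSpace (EuclideanHalfSpace (n + 1)) X]
  [IsManifold (𝓡∂ (n + 1)) ∞ X]

lemma exists_ofCoord {φ : OpenPartialHomeomorph X (EuclideanHalfSpace (n + 1))}
    (hφ : φ ∈ IsManifold.maximalAtlas (𝓡∂ (n + 1)) ∞ X) (w : Cotangent n X)
    (hw : w.proj ∈ φ.source) : ∃ p, ofCoord φ (φ.extend (𝓡∂ (n + 1)) w.proj) p = w := by
  obtain ⟨x, ζ⟩ := w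
  obtain ⟨q, hq, rfl⟩ : ∃ q ∈ (φ.extend (𝓡∂ (n + 1))).target,
      (φ.extend (𝓡∂ (n + 1))).symm q = x :=
    ⟨_, extend_mem_target hw, extend_leftInv hw⟩
  refine ⟨(InnerProductSpace.toDual ℝ (Coord n)).symm (ζ.comp (chartFrame φ q)), ?_⟩
  simp only [(φ.extend (𝓡∂ (n + 1))).right_inv hq]
  refine congrArg (Bundle.TotalSpace.mk ((φ.extend (𝓡∂ (n + 1))).symm q)) ?_
  ext v
  refine (InnerProductSpace.toDual_symm_apply (𝕜 := ℝ) (E := Coord n)).trans ?_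
  exact congrArg ζ (chartFrame_mfderiv hφ hq v)

lemma ofCoord_injective {φ : OpenPartialHomeomorph X (EuclideanHalfSpace (n + 1))}
    (hφ : φ ∈ IsManifold.maximalAtlas (𝓡∂ (n + 1)) ∞ X) {q : Coord n}
    (hq : q ∈ (φ.extend (𝓡∂ (n + 1))).target) {p p' : Coord n}
    (h : ofCoord φ q p = ofCoord φ q p') : p = p' := by
  have h1 := Bundle.TotalSpace.mk_injective _ h
  refine ext_inner_right ℝ fun v => ?_
  have h2 := DFunLike.congr_fun h1 (chartFrame φ q v)
  have h3 (u : Coord n) : ((covec u).comp (mfderiv (𝓡∂ (n + 1)) 𝓘(ℝ, Coord n)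
      (φ.extend (𝓡∂ (n + 1))) ((φ.extend (𝓡∂ (n + 1))).symm q))) (chartFrame φ q v) =
      inner ℝ u v := congrArg (covec u) (mfderiv_chartFrame hφ hq v)
  exact (h3 p).symm.trans (h2.trans (h3 p'))

/-- The coordinates of a covector in the chart `φ`. -/
def chartMom (φ : OpenPartialHomeomorph X (EuclideanHalfSpace (n + 1))) (w : Cotangent n X) :
    Coord n :=
  Classical.epsilon fun p => ofCoord φ (φ.extend (𝓡∂ (n + 1)) w.proj) p = w

lemma ofCoord_chartMom {φ : OpenPartialHomeomorph X (EuclideanHalfSpace (n + 1))}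
    (hφ : φ ∈ IsManifold.maximalAtlas (𝓡∂ (n + 1)) ∞ X) {w : Cotangent n X}
    (hw : w.proj ∈ φ.source) :
    ofCoord φ (φ.extend (𝓡∂ (n + 1)) w.proj) (chartMom φ w) = w :=
  Classical.epsilon_spec (exists_ofCoord hφ w hw)

lemma chartMom_ofCoord {φ : OpenPartialHomeomorph X (EuclideanHalfSpace (n + 1))}
    (hφ : φ ∈ IsManifold.maximalAtlas (𝓡∂ (n + 1)) ∞ X) {q : Coord n}
    (hq : q ∈ (φ.extend (𝓡∂ (n + 1))).target) (p : Coord n) :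
    chartMom φ (ofCoord φ q p) = p := by
  have h := ofCoord_chartMom hφ (w := ofCoord φ q p) (extend_symm_mem_source hq)
  have h2 : φ.extend (𝓡∂ (n + 1)) (ofCoord φ q p).proj = q :=
    (φ.extend (𝓡∂ (n + 1))).right_inv hq
  rw [h2] at h
  exact ofCoord_injective hφ hq h

lemma ofCoord_extend {ψ : OpenPartialHomeomorph X (EuclideanHalfSpace (n + 1))} {x : X}
    (hx : x ∈ ψ.source) (p : Coord n) :
    ofCoord ψ (ψ.extend (𝓡∂ (n + 1)) x) p =
      ⟨x, (covec p).comp (mfderiv (𝓡∂ (n + 1)) 𝓘(ℝ, Coord n) (ψ.extend (𝓡∂ (n + 1))) x)⟩ := by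
  simp only [ofCoord]
  rw [extend_leftInv hx]

lemma extend_comp_extend_symm_contDiffAt
    {φ ψ : OpenPartialHomeomorph X (EuclideanHalfSpace (n + 1))}
    (hφ : φ ∈ IsManifold.maximalAtlas (𝓡∂ (n + 1)) ∞ X)
    (hψ : ψ ∈ IsManifold.maximalAtlas (𝓡∂ (n + 1)) ∞ X) {q : Coord n}
    (hq : q ∈ interior (φ.extend (𝓡∂ (n + 1))).target)
    (hx : (φ.extend (𝓡∂ (n + 1))).symm q ∈ ψ.source) :
    ContDiffAt ℝ ∞ (ψ.extend (𝓡∂ (n + 1)) ∘ (φ.extend (𝓡∂ (n + 1))).symm) q := by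
  rw [← contMDiffAt_iff_contDiffAt]
  exact (ψ.contMDiffAt_extend hψ hx).comp q
    ((contMDiffOn_extend_symm_target hφ).contMDiffAt (mem_interior_iff_mem_nhds.1 hq))

lemma ofCoord_changeChart {φ ψ : OpenPartialHomeomorph X (EuclideanHalfSpace (n + 1))}
    (hφ : φ ∈ IsManifold.maximalAtlas (𝓡∂ (n + 1)) ∞ X)
    (hψ : ψ ∈ IsManifold.maximalAtlas (𝓡∂ (n + 1)) ∞ X) {q : Coord n}
    (hq : q ∈ interior (φ.extend (𝓡∂ (n + 1))).target)
    (hx : (φ.extend (𝓡∂ (n + 1))).symm q ∈ ψ.source) (p : Coord n) :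
    ofCoord φ q (adjointL n (fderiv ℝ (ψ.extend (𝓡∂ (n + 1)) ∘ (φ.extend (𝓡∂ (n + 1))).symm) q) p) =
      ofCoord ψ ((ψ.extend (𝓡∂ (n + 1)) ∘ (φ.extend (𝓡∂ (n + 1))).symm) q) p := by
  have hqt := interior_subset hq
  have hn := mem_interior_iff_mem_nhds.1 hq
  rw [Function.comp_apply, ofCoord_extend hx]
  refine congrArg (Bundle.TotalSpace.mk ((φ.extend (𝓡∂ (n + 1))).symm q)) ?_
  have key (v : TangentSpace (𝓡∂ (n + 1)) ((φ.extend (𝓡∂ (n + 1))).symm q)) :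
      mfderiv (𝓡∂ (n + 1)) 𝓘(ℝ, Coord n) (ψ.extend (𝓡∂ (n + 1)))
        ((φ.extend (𝓡∂ (n + 1))).symm q) v =
      fderiv ℝ (ψ.extend (𝓡∂ (n + 1)) ∘ (φ.extend (𝓡∂ (n + 1))).symm) q
        (mfderiv (𝓡∂ (n + 1)) 𝓘(ℝ, Coord n) (φ.extend (𝓡∂ (n + 1)))
          ((φ.extend (𝓡∂ (n + 1))).symm q) v) := by
    have U : UniqueMDiffWithinAt 𝓘(ℝ, Coord n) (φ.extend (𝓡∂ (n + 1))).target q :=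
      (uniqueDiffOn_extend_target φ).uniqueMDiffOn q hqt
    have h := mfderiv_comp_mfderivWithin q
      ((ψ.contMDiffAt_extend hψ hx).mdifferentiableAt (by simp))
      ((contMDiffOn_extend_symm_target hφ q hqt).mdifferentiableWithinAt (by simp)) U
    rw [← fderivWithin_of_mem_nhds hn, ← mfderivWithin_eq_fderivWithin]
    refine Eq.trans ?_ (DFunLike.congr_fun h _).symm
    exact congrArg (mfderiv (𝓡∂ (n + 1)) 𝓘(ℝ, Coord n) (ψ.extend (𝓡∂ (n + 1)))
      ((φ.extend (𝓡∂ (n + 1))).symm q)) (chartFrame_mfderiv hφ hqt v).symm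
  ext v
  refine (adjointL_inner _ _ _).trans ?_
  exact congrArg (covec p) (key v).symm

variable {g : BilinField n X} {S : Set ℝ} {c : ℝ → Cotangent n X}

lemma IsHamiltonCurve.continuousOn_proj (hc : IsHamiltonCurve g S c) :
    ContinuousOn (fun t => (c t).proj) S := by
  intro t ht
  obtain ⟨ψ, hψ, q, p, hq, hev, hH⟩ := hc t ht
  have h1 : ContinuousWithinAt (fun τ => (ψ.extend (𝓡∂ (n + 1))).symm (q τ)) S t :=
    ((contMDiffOn_extend_symm_target hψ).contMDiffAt
      (mem_interior_iff_mem_nhds.1 hq)).continuousAt.comp_continuousWithinAt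
      hH.1.continuousWithinAt
  refine h1.congr_of_eventuallyEq_of_mem ?_ ht
  filter_upwards [hev] with τ hτ
  rw [hτ]
  rfl

lemma IsHamiltonCurve.proj_mem_interior (hc : IsHamiltonCurve g S c) {t : ℝ} (ht : t ∈ S) :
    (c t).proj ∈ (𝓡∂ (n + 1)).interior X := by
  obtain ⟨ψ, hψ, q, p, hq, hev, hH⟩ := hc t ht
  rw [hev.self_of_nhdsWithin ht]
  exact extend_symm_mem_interior hψ hq

lemma extend_mem_interior_target {φ : OpenPartialHomeomorph X (EuclideanHalfSpace (n + 1))}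
    (hφ : φ ∈ IsManifold.maximalAtlas (𝓡∂ (n + 1)) ∞ X) {x : X} (hx : x ∈ φ.source)
    (hi : x ∈ (𝓡∂ (n + 1)).interior X) :
    φ.extend (𝓡∂ (n + 1)) x ∈ interior (φ.extend (𝓡∂ (n + 1))).target := by
  rw [interior_extend_target]
  exact ⟨extend_mem_target hx, extend_pos_of_mem_interior hφ hx hi⟩

/-- In every chart, the Hamiltonian of `g` is smooth in the interior. -/
def HasSmoothSymbol (g : BilinField n X) : Prop :=
  ∀ φ ∈ IsManifold.maximalAtlas (𝓡∂ (n + 1)) ∞ X,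
    ∀ q ∈ interior (φ.extend (𝓡∂ (n + 1))).target, ∀ p,
      DifferentiableAt ℝ (Function.uncurry fun q p => symbol g (ofCoord φ q p)) (q, p)

lemma hasSmoothSymbol (gbar : SmoothMetric n X) {x : X → ℝ}
    (hx : IsBoundaryDefining (n := n) x)
    (hg : ∀ p ∈ (𝓡∂ (n + 1)).interior X, gbar.inner p = x p ^ 2 • g p) : HasSmoothSymbol g := by
  intro φ hφ q hq p
  refine (zeroHam_differentiableAt (chartOp_isZeroFamily gbar hx hφ) hq p).congr_of_eventuallyEq ?_
  have h : ∀ᶠ z : Coord n × Coord n in 𝓝 (q, p), z.1 ∈ interior (φ.extend (𝓡∂ (n + 1))).target :=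
    (continuous_fst.tendsto (q, p)).eventually (isOpen_interior.mem_nhds hq)
  filter_upwards [h] with z hz
  exact symbol_ofCoord gbar hx hg hφ hz z.2

/-- An integral curve may use a different chart at each time. Canonical invariance transfers the
equations to any chart whose domain contains the point, so that a single chart at `y₀` can be used
throughout. -/
lemma IsHamiltonCurve.hamiltonAt (hg : HasSmoothSymbol g) (hc : IsHamiltonCurve g S c)
    {φ : OpenPartialHomeomorph X (EuclideanHalfSpace (n + 1))}
    (hφ : φ ∈ IsManifold.maximalAtlas (𝓡∂ (n + 1)) ∞ X) {t : ℝ} (ht : t ∈ S)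
    (hx : (c t).proj ∈ φ.source) :
    HamiltonAt (fun q p => symbol g (ofCoord φ q p)) S
      (fun τ => φ.extend (𝓡∂ (n + 1)) (c τ).proj) (fun τ => chartMom φ (c τ)) t := by
  obtain ⟨ψ, hψ, q, p, hq, hev, hH⟩ := hc t ht
  have hct : c t = ofCoord ψ (q t) (p t) := hev.self_of_nhdsWithin ht
  have hcp : (c t).proj = (ψ.extend (𝓡∂ (n + 1))).symm (q t) := by rw [hct]; rfl
  have hxψ : (ψ.extend (𝓡∂ (n + 1))).symm (q t) ∈ φ.source := hcp ▸ hx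
  have hxi := hc.proj_mem_interior ht
  set q₁ := fun τ => φ.extend (𝓡∂ (n + 1)) (c τ).proj with hq₁
  have hq₁t : q₁ t ∈ interior (φ.extend (𝓡∂ (n + 1))).target :=
    extend_mem_interior_target hφ hx hxi
  have hsymm₁ : (φ.extend (𝓡∂ (n + 1))).symm (q₁ t) = (ψ.extend (𝓡∂ (n + 1))).symm (q t) := by
    rw [← hcp]
    exact extend_leftInv hx
  have hsrc : (φ.extend (𝓡∂ (n + 1))).symm (q₁ t) ∈ ψ.source := by
    rw [hsymm₁]
    exact extend_symm_mem_source (interior_subset hq)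
  set l := ψ.extend (𝓡∂ (n + 1)) ∘ (φ.extend (𝓡∂ (n + 1))).symm with hl
  set k := φ.extend (𝓡∂ (n + 1)) ∘ (ψ.extend (𝓡∂ (n + 1))).symm with hk
  have hlc : ContDiffAt ℝ ∞ l (q₁ t) := extend_comp_extend_symm_contDiffAt hφ hψ hq₁t hsrc
  have hkc : ContDiffAt ℝ ∞ k (q t) := extend_comp_extend_symm_contDiffAt hψ hφ hq hxψ
  have hlq : l (q₁ t) = q t := by
    rw [hl, Function.comp_apply, hsymm₁]
    exact (ψ.extend (𝓡∂ (n + 1))).right_inv (interior_subset hq)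
  have hkq : k (q t) = q₁ t := by
    rw [hk, Function.comp_apply, ← hcp]
  have hsrc_ev : ∀ᶠ z in 𝓝 (q₁ t), z ∈ interior (φ.extend (𝓡∂ (n + 1))).target ∧
      (φ.extend (𝓡∂ (n + 1))).symm z ∈ ψ.source := by
    refine Filter.Eventually.and (isOpen_interior.mem_nhds hq₁t) ?_
    exact ((contMDiffOn_extend_symm_target hφ).contMDiffAt
      (mem_interior_iff_mem_nhds.1 hq₁t)).continuousAt.preimage_mem_nhds
      (ψ.open_source.mem_nhds hsrc)
  have hsrc_ev' : ∀ᶠ z in 𝓝 (q t), z ∈ interior (ψ.extend (𝓡∂ (n + 1))).target ∧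
      (ψ.extend (𝓡∂ (n + 1))).symm z ∈ φ.source := by
    refine Filter.Eventually.and (isOpen_interior.mem_nhds hq) ?_
    exact ((contMDiffOn_extend_symm_target hψ).contMDiffAt
      (mem_interior_iff_mem_nhds.1 hq)).continuousAt.preimage_mem_nhds
      (φ.open_source.mem_nhds hxψ)
  have hld := (hlc.differentiableAt (by simp)).hasFDerivAt
  have hkd := (hkc.differentiableAt (by simp)).hasFDerivAt
  have hkl : k ∘ l =ᶠ[𝓝 (q₁ t)] id := by
    filter_upwards [hsrc_ev] with z hz
    simp only [hk, hl, Function.comp_apply]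
    rw [extend_leftInv hz.2]
    exact (φ.extend (𝓡∂ (n + 1))).right_inv (interior_subset hz.1)
  have hlk : l ∘ k =ᶠ[𝓝 (q t)] id := by
    filter_upwards [hsrc_ev'] with z hz
    simp only [hk, hl, Function.comp_apply]
    rw [extend_leftInv hz.2]
    exact (ψ.extend (𝓡∂ (n + 1))).right_inv (interior_subset hz.1)
  have h1 : (fderiv ℝ k (q t)).comp (fderiv ℝ l (q₁ t)) = ContinuousLinearMap.id ℝ (Coord n) :=
    ((hlq.symm ▸ hkd : HasFDerivAt k (fderiv ℝ k (q t)) (l (q₁ t))).comp (q₁ t) hld).unique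
      ((hasFDerivAt_id (q₁ t)).congr_of_eventuallyEq hkl)
  have h2 : (fderiv ℝ l (q₁ t)).comp (fderiv ℝ k (q t)) = ContinuousLinearMap.id ℝ (Coord n) :=
    ((hkq.symm ▸ hld : HasFDerivAt l (fderiv ℝ l (q₁ t)) (k (q t))).comp (q t) hkd).unique
      ((hasFDerivAt_id (q t)).congr_of_eventuallyEq hlk)
  have hqc : ContinuousWithinAt q S t := hH.1.continuousWithinAt
  have hqev : q₁ =ᶠ[𝓝[S] t] k ∘ q := by
    filter_upwards [hev] with τ hτ
    simp only [hq₁, hk, Function.comp_apply]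
    rw [hτ]
    rfl
  refine HamiltonAt.canonical ht (hg ψ hψ _ hq _) (hg φ hφ _ hq₁t _) 
    (contDiffAt_infty.1 hlc 2) hkd hlq (fun v => DFunLike.congr_fun h1 v) (fun v => DFunLike.congr_fun h2 v) ?_ hqev ?_ hH
  · filter_upwards [hsrc_ev] with z hz p
    exact congrArg (symbol g) (ofCoord_changeChart hφ hψ hz.1 hz.2 p)
  · have hq₁c : ContinuousWithinAt q₁ S t :=
      (hkc.continuousAt.comp_continuousWithinAt hqc).congr_of_eventuallyEq_of_mem hqev ht
    filter_upwards [hev, hq₁c.eventually hsrc_ev, hqc.eventually hsrc_ev'] with τ hτ hτ₁ hτ₂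
    have hlτ : l (q₁ τ) = q τ := by
      simp only [hl, hq₁, Function.comp_apply]
      rw [hτ]
      change ψ.extend (𝓡∂ (n + 1)) ((φ.extend (𝓡∂ (n + 1))).symm (φ.extend (𝓡∂ (n + 1))
        ((ψ.extend (𝓡∂ (n + 1))).symm (q τ)))) = q τ
      rw [extend_leftInv hτ₂.2]
      exact (ψ.extend (𝓡∂ (n + 1))).right_inv (interior_subset hτ₂.1)
    have h := ofCoord_changeChart hφ hψ hτ₁.1 hτ₁.2 (p τ)
    rw [← hl, hlτ, ← hτ] at h
    rw [← h]
    exact chartMom_ofCoord hφ (interior_subset hτ₁.1) _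

lemma IsHamiltonCurve.energy (hg : HasSmoothSymbol g) (hc : IsHamiltonCurve g S c) {t : ℝ}
    (ht : t ∈ S) : HasDerivWithinAt (fun τ => symbol g (c τ)) 0 S t := by
  obtain ⟨ψ, hψ, q, p, hq, hev, hH⟩ := hc t ht
  refine (hH.energy (hg ψ hψ _ hq _)).congr_of_eventuallyEq_of_mem ?_ ht
  filter_upwards [hev] with τ hτ
  rw [hτ]

lemma IsHamiltonCurve.symbol_eq {T : ℝ} (hg : HasSmoothSymbol g)
    (hc : IsHamiltonCurve g (Icc 0 T) c) {t : ℝ} (ht : t ∈ Icc 0 T) :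
    symbol g (c t) = symbol g (c 0) := by
  have h := (convex_Icc 0 T).norm_image_sub_le_of_norm_hasDerivWithin_le (C := 0)
    (fun τ hτ => hc.energy hg hτ) (fun τ _ => by simp)
    (left_mem_Icc.2 (ht.1.trans ht.2)) ht
  simpa [sub_eq_zero] using h

end

/-! ### The rescaled equations and their limit. -/

section

variable {n : ℕ}

lemma basisVec_inner (v : Coord n) (i : Fin (n + 1)) : inner ℝ (basisVec i) v = v i := by
  rw [real_inner_comm, inner_basisVec]

lemma fderiv_zeroHam {Ω : Set (Coord n)} {K : Coord n → Coord n →L[ℝ] Coord n}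
    (hK : IsZeroFamily Ω K) {q : Coord n} (hq : q ∈ Ω) (p v w : Coord n) :
    fderiv ℝ (Function.uncurry (zeroHam K)) (q, p) (v, w) =
      2 * q 0 * v 0 * inner ℝ (K q p) p + q 0 ^ 2 * inner ℝ (fderiv ℝ K q v p) p +
        2 * q 0 ^ 2 * inner ℝ (K q p) w := by
  have hKd : HasFDerivAt K (fderiv ℝ K q) q :=
    ((hK.smooth.contDiffAt (hK.isOpen.mem_nhds hq)).differentiableAt (by simp)).hasFDerivAt
  have h1 : HasFDerivAt (fun z : Coord n × Coord n => K z.1)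
      ((fderiv ℝ K q).comp (ContinuousLinearMap.fst ℝ (Coord n) (Coord n))) (q, p) :=
    HasFDerivAt.comp (g := K) (f := Prod.fst) (q, p) hKd hasFDerivAt_fst
  have h2 : HasFDerivAt (fun z : Coord n × Coord n => z.1 0)
      ((EuclideanSpace.proj 0 : Coord n →L[ℝ] ℝ).comp
        (ContinuousLinearMap.fst ℝ (Coord n) (Coord n))) (q, p) :=
    ((EuclideanSpace.proj 0 : Coord n →L[ℝ] ℝ).comp
        (ContinuousLinearMap.fst ℝ (Coord n) (Coord n))).hasFDerivAt
  have hsnd : HasFDerivAt (fun z : Coord n × Coord n => z.2)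
      (ContinuousLinearMap.snd ℝ (Coord n) (Coord n)) (q, p) := hasFDerivAt_snd
  have h3 := ((h2.pow 2).mul ((h1.clm_apply hsnd).inner ℝ hsnd)).sub_const (1 : ℝ)
  have h4 : HasFDerivAt (Function.uncurry (zeroHam K)) _ (q, p) := h3
  rw [h4.fderiv]
  simp [fderivInnerCLM_apply, inner_add_left, hK.symm q hq w p]
  rw [real_inner_comm w]
  ring

/-- The derivative of the coefficients, as a force. -/
def residualForce (K : Coord n → Coord n →L[ℝ] Coord n) (q π : Coord n) : Coord n :=
  (InnerProductSpace.toDual ℝ (Coord n)).symm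
    ((innerSL ℝ π).comp ((q 0 • fderiv ℝ K q).flip π))

lemma inner_residualForce (K : Coord n → Coord n →L[ℝ] Coord n) (q π v : Coord n) :
    inner ℝ (residualForce K q π) v = q 0 * inner ℝ (fderiv ℝ K q v π) π := by
  rw [residualForce, InnerProductSpace.toDual_symm_apply]
  simp [real_inner_comm]

lemma norm_residualForce_le (K : Coord n → Coord n →L[ℝ] Coord n) (q π : Coord n) :
    ‖residualForce K q π‖ ≤ ‖q 0 • fderiv ℝ K q‖ * ‖π‖ ^ 2 := by
  rw [residualForce, LinearIsometryEquiv.norm_map]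
  refine (ContinuousLinearMap.opNorm_comp_le _ _).trans ?_
  rw [innerSL_apply_norm]
  have h := (q 0 • fderiv ℝ K q).flip.le_opNorm π
  rw [ContinuousLinearMap.opNorm_flip] at h
  nlinarith [norm_nonneg π, mul_le_mul_of_nonneg_left h (norm_nonneg π)]

/-- The time derivative of the rescaled momentum `π = q₀ p`. -/
def zeroForce (K : Coord n → Coord n →L[ℝ] Coord n) (q π : Coord n) : Coord n :=
  (2 * (K q π) 0) • π - (2 * inner ℝ (K q π) π) • basisVec 0 - residualForce K q π

/-- The time derivative of the rescaled momentum for the limiting Hamiltonian. -/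
def modelForce (k : Coord n →L[ℝ] Coord n) (π : Coord n) : Coord n :=
  (2 * (k π) 0) • π - (2 * inner ℝ (k π) π) • basisVec 0

/-- `(q, π)` is a solution of Hamilton's equations with energy `1`, in terms of the position and
the rescaled momentum, which stays in the half ball of radius `δ`. -/
structure ZeroTraj (K : Coord n → Coord n →L[ℝ] Coord n) (q₀ : Coord n) (δ T : ℝ)
    (q π : ℝ → Coord n) : Prop where
  pos : ∀ t ∈ Icc 0 T, 0 < q t 0
  near : ∀ t ∈ Icc 0 T, ‖q t - q₀‖ ≤ δ
  deriv_pos : ∀ t ∈ Icc 0 T,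
    HasDerivWithinAt q (q t 0 • ((2 : ℝ) • K (q t) (π t))) (Icc 0 T) t
  deriv_mom : ∀ t ∈ Icc 0 T, HasDerivWithinAt π (zeroForce K (q t) (π t)) (Icc 0 T) t
  energy : ∀ t ∈ Icc 0 T, inner ℝ (K (q t) (π t)) (π t) = 1

lemma hasDerivWithinAt_coord {q : ℝ → Coord n} {q' : Coord n} {S : Set ℝ} {t : ℝ}
    (h : HasDerivWithinAt q q' S t) : HasDerivWithinAt (fun τ => q τ 0) (q' 0) S t :=
  (EuclideanSpace.proj 0 : Coord n →L[ℝ] ℝ).hasFDerivAt.comp_hasDerivWithinAt t h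

/-- The factor `(q 0)²` of the Hamiltonian is absorbed by `π = q 0 • p`. The velocity is then
proportional to the height, and the force involves `q` only through `K` and `q 0 • DK`, both of
which have limits at the boundary. -/
lemma HamiltonAt.rescaled {Ω : Set (Coord n)} {K : Coord n → Coord n →L[ℝ] Coord n}
    (hK : IsZeroFamily Ω K) {S : Set ℝ} {q p : ℝ → Coord n} {t : ℝ} (hq : q t ∈ Ω)
    (h : HamiltonAt (zeroHam K) S q p t) :
    HasDerivWithinAt q (q t 0 • ((2 : ℝ) • K (q t) (q t 0 • p t))) S t ∧
      HasDerivWithinAt (fun τ => q τ 0 • p τ) (zeroForce K (q t) (q t 0 • p t)) S t := by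
  obtain ⟨q', p', h1, h2, h3⟩ := (hamiltonAt_iff (zeroHam_differentiableAt hK hq (p t))).1 h
  have hq' : q' = q t 0 • ((2 : ℝ) • K (q t) (q t 0 • p t)) := by
    refine ext_inner_right ℝ fun w => ?_
    have := h3 0 w
    rw [fderiv_zeroHam hK hq] at this
    simp only [map_zero, inner_zero_right, sub_zero] at this
    rw [← this]
    simp [inner_smul_left]
    ring
  refine ⟨hq' ▸ h1, ?_⟩
  refine ((hasDerivWithinAt_coord h1).smul h2).congr_deriv ?_
  refine ext_inner_right ℝ fun v => ?_
  have := h3 v 0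
  rw [fderiv_zeroHam hK hq] at this
  simp only [inner_zero_right, zero_sub] at this
  have h4 : inner ℝ p' v = -(2 * q t 0 * v 0 * inner ℝ (K (q t) (p t)) (p t) +
      q t 0 ^ 2 * inner ℝ (fderiv ℝ K (q t) v (p t)) (p t)) := by linarith
  simp only [zeroForce, inner_sub_left, inner_add_left, inner_residualForce, real_inner_smul_left,
    h4, basisVec_inner, hq']
  simp [inner_smul_left, inner_smul_right]
  ring

/-- Bounds for the rescaled equations in the half ball of radius `δ`. -/
def BoundedNear (K : Coord n → Coord n →L[ℝ] Coord n) (q₀ : Coord n) (δ C : ℝ) : Prop :=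
  ∀ q : Coord n, 0 < q 0 → ‖q - q₀‖ ≤ δ → ∀ π, inner ℝ (K q π) π = 1 →
    ‖π‖ ≤ C ∧ ‖(2 : ℝ) • K q π‖ ≤ C

/-- In the half ball of radius `δ`, the rescaled equations are `η`-close to the limiting ones. -/
def CloseNear (K : Coord n → Coord n →L[ℝ] Coord n) (k : Coord n →L[ℝ] Coord n) (q₀ : Coord n)
    (δ η : ℝ) : Prop :=
  ∀ q : Coord n, 0 < q 0 → ‖q - q₀‖ ≤ δ → ∀ π, inner ℝ (K q π) π = 1 →
    ‖(2 : ℝ) • K q π - (2 : ℝ) • k π‖ ≤ η ∧ ‖zeroForce K q π - modelForce k π‖ ≤ η ∧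
      |inner ℝ (k π) π - 1| ≤ η

lemma IsModelOp.coercive {k : Coord n →L[ℝ] Coord n} (hk : IsModelOp k) :
    ∃ a > 0, ∀ v, a * ‖v‖ ^ 2 ≤ inner ℝ (k v) v := by
  have hne : (Metric.sphere (0 : Coord n) 1).Nonempty := ⟨basisVec 0, by simp⟩
  have hc : ContinuousOn (fun v => inner ℝ (k v) v) (Metric.sphere (0 : Coord n) 1) := by fun_prop
  obtain ⟨u, hu, hmin⟩ := (isCompact_sphere (0 : Coord n) 1).exists_isMinOn hne hc
  have hu1 : ‖u‖ = 1 := by simpa using hu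
  refine ⟨inner ℝ (k u) u, hk.pos u (by rintro rfl; simp at hu1), fun v => ?_⟩
  rcases eq_or_ne v 0 with rfl | hv
  · simp
  have hv' : 0 < ‖v‖ := norm_pos_iff.2 hv
  have h := hmin (a := ‖v‖⁻¹ • v) (by simp [norm_smul, hv'.ne'])
  simp only [mem_ofPred_eq, map_smul, inner_smul_left, inner_smul_right] at h
  simp at h
  rw [← mul_assoc, ← mul_inv, ← div_eq_inv_mul, le_div_iff₀ (by positivity)] at h
  rw [pow_two]
  exact h

lemma halfBall_mem_nhdsWithin {s : Set (Coord n)} {q₀ : Coord n}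
    (h : s ∈ 𝓝[{q : Coord n | 0 < q 0}] q₀) :
    ∃ δ > 0, ∀ q : Coord n, 0 < q 0 → ‖q - q₀‖ ≤ δ → q ∈ s := by
  obtain ⟨ε, hε, h'⟩ := Metric.mem_nhdsWithin_iff.1 h
  refine ⟨ε / 2, by positivity, fun q hq hd => h' ⟨?_, hq⟩⟩
  rw [mem_ball_iff_norm]
  linarith

/-- Coercivity of `k` persists, with half the constant, for nearby `K`; the energy identity then
bounds the rescaled momentum. -/
lemma IsZeroLimit.exists_boundedNear {Ω : Set (Coord n)} {K : Coord n → Coord n →L[ℝ] Coord n}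
    {q₀ : Coord n} {k : Coord n →L[ℝ] Coord n} (h : IsZeroLimit Ω K q₀ k) :
    ∃ δ > 0, ∃ C ≥ 1, BoundedNear K q₀ δ C ∧ ∀ q : Coord n, 0 < q 0 → ‖q - q₀‖ ≤ δ → q ∈ Ω := by
  obtain ⟨a, ha, hco⟩ := h.model.coercive
  have h1 : ∀ᶠ q in 𝓝[{q : Coord n | 0 < q 0}] q₀, ‖K q - k‖ < a / 2 := by
    have := h.tendsto.eventually (Metric.ball_mem_nhds k (half_pos ha))
    filter_upwards [this] with q hq
    rwa [← dist_eq_norm]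
  obtain ⟨δ, hδ, hδ'⟩ := halfBall_mem_nhdsWithin (h1.and h.mem_nhds)
  have hr : 0 ≤ √(2 / a) := Real.sqrt_nonneg _
  have hnn : 0 ≤ ‖k‖ + a / 2 := by positivity
  -- The terms are, in order, for `C ≥ 1`, for the bound of `π`, and for the bound of `2 Kπ`.
  refine ⟨δ, hδ, 1 + √(2 / a) + 2 * ((‖k‖ + a / 2) * √(2 / a)), ?_, ?_,
    fun q hq hd => (hδ' q hq hd).2⟩
  · have : 0 ≤ 2 * ((‖k‖ + a / 2) * √(2 / a)) := by positivity
    linarith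
  · intro q hq hd π hπ
    have hKk := (hδ' q hq hd).1
    have h2 : |inner ℝ ((K q - k) π) π| ≤ a / 2 * ‖π‖ ^ 2 := by
      refine (abs_real_inner_le_norm _ _).trans ?_
      have := (K q - k).le_opNorm π
      nlinarith [norm_nonneg π, norm_nonneg ((K q - k) π), sq_nonneg ‖π‖]
    have h3 : inner ℝ ((K q - k) π) π = 1 - inner ℝ (k π) π := by
      rw [sub_apply, inner_sub_left, hπ]
    have h4 : ‖π‖ ^ 2 ≤ 2 / a := by
      rw [le_div_iff₀ ha]
      have := hco π
      rw [h3] at h2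
      have := (abs_le.1 h2).1
      nlinarith
    have h5 : ‖π‖ ≤ √(2 / a) := Real.le_sqrt_of_sq_le h4
    have h6 : ‖K q‖ ≤ ‖k‖ + a / 2 := by
      have := norm_sub_norm_le (K q) k
      linarith
    have h7 : ‖K q π‖ ≤ (‖k‖ + a / 2) * √(2 / a) :=
      ((K q).le_opNorm π).trans (mul_le_mul h6 h5 (norm_nonneg _) hnn)
    have h8 : 0 ≤ (‖k‖ + a / 2) * √(2 / a) := by positivity
    refine ⟨by linarith, ?_⟩
    rw [norm_smul]
    simp only [Real.norm_ofNat]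
    linarith

lemma IsZeroLimit.exists_closeNear {Ω : Set (Coord n)} {K : Coord n → Coord n →L[ℝ] Coord n}
    {q₀ : Coord n} {k : Coord n →L[ℝ] Coord n} (h : IsZeroLimit Ω K q₀ k) {η : ℝ} (hη : 0 < η) :
    ∃ δ > 0, CloseNear K k q₀ δ η := by
  obtain ⟨δ₀, hδ₀, C, hC, hB, -⟩ := h.exists_boundedNear
  have hC0 : 0 < C := by linarith
  -- The force error has three parts, of size `2εC²`, `2εC²` and `εC²`.
  set ε := η / (5 * C ^ 2) with hε
  have hε0 : 0 < ε := by positivity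
  have h1 : ∀ᶠ q in 𝓝[{q : Coord n | 0 < q 0}] q₀, ‖K q - k‖ < ε := by
    have := h.tendsto.eventually (Metric.ball_mem_nhds k hε0)
    filter_upwards [this] with q hq
    rwa [← dist_eq_norm]
  have h2 : ∀ᶠ q in 𝓝[{q : Coord n | 0 < q 0}] q₀, ‖q 0 • fderiv ℝ K q‖ < ε := by
    have := (tendsto_zero_iff_norm_tendsto_zero
      (E := Coord n →L[ℝ] Coord n →L[ℝ] Coord n).1 h.tendsto_fderiv).eventually
      (Metric.ball_mem_nhds 0 hε0)
    filter_upwards [this] with q hq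
    simpa using hq
  obtain ⟨δ, hδ, hδ'⟩ := halfBall_mem_nhdsWithin (h1.and h2)
  refine ⟨min δ δ₀, lt_min hδ hδ₀, fun q hq hd π hπ => ?_⟩
  obtain ⟨h3, h4⟩ := hδ' q hq (hd.trans (min_le_left _ _))
  have h5 := (hB q hq (hd.trans (min_le_right _ _)) π hπ).1
  have h6 : ‖K q π - k π‖ ≤ ε * C := by
    rw [← sub_apply]
    exact ((K q - k).le_opNorm π).trans (mul_le_mul h3.le h5 (norm_nonneg _) hε0.le)
  have hεη : ε * (5 * C ^ 2) = η := by rw [hε]; field_simp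
  have hCC : C ≤ C ^ 2 := by nlinarith
  have h7 : |inner ℝ (K q π) π - inner ℝ (k π) π| ≤ ε * C ^ 2 := by
    rw [← inner_sub_left]
    refine (abs_real_inner_le_norm _ _).trans ?_
    calc _ ≤ (ε * C) * C := mul_le_mul h6 h5 (norm_nonneg _) (by positivity)
      _ = _ := by ring
  have h8 : |(K q π) 0 - (k π) 0| ≤ ε * C := (PiLp.norm_apply_le (K q π - k π) 0).trans h6
  refine ⟨?_, ?_, ?_⟩
  · rw [← smul_sub, norm_smul]
    simp only [Real.norm_ofNat]
    nlinarith
  · have h9 : zeroForce K q π - modelForce k π = (2 * ((K q π) 0 - (k π) 0)) • π -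
        (2 * (inner ℝ (K q π) π - inner ℝ (k π) π)) • basisVec 0 - residualForce K q π := by
      rw [zeroForce, modelForce]
      module
    rw [h9]
    have e1 : ‖(2 * ((K q π) 0 - (k π) 0)) • π‖ ≤ 2 * (ε * C ^ 2) := by
      rw [norm_smul, norm_mul, Real.norm_ofNat, Real.norm_eq_abs, mul_assoc]
      have := mul_le_mul h8 h5 (norm_nonneg π) (by positivity)
      nlinarith
    have e2 : ‖(2 * (inner ℝ (K q π) π - inner ℝ (k π) π)) • (basisVec 0 : Coord n)‖ ≤
        2 * (ε * C ^ 2) := by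
      rw [norm_smul, norm_mul, Real.norm_ofNat, Real.norm_eq_abs]
      simp only [PiLp.norm_single, norm_one, mul_one]
      linarith
    have e3 : ‖residualForce K q π‖ ≤ ε * C ^ 2 :=
      (norm_residualForce_le K q π).trans (mul_le_mul h4.le
        (pow_le_pow_left₀ (norm_nonneg _) h5 2) (by positivity) hε0.le)
    calc _ ≤ ‖(2 * ((K q π) 0 - (k π) 0)) • π‖ +
          ‖(2 * (inner ℝ (K q π) π - inner ℝ (k π) π)) • (basisVec 0 : Coord n)‖ +
          ‖residualForce K q π‖ :=
        (norm_sub_le _ _).trans (add_le_add_left (norm_sub_le _ _) _)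
      _ ≤ η := by linarith
  · rw [abs_sub_comm, ← hπ]
    refine h7.trans ?_
    nlinarith [mul_pos hε0 (pow_pos hC0 2)]

end

/-! ### A priori estimates along rescaled trajectories. -/

section

variable {n : ℕ}

lemma HasDerivWithinAt.ici_of_Icc {F : Type*} [NormedAddCommGroup F] [NormedSpace ℝ F] {f : ℝ → F}
    {f' : F} {T t : ℝ} (h : HasDerivWithinAt f f' (Icc 0 T) t) (ht : t ∈ Ico 0 T) :
    HasDerivWithinAt f f' (Ici t) t :=
  h.mono_of_mem_nhdsWithin (mem_of_superset (Icc_mem_nhdsGE ht.2) (Icc_subset_Icc_left ht.1))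

namespace ZeroTraj

variable {K : Coord n → Coord n →L[ℝ] Coord n} {k : Coord n →L[ℝ] Coord n} {q₀ : Coord n}
  {δ δ' T C η : ℝ} {q π : ℝ → Coord n}

lemma continuousOn_pos (h : ZeroTraj K q₀ δ T q π) : ContinuousOn q (Icc 0 T) :=
  fun t ht => (h.deriv_pos t ht).continuousWithinAt

lemma mono_radius (h : ZeroTraj K q₀ δ T q π) (hδ : δ ≤ δ') : ZeroTraj K q₀ δ' T q π :=
  { h with near := fun t ht => (h.near t ht).trans hδ }

lemma mom_le (h : ZeroTraj K q₀ δ T q π) (hB : BoundedNear K q₀ δ C) {t : ℝ}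
    (ht : t ∈ Icc 0 T) : ‖π t‖ ≤ C :=
  (hB _ (h.pos t ht) (h.near t ht) _ (h.energy t ht)).1

lemma vel_le (h : ZeroTraj K q₀ δ T q π) (hB : BoundedNear K q₀ δ C) {t : ℝ}
    (ht : t ∈ Icc 0 T) : ‖(2 : ℝ) • K (q t) (π t)‖ ≤ C :=
  (hB _ (h.pos t ht) (h.near t ht) _ (h.energy t ht)).2

/-- Since the velocity is proportional to the height, the logarithm of the height has bounded
velocity; this yields all the height estimates. -/
lemma deriv_log (h : ZeroTraj K q₀ δ T q π) {t : ℝ} (ht : t ∈ Icc 0 T) :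
    HasDerivWithinAt (fun τ => Real.log (q τ 0)) (((2 : ℝ) • K (q t) (π t)) 0) (Icc 0 T) t := by
  have h1 := (hasDerivWithinAt_coord (h.deriv_pos t ht)).log (h.pos t ht).ne'
  refine h1.congr_deriv ?_
  have := (h.pos t ht).ne'
  simp
  field_simp

lemma abs_log_le (h : ZeroTraj K q₀ δ T q π) (hB : BoundedNear K q₀ δ C) {t : ℝ}
    (ht : t ∈ Icc 0 T) : |Real.log (q t 0) - Real.log (q 0 0)| ≤ C * t := by
  have h0 : (0 : ℝ) ∈ Icc 0 T := left_mem_Icc.2 (ht.1.trans ht.2)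
  have := (convex_Icc 0 T).norm_image_sub_le_of_norm_hasDerivWithin_le (C := C)
    (fun τ hτ => h.deriv_log hτ)
    (fun τ hτ => (PiLp.norm_apply_le ((2 : ℝ) • K (q τ) (π τ)) 0).trans (h.vel_le hB hτ)) h0 ht
  simpa [abs_of_nonneg ht.1] using this

lemma height_le (h : ZeroTraj K q₀ δ T q π) (hB : BoundedNear K q₀ δ C) {t : ℝ}
    (ht : t ∈ Icc 0 T) : q t 0 ≤ Real.exp (C * t) * q 0 0 := by
  have h0 : (0 : ℝ) ∈ Icc 0 T := left_mem_Icc.2 (ht.1.trans ht.2)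
  have h1 := (abs_le.1 (h.abs_log_le hB ht)).2
  rw [← Real.log_le_log_iff (h.pos t ht) (mul_pos (Real.exp_pos _) (h.pos 0 h0)),
    Real.log_mul (Real.exp_pos _).ne' (h.pos 0 h0).ne', Real.log_exp]
  linarith

lemma le_height (h : ZeroTraj K q₀ δ T q π) (hB : BoundedNear K q₀ δ C) {t : ℝ}
    (ht : t ∈ Icc 0 T) : Real.exp (-(C * t)) * q 0 0 ≤ q t 0 := by
  have h0 : (0 : ℝ) ∈ Icc 0 T := left_mem_Icc.2 (ht.1.trans ht.2)
  have h1 := (abs_le.1 (h.abs_log_le hB ht)).1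
  rw [← Real.log_le_log_iff (mul_pos (Real.exp_pos _) (h.pos 0 h0)) (h.pos t ht),
    Real.log_mul (Real.exp_pos _).ne' (h.pos 0 h0).ne', Real.log_exp]
  linarith

lemma height_le_exp (h : ZeroTraj K q₀ δ T q π) (hB : BoundedNear K q₀ δ C) (hC : 0 ≤ C) {t : ℝ}
    (ht : t ∈ Icc 0 T) : q t 0 ≤ Real.exp (C * T) * q 0 0 := by
  have h0 : (0 : ℝ) ∈ Icc 0 T := left_mem_Icc.2 (ht.1.trans ht.2)
  refine (h.height_le hB ht).trans (mul_le_mul_of_nonneg_right ?_ (h.pos 0 h0).le)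
  exact Real.exp_le_exp.2 (mul_le_mul_of_nonneg_left ht.2 hC)

/-- The bound is proportional to the initial height, so in bounded time a trajectory that starts
close to the boundary hardly moves in the chart. -/
lemma displacement_le (h : ZeroTraj K q₀ δ T q π) (hB : BoundedNear K q₀ δ C) (hC : 0 ≤ C) {t : ℝ}
    (ht : t ∈ Icc 0 T) : ‖q t - q 0‖ ≤ C * Real.exp (C * T) * T * q 0 0 := by
  have h0 : (0 : ℝ) ∈ Icc 0 T := left_mem_Icc.2 (ht.1.trans ht.2)
  have hx0 := h.pos 0 h0
  have := (convex_Icc 0 T).norm_image_sub_le_of_norm_hasDerivWithin_le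
    (C := (Real.exp (C * T) * q 0 0) * C) (fun τ hτ => h.deriv_pos τ hτ) (fun τ hτ => ?_) h0 ht
  · refine this.trans ?_
    rw [sub_zero, Real.norm_eq_abs, abs_of_nonneg ht.1]
    have : 0 ≤ Real.exp (C * T) * q 0 0 * C := by positivity
    nlinarith [ht.2]
  · rw [norm_smul, Real.norm_eq_abs, abs_of_pos (h.pos τ hτ)]
    exact mul_le_mul (h.height_le_exp hB hC hτ) (h.vel_le hB hτ) (norm_nonneg _) (by positivity)

/-- A trajectory which moves towards the boundary, steeply enough, continues to do so. -/
lemma descent (h : ZeroTraj K q₀ δ T q π) (hk : IsModelOp k) (hη : (2 + ‖k‖) * η ≤ 1 / 2)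
    (hcl : CloseNear K k q₀ δ η) (h0 : (k (π 0)) 0 ≤ -(1 / 2)) {t : ℝ}
    (ht : t ∈ Icc 0 T) : (k (π t)) 0 ≤ -(1 / 2) := by
  have hder : ∀ τ ∈ Icc 0 T, HasDerivWithinAt (fun s => (k (π s)) 0)
      ((k (zeroForce K (q τ) (π τ))) 0) (Icc 0 T) τ := fun τ hτ =>
    hasDerivWithinAt_coord (k.hasFDerivAt.comp_hasDerivWithinAt τ (h.deriv_mom τ hτ))
  refine image_le_of_deriv_right_lt_deriv_boundary (B := fun _ => -(1 / 2)) (B' := fun _ => 0)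
    (fun τ hτ => (hder τ hτ).continuousWithinAt)
    (fun τ hτ => HasDerivWithinAt.ici_of_Icc (hder τ (Ico_subset_Icc_self hτ)) hτ) h0
    (fun _ => hasDerivAt_const _ _) (fun τ hτ heq => ?_) ht
  have hτ' := Ico_subset_Icc_self hτ
  -- In the limiting system the slope `w = (kπ)₀` satisfies `w' = 2w² - 2`, which is `-3/2` at `w =
  -- -1/2`. The errors add up to at most `(2 + ‖k‖)η ≤ 1/2`, so the slope cannot cross this value
  -- upwards.
  obtain ⟨-, h2, h3⟩ := hcl _ (h.pos τ hτ') (h.near τ hτ') _ (h.energy τ hτ')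
  have h4 : |(k (zeroForce K (q τ) (π τ) - modelForce k (π τ))) 0| ≤ ‖k‖ * η :=
    (PiLp.norm_apply_le _ 0).trans ((k.le_opNorm _).trans
      (mul_le_mul_of_nonneg_left h2 (norm_nonneg _)))
  have hnorm : (k (basisVec 0)) 0 = 1 := by rw [← inner_basisVec]; exact hk.normal
  have h5 : (k (modelForce k (π τ))) 0 =
      2 * (k (π τ)) 0 ^ 2 - 2 * inner ℝ (k (π τ)) (π τ) := by
    simp only [modelForce, map_sub, map_smul, PiLp.sub_apply, PiLp.smul_apply, smul_eq_mul, hnorm]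
    ring
  rw [map_sub, PiLp.sub_apply, h5] at h4
  have h6 := (abs_le.1 h4).2
  have h7 := (abs_le.1 h3).1
  have heq' : (k (π τ)) 0 = -(1 / 2) := heq
  rw [heq'] at h6
  nlinarith [norm_nonneg k]

/-- While the slope is at most `-1/2`, the logarithm of the height has velocity at most `-1 + η`,
hence at most `-1/2`. -/
lemma descent_height (h : ZeroTraj K q₀ δ T q π) (hk : IsModelOp k) (hη : (2 + ‖k‖) * η ≤ 1 / 2)
    (hcl : CloseNear K k q₀ δ η) (h0 : (k (π 0)) 0 ≤ -(1 / 2)) {t : ℝ}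
    (ht : t ∈ Icc 0 T) : q t 0 ≤ Real.exp (-(t / 2)) * q 0 0 := by
  have hz : (0 : ℝ) ∈ Icc 0 T := left_mem_Icc.2 (ht.1.trans ht.2)
  have hder : ∀ τ ∈ Icc 0 T, HasDerivWithinAt (fun s => Real.log (q s 0) + s / 2)
      (((2 : ℝ) • K (q τ) (π τ)) 0 + 1 / 2) (Icc 0 T) τ := fun τ hτ =>
    (h.deriv_log hτ).add ((hasDerivWithinAt_id τ _).div_const 2)
  have hanti : AntitoneOn (fun s => Real.log (q s 0) + s / 2) (Icc 0 T) := by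
    refine antitoneOn_of_hasDerivWithinAt_nonpos (convex_Icc 0 T)
      (fun τ hτ => (hder τ hτ).continuousWithinAt)
      (fun τ hτ => (hder τ (interior_subset hτ)).mono interior_subset) fun τ hτ => ?_
    have hτ' := interior_subset hτ
    obtain ⟨h1, -, -⟩ := hcl _ (h.pos τ hτ') (h.near τ hτ') _ (h.energy τ hτ')
    have h2 := (abs_le.1 ((PiLp.norm_apply_le _ 0).trans h1)).2
    have h3 := h.descent hk hη hcl h0 hτ'
    simp only [PiLp.sub_apply, PiLp.smul_apply, smul_eq_mul] at h2 ⊢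
    nlinarith [norm_nonneg k]
  have h1 := hanti hz ht ht.1
  simp only [zero_div, add_zero] at h1
  rw [← Real.log_le_log_iff (h.pos t ht) (mul_pos (Real.exp_pos _) (h.pos 0 hz)),
    Real.log_mul (Real.exp_pos _).ne' (h.pos 0 hz).ne', Real.log_exp]
  linarith

/-- The height, and with it the speed, decays like `exp(-t/2)`; integrating gives a bound that does
not depend on the time, unlike `displacement_le`. -/
lemma descent_displacement (h : ZeroTraj K q₀ δ T q π) (hk : IsModelOp k)
    (hη : (2 + ‖k‖) * η ≤ 1 / 2) (hcl : CloseNear K k q₀ δ η)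
    (hB : BoundedNear K q₀ δ C) (hC : 0 ≤ C) (h0 : (k (π 0)) 0 ≤ -(1 / 2)) {t : ℝ}
    (ht : t ∈ Icc 0 T) : ‖q t - q 0‖ ≤ 2 * C * q 0 0 := by
  have hz : (0 : ℝ) ∈ Icc 0 T := left_mem_Icc.2 (ht.1.trans ht.2)
  have hx0 := h.pos 0 hz
  have hBd (s : ℝ) : HasDerivAt (fun s => 2 * C * q 0 0 * (1 - Real.exp (-(s / 2))))
      (C * q 0 0 * Real.exp (-(s / 2))) s := by
    have h1 : HasDerivAt (fun s : ℝ => -(s / 2)) (-(1 / 2)) s :=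
      ((hasDerivAt_id s).div_const 2).neg
    refine ((h1.exp.const_sub 1).const_mul (2 * C * q 0 0)).congr_deriv ?_
    ring
  have key := image_norm_le_of_norm_deriv_right_le_deriv_boundary (f := fun s => q s - q 0)
    (h.continuousOn_pos.sub continuousOn_const)
    (fun τ hτ => (HasDerivWithinAt.ici_of_Icc (h.deriv_pos τ (Ico_subset_Icc_self hτ)) hτ).sub_const
      (q 0)) (by simp) hBd (fun τ hτ => ?_) ht
  · refine key.trans ?_
    have h2 : 0 ≤ 2 * C * q 0 0 := by positivity
    have := Real.exp_pos (-(t / 2))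
    nlinarith
  · have hτ' := Ico_subset_Icc_self hτ
    rw [norm_smul, Real.norm_eq_abs, abs_of_pos (h.pos τ hτ')]
    calc _ ≤ (Real.exp (-(τ / 2)) * q 0 0) * C :=
          mul_le_mul (h.descent_height hk hη hcl h0 hτ') (h.vel_le hB hτ') (norm_nonneg _)
            (by positivity)
      _ = _ := by ring

end ZeroTraj

end

section

variable {n : ℕ}

/-! ### The explicit solutions of the limiting equations -/

/-- The initial direction of the height. -/
def modelSlope (k : Coord n →L[ℝ] Coord n) (P : Coord n) : ℝ := (k P) 0

/-- The reciprocal of the height of the explicit solution. -/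
def invHeight (w t : ℝ) : ℝ := Real.cosh (2 * t) - w * Real.sinh (2 * t)

/-- The canonical momentum of the explicit solution. -/
def modelCov (k : Coord n →L[ℝ] Coord n) (P : Coord n) (t : ℝ) : Coord n :=
  P + (modelSlope k P * Real.cosh (2 * t) - Real.sinh (2 * t) - modelSlope k P) • basisVec 0

/-- The rescaled momentum of the explicit solution. -/
def modelMom (k : Coord n →L[ℝ] Coord n) (P : Coord n) (t : ℝ) : Coord n :=
  (invHeight (modelSlope k P) t)⁻¹ • modelCov k P t

/-- The position of the explicit solution. -/
def modelPos (k : Coord n →L[ℝ] Coord n) (P : Coord n) (t : ℝ) : Coord n :=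
  basisVec 0 + ((invHeight (modelSlope k P) t)⁻¹ - 1) • k (basisVec 0) +
    (Real.sinh (2 * t) / invHeight (modelSlope k P) t) • (k P - modelSlope k P • k (basisVec 0))

lemma hasDerivAt_cosh_two (t : ℝ) :
    HasDerivAt (fun s => Real.cosh (2 * s)) (2 * Real.sinh (2 * t)) t := by
  refine (((hasDerivAt_id t).const_mul 2).cosh).congr_deriv ?_
  simp; ring

lemma hasDerivAt_sinh_two (t : ℝ) :
    HasDerivAt (fun s => Real.sinh (2 * s)) (2 * Real.cosh (2 * t)) t := by
  refine (((hasDerivAt_id t).const_mul 2).sinh).congr_deriv ?_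
  simp; ring

lemma hasDerivAt_invHeight (w t : ℝ) :
    HasDerivAt (invHeight w) (2 * Real.sinh (2 * t) - 2 * w * Real.cosh (2 * t)) t := by
  refine ((hasDerivAt_cosh_two t).sub ((hasDerivAt_sinh_two t).const_mul w)).congr_deriv ?_
  ring

/-- Twice the reciprocal height is `(1 - w) exp(2t) + (1 + w) exp(-2t)`. -/
lemma invHeight_pos {w : ℝ} (hw : |w| ≤ 1) (t : ℝ) : 0 < invHeight w t := by
  obtain ⟨h1, h2⟩ := abs_le.1 hw
  rw [invHeight, Real.cosh_eq, Real.sinh_eq]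
  have e1 := Real.exp_pos (2 * t)
  have e2 := Real.exp_pos (-(2 * t))
  nlinarith [mul_nonneg (by linarith : 0 ≤ 1 - w) e1.le, mul_nonneg (by linarith : 0 ≤ 1 + w) e2.le]

@[simp] lemma invHeight_zero (w : ℝ) : invHeight w 0 = 1 := by simp [invHeight]

@[simp] lemma modelCov_zero (k : Coord n →L[ℝ] Coord n) (P : Coord n) : modelCov k P 0 = P := by
  simp [modelCov]

@[simp] lemma modelMom_zero (k : Coord n →L[ℝ] Coord n) (P : Coord n) : modelMom k P 0 = P := by
  simp [modelMom]

@[simp] lemma modelPos_zero (k : Coord n →L[ℝ] Coord n) (P : Coord n) :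
    modelPos k P 0 = basisVec 0 := by
  simp [modelPos]

namespace IsModelOp

variable {k : Coord n →L[ℝ] Coord n} {P : Coord n}

lemma apply_zero (hk : IsModelOp k) (v : Coord n) : (k v) 0 = inner ℝ v (k (basisVec 0)) := by
  rw [← hk.symm, inner_basisVec]

lemma normal_apply (hk : IsModelOp k) : (k (basisVec 0)) 0 = 1 := by
  rw [← inner_basisVec]; exact hk.normal

/-- Cauchy–Schwarz for the form of `k`: both `P` and `basisVec 0` are unit vectors for it, and the
slope is their product. The next but one lemma is the case of equality. -/
lemma sq_slope_le (hk : IsModelOp k) (hP : inner ℝ (k P) P = 1) : modelSlope k P ^ 2 ≤ 1 := by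
  rcases eq_or_ne (P - modelSlope k P • basisVec 0) 0 with h | h
  · have h1 : P = modelSlope k P • basisVec 0 := sub_eq_zero.1 h
    have h2 : inner ℝ (k (modelSlope k P • basisVec 0)) (modelSlope k P • (basisVec 0 : Coord n)) = 1 := by
      rw [← h1]; exact hP
    rw [map_smul, real_inner_smul_left, real_inner_smul_right, hk.normal] at h2
    linarith
  · have h1 := hk.pos _ h
    have h3 : inner ℝ (k (basisVec 0)) P = modelSlope k P := by
      rw [real_inner_comm, ← hk.apply_zero, modelSlope]
    rw [map_sub, inner_sub_left, inner_sub_right, inner_sub_right, hP, map_smul] at h1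
    have h4 : inner ℝ (k P) (basisVec 0) = modelSlope k P := by rw [inner_basisVec]; rfl
    simp only [real_inner_smul_left, real_inner_smul_right, hk.normal, h3, h4] at h1
    nlinarith

lemma abs_slope_le (hk : IsModelOp k) (hP : inner ℝ (k P) P = 1) : |modelSlope k P| ≤ 1 :=
  abs_le_one_iff_mul_self_le_one.2 (by nlinarith [hk.sq_slope_le hP])

lemma eq_of_slope_eq_one (hk : IsModelOp k) (hP : inner ℝ (k P) P = 1) (h : modelSlope k P = 1) :
    P = basisVec 0 := by
  by_contra hne
  have h1 := hk.pos _ (sub_ne_zero.2 hne)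
  have h3 : inner ℝ (k (basisVec 0)) P = 1 := by
    rw [real_inner_comm, ← hk.apply_zero, ← modelSlope, h]
  rw [map_sub, inner_sub_left, inner_sub_right, inner_sub_right, hP, hk.normal, h3,
    inner_basisVec] at h1
  have h4 : (k P) 0 = modelSlope k P := rfl
  rw [h4, h] at h1
  norm_num at h1

lemma modelPos_apply_zero (hk : IsModelOp k) (t : ℝ) :
    (modelPos k P t) 0 = (invHeight (modelSlope k P) t)⁻¹ := by
  have h4 : (k P) 0 = modelSlope k P := rfl
  simp [modelPos, hk.normal_apply, h4]

lemma apply_modelCov_zero (hk : IsModelOp k) (t : ℝ) :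
    (k (modelCov k P t)) 0 =
      modelSlope k P * Real.cosh (2 * t) - Real.sinh (2 * t) := by
  have h4 : (k P) 0 = modelSlope k P := rfl
  simp [modelCov, hk.normal_apply, h4]

lemma inner_modelCov (hk : IsModelOp k) (hP : inner ℝ (k P) P = 1) (t : ℝ) :
    inner ℝ (k (modelCov k P t)) (modelCov k P t) = invHeight (modelSlope k P) t ^ 2 := by
  have h3 : inner ℝ (k (basisVec 0)) P = modelSlope k P := by
    rw [real_inner_comm, ← hk.apply_zero, modelSlope]
  have h4 : inner ℝ (k P) (basisVec 0) = modelSlope k P := by rw [inner_basisVec]; rfl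
  simp only [modelCov, map_add, map_smul, inner_add_left, inner_add_right, real_inner_smul_left,
    real_inner_smul_right, hP, h3, h4, hk.normal, invHeight]
  linear_combination (modelSlope k P ^ 2 - 1) * Real.cosh_sq (2 * t)

lemma inner_modelMom (hk : IsModelOp k) (hP : inner ℝ (k P) P = 1) (t : ℝ) :
    inner ℝ (k (modelMom k P t)) (modelMom k P t) = 1 := by
  have := (invHeight_pos (hk.abs_slope_le hP) t).ne'
  simp only [modelMom, map_smul, real_inner_smul_left, real_inner_smul_right,
    hk.inner_modelCov hP]
  field_simp

lemma hasDerivAt_modelCov (t : ℝ) :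
    HasDerivAt (modelCov k P) ((-(2 * invHeight (modelSlope k P) t)) • basisVec 0) t := by
  have h1 := (((hasDerivAt_cosh_two t).const_mul (modelSlope k P)).sub
    (hasDerivAt_sinh_two t)).sub_const (modelSlope k P)
  refine ((h1.smul_const (basisVec 0 : Coord n)).const_add P).congr_deriv ?_
  congr 1
  rw [invHeight]; ring

lemma hasDerivAt_modelPos (hk : IsModelOp k) (hP : inner ℝ (k P) P = 1) (t : ℝ) :
    HasDerivAt (modelPos k P)
      ((modelPos k P t) 0 • ((2 : ℝ) • k (modelMom k P t))) t := by
  have hD := (invHeight_pos (hk.abs_slope_le hP) t).ne'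
  have h1 := hasDerivAt_invHeight (modelSlope k P) t
  have h2 := (((h1.inv hD).sub_const 1).smul_const (k (basisVec 0))).const_add (basisVec 0)
  have h3 := ((hasDerivAt_sinh_two t).div h1 hD).smul_const
    (k P - modelSlope k P • k (basisVec 0))
  refine (h2.add h3).congr_deriv ?_
  rw [hk.modelPos_apply_zero, modelMom, modelCov]
  simp only [map_smul, map_add]
  -- The numerator of the derivative of `sinh / invHeight`, which is constant by `cosh² - sinh² =
  -- 1`.
  have e1 : (2 * Real.cosh (2 * t) * invHeight (modelSlope k P) t - Real.sinh (2 * t) *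
      (2 * Real.sinh (2 * t) - 2 * modelSlope k P * Real.cosh (2 * t))) = 2 := by
    rw [invHeight]
    nlinarith [Real.cosh_sq (2 * t)]
  rw [e1]
  match_scalars
  · field_simp
    ring
  · field_simp

lemma hasDerivAt_modelMom (hk : IsModelOp k) (hP : inner ℝ (k P) P = 1) (t : ℝ) :
    HasDerivAt (modelMom k P) (modelForce k (modelMom k P t)) t := by
  have hD := (invHeight_pos (hk.abs_slope_le hP) t).ne'
  refine (((hasDerivAt_invHeight (modelSlope k P) t).inv hD).smul
    (hasDerivAt_modelCov (k := k) (P := P) t)).congr_deriv ?_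
  rw [modelForce, hk.inner_modelMom hP]
  simp only [modelMom, map_smul, PiLp.smul_apply, hk.apply_modelCov_zero, smul_eq_mul]
  match_scalars <;> (try simp only [Pi.inv_apply]) <;> (field_simp; try ring)

end IsModelOp

/-! ### Comparison with the limiting flow. -/

/-- The limiting vector field. -/
def modelField (k : Coord n →L[ℝ] Coord n) (z : Coord n × Coord n) : Coord n × Coord n :=
  (z.1 0 • ((2 : ℝ) • k z.2), modelForce k z.2)

lemma modelField_contDiff (k : Coord n →L[ℝ] Coord n) : ContDiff ℝ 1 (modelField k) := by
  have h0 : ContDiff ℝ 1 fun z : Coord n × Coord n => z.1 0 :=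
    ((EuclideanSpace.proj 0 : Coord n →L[ℝ] ℝ).comp
      (ContinuousLinearMap.fst ℝ (Coord n) (Coord n))).contDiff
  have h1 : ContDiff ℝ 1 fun z : Coord n × Coord n => (k z.2) 0 :=
    ((EuclideanSpace.proj 0 : Coord n →L[ℝ] ℝ).comp (k.comp
      (ContinuousLinearMap.snd ℝ (Coord n) (Coord n)))).contDiff
  have h2 : ContDiff ℝ 1 fun z : Coord n × Coord n => k z.2 :=
    (k.comp (ContinuousLinearMap.snd ℝ (Coord n) (Coord n))).contDiff
  unfold modelField modelForce
  refine (h0.smul (h2.const_smul (2 : ℝ))).prodMk (((contDiff_const.mul h1).smul contDiff_snd).sub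
    ((contDiff_const.mul (h2.inner ℝ contDiff_snd)).smul contDiff_const))

lemma ContDiff.exists_lipschitzOnWith_closedBall {E F : Type*} [NormedAddCommGroup E]
    [NormedSpace ℝ E] [FiniteDimensional ℝ E] [NormedAddCommGroup F] [NormedSpace ℝ F]
    {f : E → F} (hf : ContDiff ℝ 1 f) (R : ℝ) :
    ∃ L, 1 ≤ L ∧ LipschitzOnWith L f (Metric.closedBall 0 R) := by
  obtain ⟨L, hL⟩ := hf.locallyLipschitz.locallyLipschitzOn.exists_lipschitzOnWith_of_compact
    (isCompact_closedBall (0 : E) R)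
  exact ⟨max 1 L, le_max_left _ _, hL.weaken (le_max_right _ _)⟩

lemma gronwallBound_le {δ L ε x : ℝ} (hL : 1 ≤ L) (hε : 0 ≤ ε) (hx : 0 ≤ x) :
    gronwallBound δ L ε x ≤ (δ + ε) * Real.exp (L * x) := by
  rw [gronwallBound_of_K_ne_0 (by linarith)]
  have h1 : ε / L ≤ ε := div_le_self hε hL
  have h2 : 1 ≤ Real.exp (L * x) := Real.one_le_exp (by positivity)
  have h3 := mul_le_mul_of_nonneg_right h1 (sub_nonneg.2 h2)
  simp only
  nlinarith

/-- Translating and dilating so that the start becomes `basisVec 0` is a symmetry of the limiting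
equations. The rescaled trajectory is therefore an approximate integral curve of `modelField`, and
Grönwall applies with bounds uniform in the trajectory. -/
lemma IsZeroLimit.tracks {Ω : Set (Coord n)} {K : Coord n → Coord n →L[ℝ] Coord n}
    {q₀ : Coord n} {k : Coord n →L[ℝ] Coord n} (h : IsZeroLimit Ω K q₀ k) {P : Coord n}
    (hP : inner ℝ (k P) P = 1) (T : ℝ) {η : ℝ} (hη : 0 < η) :
    ∃ δ > 0, ∃ ε > 0, ∀ T' ≤ T, ∀ q π : ℝ → Coord n, ZeroTraj K q₀ δ T' q π →
      ‖π 0 - P‖ ≤ ε → ∀ t ∈ Icc 0 T',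
        ‖(q 0 0)⁻¹ • (q t - q 0) + basisVec 0 - modelPos k P t‖ ≤ η ∧
          ‖π t - modelMom k P t‖ ≤ η := by
  rcases lt_or_ge T 0 with hT | hT
  · exact ⟨1, one_pos, 1, one_pos, fun T' hT' q π _ _ t ht => by linarith [ht.1, ht.2]⟩
  obtain ⟨δ₀, hδ₀, C, hC, hB, -⟩ := h.exists_boundedNear
  have hC0 : 0 < C := by linarith
  have hcont : ContinuousOn (fun t => ‖(modelPos k P t, modelMom k P t)‖) (Icc 0 T) :=
    fun t _ => ((h.model.hasDerivAt_modelPos hP t).continuousAt.prodMk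
      (h.model.hasDerivAt_modelMom hP t).continuousAt).norm.continuousWithinAt
  obtain ⟨M, hM⟩ := (isCompact_Icc.image_of_continuousOn hcont).bddAbove
  -- A ball that contains both curves: `M` bounds the explicit one, the sum bounds the rescaled
  -- positions and momenta. The field is Lipschitz only on bounded sets.
  set R := max M (C * Real.exp (C * T) * T + 1 + C) with hR
  obtain ⟨L, hL, hLip⟩ := ContDiff.exists_lipschitzOnWith_closedBall (modelField_contDiff k) R
  have hL' : (1 : ℝ) ≤ L := by exact_mod_cast hL
  -- The velocity error is multiplied by the relative height, at most `exp(CT)`, and Grönwall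
  -- contributes `exp(LT)`; the initial error is also `ε`.
  set ε := η / (4 * Real.exp (C * T) * Real.exp (L * T)) with hε
  have hε0 : 0 < ε := by positivity
  obtain ⟨δ₁, hδ₁, hcl⟩ := h.exists_closeNear hε0
  refine ⟨min δ₀ δ₁, lt_min hδ₀ hδ₁, ε, hε0, fun T' hT' q π hq hπ t ht => ?_⟩
  have hq0 := hq.mono_radius (min_le_left δ₀ δ₁)
  have hq1 := hq.mono_radius (min_le_right δ₀ δ₁)
  have h0 : (0 : ℝ) ∈ Icc 0 T' := left_mem_Icc.2 (ht.1.trans ht.2)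
  have hx0 := hq.pos 0 h0
  have hCT : Real.exp (C * T') ≤ Real.exp (C * T) :=
    Real.exp_le_exp.2 (mul_le_mul_of_nonneg_left hT' hC0.le)
  have hheight : ∀ τ ∈ Icc 0 T', (q 0 0)⁻¹ * q τ 0 ≤ Real.exp (C * T) := fun τ hτ => by
    rw [inv_mul_le_iff₀ hx0, mul_comm]
    exact (hq0.height_le_exp hB hC0.le hτ).trans (mul_le_mul_of_nonneg_right hCT hx0.le)
  set f : ℝ → Coord n × Coord n := fun τ => ((q 0 0)⁻¹ • (q τ - q 0) + basisVec 0, π τ) with hf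
  set v : ℝ → Coord n × Coord n := fun τ =>
    ((q 0 0)⁻¹ • (q τ 0 • ((2 : ℝ) • K (q τ) (π τ))), zeroForce K (q τ) (π τ)) with hv
  have hfd : ∀ τ ∈ Icc 0 T', HasDerivWithinAt f (v τ) (Icc 0 T') τ := fun τ hτ =>
    ((((hq.deriv_pos τ hτ).sub_const (q 0)).const_smul (q 0 0)⁻¹).add_const
      (basisVec 0)).prodMk (hq.deriv_mom τ hτ)
  have hgd : ∀ τ, HasDerivAt (fun s => (modelPos k P s, modelMom k P s))
      (modelField k (modelPos k P τ, modelMom k P τ)) τ := fun τ =>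
    (h.model.hasDerivAt_modelPos hP τ).prodMk (h.model.hasDerivAt_modelMom hP τ)
  have key := dist_le_of_approx_trajectories_ODE_of_mem (v := fun _ => modelField k)
    (s := fun _ => Metric.closedBall 0 R) (K := L) (f := f) (f' := v) (a := 0) (b := T')
    (g := fun s => (modelPos k P s, modelMom k P s))
    (g' := fun s => modelField k (modelPos k P s, modelMom k P s))
    (δ := ε) (εf := Real.exp (C * T) * ε) (εg := 0) (fun _ _ => hLip)
    (fun τ hτ => (hfd τ hτ).continuousWithinAt)
    (fun τ hτ => HasDerivWithinAt.ici_of_Icc (hfd τ (Ico_subset_Icc_self hτ)) hτ) ?_ ?_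
    (fun τ _ => (hgd τ).continuousAt.continuousWithinAt) (fun τ _ => (hgd τ).hasDerivWithinAt)
    (by simp) ?_ ?_ t ht
  · have hTt : Real.exp (L * t) ≤ Real.exp (L * T) :=
      Real.exp_le_exp.2 (mul_le_mul_of_nonneg_left (ht.2.trans hT') (by linarith))
    have h1C : 1 ≤ Real.exp (C * T) := Real.one_le_exp (by positivity)
    have key2 : dist (f t) (modelPos k P t, modelMom k P t) ≤ η := by
      rw [sub_zero, add_zero] at key
      refine key.trans ((gronwallBound_le hL' (by positivity) ht.1).trans ?_)
      calc _ ≤ (Real.exp (C * T) * ε + Real.exp (C * T) * ε) * Real.exp (L * T) :=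
            mul_le_mul (by nlinarith) hTt (Real.exp_pos _).le (by positivity)
        _ ≤ η := by
          rw [hε]
          field_simp
          norm_num
    rw [dist_eq_norm, Prod.norm_def] at key2
    exact ⟨(le_max_left _ _).trans key2, (le_max_right _ _).trans key2⟩
  · intro τ hτ'
    have hτ := Ico_subset_Icc_self hτ'
    obtain ⟨c1, c2, -⟩ := hcl _ (hq1.pos τ hτ) (hq1.near τ hτ) _ (hq1.energy τ hτ)
    have hu0 : (f τ).1 0 = (q 0 0)⁻¹ * q τ 0 := by
      simp only [hf, PiLp.add_apply, PiLp.smul_apply, PiLp.sub_apply, smul_eq_mul]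
      simp
      field_simp
      ring
    rw [dist_eq_norm, Prod.norm_def]
    refine max_le ?_ (c2.trans ?_)
    · have : (v τ - modelField k (f τ)).1 =
          ((q 0 0)⁻¹ * q τ 0) • ((2 : ℝ) • K (q τ) (π τ) - (2 : ℝ) • k (π τ)) := by
        simp only [hv, modelField, Prod.fst_sub, hu0]
        simp only [hf]
        module
      rw [this, norm_smul, Real.norm_eq_abs,
        abs_of_pos (mul_pos (inv_pos.2 hx0) (hq.pos τ hτ))]
      exact mul_le_mul (hheight τ hτ) c1 (norm_nonneg _) (Real.exp_pos _).le
    · exact le_mul_of_one_le_left hε0.le (Real.one_le_exp (by positivity))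
  · intro τ hτ'
    have hτ := Ico_subset_Icc_self hτ'
    rw [mem_closedBall_zero_iff, Prod.norm_def]
    refine (max_le ?_ ?_).trans (le_max_right _ _)
    · have h1 := hq0.displacement_le hB hC0.le hτ
      have h2 : ‖(q 0 0)⁻¹ • (q τ - q 0)‖ ≤ C * Real.exp (C * T) * T := by
        rw [norm_smul, norm_inv, Real.norm_eq_abs, abs_of_pos hx0, inv_mul_le_iff₀ hx0]
        refine h1.trans ?_
        rw [mul_comm (q 0 0)]
        refine mul_le_mul_of_nonneg_right ?_ hx0.le
        exact mul_le_mul (mul_le_mul_of_nonneg_left hCT hC0.le) hT' (ht.1.trans ht.2)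
          (by positivity)
      have h3 := norm_add_le ((q 0 0)⁻¹ • (q τ - q 0)) (basisVec 0)
      have h4 : ‖(basisVec 0 : Coord n)‖ = 1 := by simp
      simp only [hf]
      linarith
    · have h1 := hq0.mom_le hB hτ
      have : 0 ≤ C * Real.exp (C * T) * T := by positivity
      simp only [hf]
      linarith
  · intro τ hτ
    rw [mem_closedBall_zero_iff]
    exact (hM (mem_image_of_mem _ ⟨hτ.1, hτ.2.le.trans hT'⟩)).trans (le_max_left _ _)
  · rw [dist_eq_norm, Prod.norm_def]
    refine max_le ?_ ?_
    · simp [hf, hε0.le]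
    · simpa [hf] using hπ

end

/-! ### Confinement of trajectories near the boundary point. -/

section

/-- A curve stays in an open subset `V` of a closed set `Z`, if it is in `V` at any time before
which it stayed in `Z`. -/
lemma mem_of_bootstrap {Y : Type*} [TopologicalSpace Y] {T : ℝ} {f : ℝ → Y} {V Z : Set Y}
    (hf : ContinuousOn f (Icc 0 T)) (hV : IsOpen V) (hZ : IsClosed Z) (hVZ : V ⊆ Z) (h0 : f 0 ∈ V)
    (step : ∀ t ∈ Icc 0 T, (∀ τ ∈ Icc 0 t, f τ ∈ Z) → f t ∈ V) : ∀ t ∈ Icc 0 T, f t ∈ V := by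
  by_contra! hbad
  obtain ⟨t₁, ht₁, hbad⟩ := hbad
  have hcl : IsClosed (Icc 0 T ∩ f ⁻¹' Vᶜ) :=
    hf.preimage_isClosed_of_isClosed isClosed_Icc hV.isClosed_compl
  obtain ⟨t, ⟨ht, htV⟩, hmin⟩ :=
    (isCompact_Icc.of_isClosed_subset hcl inter_subset_left).exists_isLeast ⟨t₁, ht₁, hbad⟩
  have hlt : ∀ τ ∈ Ico 0 t, f τ ∈ V := fun τ hτ => by
    by_contra hn
    exact absurd (hmin ⟨⟨hτ.1, hτ.2.le.trans ht.2⟩, hn⟩) (not_le.2 hτ.2)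
  have ht0 : (0 : ℝ) ≠ t := by
    rintro rfl
    exact htV h0
  have htZ : f t ∈ Z := by
    have h1 : ContinuousWithinAt f (Ico 0 t) t :=
      (hf t ht).mono fun τ hτ => ⟨hτ.1, hτ.2.le.trans ht.2⟩
    have h2 := h1.mem_closure (t := Z) (by rw [closure_Ico ht0]; exact ⟨ht.1, le_rfl⟩)
      fun τ hτ => hVZ (hlt τ hτ)
    rwa [hZ.closure_eq] at h2
  refine htV (step t ht fun τ hτ => ?_)
  rcases hτ.2.lt_or_eq with h | h
  · exact hVZ (hlt τ ⟨hτ.1, h⟩)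
  · exact h ▸ htZ

variable {n : ℕ}

lemma HamiltonAt.congr {H H' : Coord n → Coord n → ℝ} {S : Set ℝ} {q p : ℝ → Coord n} {t : ℝ}
    (hH : HamiltonAt H S q p t) (h : ∀ᶠ q' in 𝓝 (q t), ∀ p', H q' p' = H' q' p') :
    HamiltonAt H' S q p t := by
  have h1 : (fun p' => H (q t) p') = fun p' => H' (q t) p' := funext h.self_of_nhds
  have h2 : (fun q' => H q' (p t)) =ᶠ[𝓝 (q t)] fun q' => H' q' (p t) := h.mono fun q' h' => h' _
  have h3 : ∇ (fun q' => H q' (p t)) (q t) = ∇ (fun q' => H' q' (p t)) (q t) := by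
    unfold gradient
    rw [h2.fderiv_eq]
  unfold HamiltonAt at hH ⊢
  rwa [h1, h3] at hH

lemma residualForce_neg (K : Coord n → Coord n →L[ℝ] Coord n) (q π : Coord n) :
    residualForce K q (-π) = residualForce K q π := by
  refine ext_inner_right ℝ fun v => ?_
  rw [inner_residualForce, inner_residualForce, map_neg, inner_neg_neg]

lemma zeroForce_neg (K : Coord n → Coord n →L[ℝ] Coord n) (q π : Coord n) :
    zeroForce K q (-π) = zeroForce K q π := by
  rw [zeroForce, zeroForce, residualForce_neg, map_neg, inner_neg_neg, PiLp.neg_apply]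
  module

variable {X : Type*} [TopologicalSpace X] [ChartedSpace (EuclideanHalfSpace (n + 1)) X]

/-- The curve `f` and the rescaled momentum `π` satisfy Hamilton's equations with energy `1`, at the
times when `f` is in the domain of the chart `φ`. -/
structure ManTraj (K : Coord n → Coord n →L[ℝ] Coord n)
    (φ : OpenPartialHomeomorph X (EuclideanHalfSpace (n + 1))) (T : ℝ) (f : ℝ → X)
    (π : ℝ → Coord n) : Prop where
  cont : ContinuousOn f (Icc 0 T)
  pos : ∀ t ∈ Icc 0 T, f t ∈ φ.source → 0 < φ.extend (𝓡∂ (n + 1)) (f t) 0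
  deriv_pos : ∀ t ∈ Icc 0 T, f t ∈ φ.source →
    HasDerivWithinAt (fun τ => φ.extend (𝓡∂ (n + 1)) (f τ))
      (φ.extend (𝓡∂ (n + 1)) (f t) 0 • ((2 : ℝ) • K (φ.extend (𝓡∂ (n + 1)) (f t)) (π t)))
      (Icc 0 T) t
  deriv_mom : ∀ t ∈ Icc 0 T, f t ∈ φ.source →
    HasDerivWithinAt π (zeroForce K (φ.extend (𝓡∂ (n + 1)) (f t)) (π t)) (Icc 0 T) t
  energy : ∀ t ∈ Icc 0 T, f t ∈ φ.source →
    inner ℝ (K (φ.extend (𝓡∂ (n + 1)) (f t)) (π t)) (π t) = 1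

namespace ManTraj

variable {K : Coord n → Coord n →L[ℝ] Coord n}
  {φ : OpenPartialHomeomorph X (EuclideanHalfSpace (n + 1))} {T : ℝ} {f : ℝ → X} {π : ℝ → Coord n}

lemma restrict (h : ManTraj K φ T f π) {T' : ℝ} (hT : T' ≤ T) : ManTraj K φ T' f π := by
  have hs : Icc 0 T' ⊆ Icc 0 T := Icc_subset_Icc_right hT
  exact ⟨h.cont.mono hs, fun t ht => h.pos t (hs ht), fun t ht hf => (h.deriv_pos t (hs ht) hf).mono hs,
    fun t ht hf => (h.deriv_mom t (hs ht) hf).mono hs, fun t ht => h.energy t (hs ht)⟩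

lemma shift (h : ManTraj K φ T f π) {s : ℝ} (hs : 0 ≤ s) :
    ManTraj K φ (T - s) (fun t => f (s + t)) (fun t => π (s + t)) := by
  have hm : MapsTo (fun t => s + t) (Icc 0 (T - s)) (Icc 0 T) := fun t ht =>
    ⟨add_nonneg hs ht.1, by linarith [ht.2]⟩
  have hd (t : ℝ) : HasDerivWithinAt (fun t => s + t) 1 (Icc 0 (T - s)) t :=
    ((hasDerivAt_id t).const_add s).hasDerivWithinAt
  refine ⟨h.cont.comp (by fun_prop) hm, fun t ht => h.pos _ (hm ht), fun t ht hf => ?_,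
    fun t ht hf => ?_, fun t ht => h.energy _ (hm ht)⟩
  · exact (HasDerivWithinAt.scomp t (h.deriv_pos _ (hm ht) hf) (hd t) hm).congr_deriv (one_smul _ _)
  · exact (HasDerivWithinAt.scomp t (h.deriv_mom _ (hm ht) hf) (hd t) hm).congr_deriv (one_smul _ _)

/-- Time reversal: the energy and the force are even in the momentum, while the velocity is odd. -/
lemma reverse (h : ManTraj K φ T f π) :
    ManTraj K φ T (fun t => f (T - t)) (fun t => -π (T - t)) := by
  have hm : MapsTo (fun t => T - t) (Icc 0 T) (Icc 0 T) := fun t ht =>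
    ⟨by linarith [ht.2], by linarith [ht.1]⟩
  have hd (t : ℝ) : HasDerivWithinAt (fun t => T - t) (-1) (Icc 0 T) t :=
    ((hasDerivAt_id t).const_sub T).hasDerivWithinAt
  refine ⟨h.cont.comp (by fun_prop) hm, fun t ht => h.pos _ (hm ht), fun t ht hf => ?_,
    fun t ht hf => ?_, fun t ht hf => ?_⟩
  · refine (HasDerivWithinAt.scomp t (h.deriv_pos _ (hm ht) hf) (hd t) hm).congr_deriv ?_
    rw [map_neg]
    module
  · refine (HasDerivWithinAt.scomp t (h.deriv_mom _ (hm ht) hf) (hd t) hm).neg.congr_deriv ?_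
    rw [zeroForce_neg]
    module
  · rw [map_neg, inner_neg_neg]
    exact h.energy _ (hm ht) hf

lemma zeroTraj (h : ManTraj K φ T f π) {q₀ : Coord n} {δ : ℝ} (hf : ∀ t ∈ Icc 0 T, f t ∈ φ.source)
    (hδ : ∀ t ∈ Icc 0 T, ‖φ.extend (𝓡∂ (n + 1)) (f t) - q₀‖ ≤ δ) :
    ZeroTraj K q₀ δ T (fun t => φ.extend (𝓡∂ (n + 1)) (f t)) π :=
  ⟨fun t ht => h.pos t ht (hf t ht), hδ, fun t ht => h.deriv_pos t ht (hf t ht),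
    fun t ht => h.deriv_mom t ht (hf t ht), fun t ht => h.energy t ht (hf t ht)⟩

/-- A trajectory whose displacement is under control stays near the boundary point. -/
lemma confined [T2Space X] (h : ManTraj K φ T f π) {q₀ : Coord n} {δ M : ℝ}
    (hball : ∀ q : Coord n, 0 ≤ q 0 → ‖q - q₀‖ ≤ δ → q ∈ (φ.extend (𝓡∂ (n + 1))).target)
    (h0 : f 0 ∈ φ.source)
    (hM : ∀ t ∈ Icc 0 T, ZeroTraj K q₀ δ t (fun τ => φ.extend (𝓡∂ (n + 1)) (f τ)) π →
      ‖φ.extend (𝓡∂ (n + 1)) (f t) - φ.extend (𝓡∂ (n + 1)) (f 0)‖ ≤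
        M * φ.extend (𝓡∂ (n + 1)) (f 0) 0)
    (hpos : 0 ≤ M * φ.extend (𝓡∂ (n + 1)) (f 0) 0)
    (hlt : ‖φ.extend (𝓡∂ (n + 1)) (f 0) - q₀‖ + M * φ.extend (𝓡∂ (n + 1)) (f 0) 0 < δ) :
    (∀ t ∈ Icc 0 T, f t ∈ φ.source) ∧
      ZeroTraj K q₀ δ T (fun τ => φ.extend (𝓡∂ (n + 1)) (f τ)) π := by
  set B : Set (Coord n) := Metric.closedBall q₀ δ ∩ {q : Coord n | 0 ≤ q 0} with hB
  have hBt : B ⊆ (φ.extend (𝓡∂ (n + 1))).target := fun q hq =>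
    hball q hq.2 (mem_closedBall_iff_norm.1 hq.1)
  have hBc : IsCompact B := (isCompact_closedBall q₀ δ).inter_right
    (isClosed_le continuous_const (EuclideanSpace.proj 0 : Coord n →L[ℝ] ℝ).continuous)
  -- Closed in `X` itself, as a compact subset of a Hausdorff space; hence the curve cannot slip out
  -- of the chart domain between `V` and this set.
  have hZ : IsClosed ((φ.extend (𝓡∂ (n + 1))).symm '' B) :=
    (hBc.image_of_continuousOn (φ.continuousOn_extend_symm.mono hBt)).isClosed
  set V : Set X := φ.source ∩ φ.extend (𝓡∂ (n + 1)) ⁻¹' Metric.ball q₀ δ with hV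
  have hVo : IsOpen V := by
    have h1 := φ.continuousOn_extend (I := 𝓡∂ (n + 1))
    rw [φ.extend_source] at h1
    exact h1.isOpen_inter_preimage φ.open_source Metric.isOpen_ball
  have hVZ : V ⊆ (φ.extend (𝓡∂ (n + 1))).symm '' B := fun z hz => by
    refine ⟨φ.extend (𝓡∂ (n + 1)) z, ⟨Metric.ball_subset_closedBall hz.2, ?_⟩,
      extend_leftInv hz.1⟩
    have := extend_mem_target hz.1
    rw [extend_target_eq] at this
    exact this.2
  have hZ' : ∀ z ∈ (φ.extend (𝓡∂ (n + 1))).symm '' B,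
      z ∈ φ.source ∧ ‖φ.extend (𝓡∂ (n + 1)) z - q₀‖ ≤ δ := by
    rintro _ ⟨q, hq, rfl⟩
    refine ⟨extend_symm_mem_source (hBt hq), ?_⟩
    rw [(φ.extend (𝓡∂ (n + 1))).right_inv (hBt hq)]
    exact mem_closedBall_iff_norm.1 hq.1
  have key := mem_of_bootstrap h.cont hVo hZ hVZ
    ⟨h0, mem_ball_iff_norm.2 (by linarith)⟩ fun t ht hst => by
      have htr := (h.restrict ht.2).zeroTraj (fun τ hτ => (hZ' _ (hst τ hτ)).1)
        fun τ hτ => (hZ' _ (hst τ hτ)).2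
      refine ⟨(hZ' _ (hst t ⟨ht.1, le_rfl⟩)).1, mem_ball_iff_norm.2 ?_⟩
      have h1 := hM t ht htr
      have h2 := norm_sub_le_norm_sub_add_norm_sub (φ.extend (𝓡∂ (n + 1)) (f t))
        (φ.extend (𝓡∂ (n + 1)) (f 0)) q₀
      linarith
  exact ⟨fun t ht => (key t ht).1, h.zeroTraj (fun t ht => (key t ht).1)
    fun t ht => (mem_ball_iff_norm.1 (key t ht).2).le⟩

end ManTraj

/-- The data which describe the metric `g` near the boundary point `y₀`, in the chart `φ`. -/
structure IsFrontModel [IsManifold (𝓡∂ (n + 1)) ∞ X] (g : BilinField n X)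
    (φ : OpenPartialHomeomorph X (EuclideanHalfSpace (n + 1))) (y₀ : X)
    (K : Coord n → Coord n →L[ℝ] Coord n) (k : Coord n →L[ℝ] Coord n) : Prop where
  chart : φ ∈ IsManifold.maximalAtlas (𝓡∂ (n + 1)) ∞ X
  mem_source : y₀ ∈ φ.source
  smooth : HasSmoothSymbol g
  family : IsZeroFamily (interior (φ.extend (𝓡∂ (n + 1))).target) K
  limit : IsZeroLimit (interior (φ.extend (𝓡∂ (n + 1))).target) K (φ.extend (𝓡∂ (n + 1)) y₀) k
  symbol_eq : ∀ q ∈ interior (φ.extend (𝓡∂ (n + 1))).target, ∀ p,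
    symbol g (ofCoord φ q p) = zeroHam K q p

lemma exists_isFrontModel [IsManifold (𝓡∂ (n + 1)) ∞ X] {g : BilinField n X}
    (hg : IsAsymptoticallyHyperbolic g) {y₀ : X} (hy₀ : y₀ ∈ (𝓡∂ (n + 1)).boundary X)
    {φ : OpenPartialHomeomorph X (EuclideanHalfSpace (n + 1))}
    (hφ : φ ∈ IsManifold.maximalAtlas (𝓡∂ (n + 1)) ∞ X) (hy₀φ : y₀ ∈ φ.source) :
    ∃ K k, IsFrontModel g φ y₀ K k := by
  obtain ⟨x, gbar, hx, hxg, hn⟩ := hg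
  obtain ⟨k, hk⟩ := exists_isZeroLimit gbar hx hn hφ hy₀φ hy₀
  exact ⟨_, k, hφ, hy₀φ, hasSmoothSymbol gbar hx hxg, chartOp_isZeroFamily gbar hx hφ, hk,
    fun q hq p => symbol_ofCoord gbar hx hxg hφ hq p⟩

namespace IsFrontModel

variable [IsManifold (𝓡∂ (n + 1)) ∞ X] {g : BilinField n X}
  {φ : OpenPartialHomeomorph X (EuclideanHalfSpace (n + 1))} {y₀ : X}
  {K : Coord n → Coord n →L[ℝ] Coord n} {k : Coord n →L[ℝ] Coord n}

lemma energy_iff (h : IsFrontModel g φ y₀ K k) {q : Coord n}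
    (hq : q ∈ interior (φ.extend (𝓡∂ (n + 1))).target) (p : Coord n) :
    symbol g (ofCoord φ q p) = 0 ↔ inner ℝ (K q (q 0 • p)) (q 0 • p) = 1 := by
  rw [h.symbol_eq q hq, zeroHam, map_smul, real_inner_smul_left, real_inner_smul_right, sub_eq_zero,
    pow_two, mul_assoc]

lemma symbol_hamiltonAt_iff (h : IsFrontModel g φ y₀ K k) {S : Set ℝ} {q p : ℝ → Coord n} {t : ℝ}
    (hq : q t ∈ interior (φ.extend (𝓡∂ (n + 1))).target) :
    HamiltonAt (fun q p => symbol g (ofCoord φ q p)) S q p t ↔ HamiltonAt (zeroHam K) S q p t := by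
  have h1 : ∀ᶠ q' in 𝓝 (q t), ∀ p', symbol g (ofCoord φ q' p') = zeroHam K q' p' := by
    filter_upwards [isOpen_interior.mem_nhds hq] with q' hq' p'
    exact h.symbol_eq q' hq' p'
  exact ⟨fun hH => hH.congr h1, fun hH => hH.congr (h1.mono fun q' h' p' => (h' p').symm)⟩

/-- A null bicharacteristic, in terms of the position and the rescaled momentum. -/
lemma manTraj (h : IsFrontModel g φ y₀ K k) {T : ℝ} {c : ℝ → Cotangent n X}
    (hc : IsHamiltonCurve g (Icc 0 T) c) (h0 : symbol g (c 0) = 0) :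
    ManTraj K φ T (fun t => (c t).proj)
      (fun t => φ.extend (𝓡∂ (n + 1)) (c t).proj 0 • chartMom φ (c t)) := by
  have hi : ∀ t ∈ Icc 0 T, (c t).proj ∈ φ.source →
      φ.extend (𝓡∂ (n + 1)) (c t).proj ∈ interior (φ.extend (𝓡∂ (n + 1))).target :=
    fun t ht hs => extend_mem_interior_target h.chart hs (hc.proj_mem_interior ht)
  have hr : ∀ t ∈ Icc 0 T, (hs : (c t).proj ∈ φ.source) → _ := fun t ht hs =>
    ((h.symbol_hamiltonAt_iff (hi t ht hs)).1 (hc.hamiltonAt h.smooth h.chart ht hs)).rescaled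
      h.family (hi t ht hs)
  refine ⟨hc.continuousOn_proj, fun t ht hs => h.family.pos _ (hi t ht hs),
    fun t ht hs => (hr t ht hs).1, fun t ht hs => (hr t ht hs).2, fun t ht hs => ?_⟩
  rw [← h.energy_iff (hi t ht hs), ofCoord_chartMom h.chart hs, hc.symbol_eq h.smooth ht, h0]

/-- A half ball on which the equations are under control. -/
lemma exists_radius (h : IsFrontModel g φ y₀ K k) :
    ∃ δ > 0, ∃ C ≥ 1, BoundedNear K (φ.extend (𝓡∂ (n + 1)) y₀) δ C ∧
      ∀ q : Coord n, 0 ≤ q 0 → ‖q - φ.extend (𝓡∂ (n + 1)) y₀‖ ≤ δ →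
        q ∈ (φ.extend (𝓡∂ (n + 1))).target := by
  obtain ⟨δ, hδ, C, hC, hB, -⟩ := h.limit.exists_boundedNear
  have h1 := extend_mem_target h.mem_source
  rw [extend_target_eq] at h1
  obtain ⟨r, hr, hrs⟩ := Metric.isOpen_iff.1 (isOpen_symm_preimage_target φ) _ h1.1
  refine ⟨min δ (r / 2), lt_min hδ (half_pos hr), C, hC,
    fun q hq hd => hB q hq (hd.trans (min_le_left _ _)), fun q hq hd => ?_⟩
  rw [extend_target_eq]
  refine ⟨hrs (mem_ball_iff_norm.2 ?_), hq⟩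
  have := hd.trans (min_le_right _ _)
  linarith

lemma height_le_dist (h : IsFrontModel g φ y₀ K k) (q : Coord n) :
    q 0 ≤ ‖q - φ.extend (𝓡∂ (n + 1)) y₀‖ := by
  have := PiLp.norm_apply_le (q - φ.extend (𝓡∂ (n + 1)) y₀) 0
  rw [PiLp.sub_apply, h.limit.zero, sub_zero] at this
  exact (le_abs_self _).trans this

/-- In bounded time, trajectories which start near the boundary point stay near it. -/
lemma stay [T2Space X] (h : IsFrontModel g φ y₀ K k) (T : ℝ) {δ : ℝ} (hδ : 0 < δ) :
    ∃ ρ > 0, ∀ T' ≤ T, ∀ (f : ℝ → X) (π : ℝ → Coord n), ManTraj K φ T' f π → f 0 ∈ φ.source →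
      0 ≤ T' → ‖φ.extend (𝓡∂ (n + 1)) (f 0) - φ.extend (𝓡∂ (n + 1)) y₀‖ ≤ ρ →
      (∀ t ∈ Icc 0 T', f t ∈ φ.source) ∧
        ZeroTraj K (φ.extend (𝓡∂ (n + 1)) y₀) δ T' (fun τ => φ.extend (𝓡∂ (n + 1)) (f τ)) π := by
  rcases lt_or_ge T 0 with hT | hT
  · exact ⟨1, one_pos, fun T' hT' _ _ _ _ h' => by linarith⟩
  obtain ⟨δ₀, hδ₀, C, hC, hB, hball⟩ := h.exists_radius
  have hC0 : 0 < C := by linarith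
  set M := C * Real.exp (C * T) * T with hM
  have hM0 : 0 ≤ M := by positivity
  set δ' := min δ δ₀ with hδ'
  have hδ'0 : 0 < δ' := lt_min hδ hδ₀
  -- The initial height is at most the distance from the boundary point, so distance plus
  -- displacement is at most `(1 + M)` times the distance.
  refine ⟨δ' / (2 * (1 + M)), by positivity, fun T' hT' f π hf hf0 hT'0 hd => ?_⟩
  have hp := hf.pos 0 (left_mem_Icc.2 hT'0) hf0
  have hx := h.height_le_dist (φ.extend (𝓡∂ (n + 1)) (f 0))
  rw [le_div_iff₀ (by positivity)] at hd
  have := hf.confined (q₀ := φ.extend (𝓡∂ (n + 1)) y₀) (δ := δ') (M := M)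
    (fun q hq hqd => hball q hq (hqd.trans (min_le_right _ _))) hf0 (fun t ht htr => ?_)
    (by positivity) (by nlinarith)
  · exact ⟨this.1, this.2.mono_radius (min_le_left _ _)⟩
  · have h1 := (htr.mono_radius (min_le_right δ δ₀)).displacement_le hB hC0.le (t := t)
      ⟨ht.1, le_rfl⟩
    refine h1.trans (mul_le_mul_of_nonneg_right ?_ hp.le)
    have htT := ht.2.trans hT'
    exact mul_le_mul (mul_le_mul_of_nonneg_left (Real.exp_le_exp.2
      (mul_le_mul_of_nonneg_left htT hC0.le)) hC0.le) htT ht.1 (by positivity)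

/-- A trajectory which starts near the boundary point and moves steeply towards the boundary does
not leave the neighbourhood, and descends. -/
lemma trap [T2Space X] (h : IsFrontModel g φ y₀ K k) :
    ∃ ρ > 0, ∀ (T : ℝ) (f : ℝ → X) (π : ℝ → Coord n), ManTraj K φ T f π → f 0 ∈ φ.source →
      ‖φ.extend (𝓡∂ (n + 1)) (f 0) - φ.extend (𝓡∂ (n + 1)) y₀‖ ≤ ρ → (k (π 0)) 0 ≤ -(1 / 2) →
      ∀ t ∈ Icc 0 T, f t ∈ φ.source ∧
        φ.extend (𝓡∂ (n + 1)) (f t) 0 ≤ φ.extend (𝓡∂ (n + 1)) (f 0) 0 := by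
  obtain ⟨δ₀, hδ₀, C, hC, hB, hball⟩ := h.exists_radius
  have hC0 : 0 < C := by linarith
  have hη0 : 0 < 1 / (2 * (2 + ‖k‖)) := by positivity
  obtain ⟨δ₁, hδ₁, hcl⟩ := h.limit.exists_closeNear hη0
  have hη : (2 + ‖k‖) * (1 / (2 * (2 + ‖k‖))) ≤ 1 / 2 := by
    have : 0 < 2 + ‖k‖ := by positivity
    field_simp
    norm_num
  set δ := min δ₀ δ₁ with hδ
  have hδ0 : 0 < δ := lt_min hδ₀ hδ₁
  -- The radius can precede the choice of `T`, because the displacement of a descending trajectory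
  -- is at most `2C` times its initial height at all times.
  refine ⟨δ / (2 * (1 + 2 * C)), by positivity, fun T f π hf hf0 hd hs t ht => ?_⟩
  have hT0 := ht.1.trans ht.2
  have hp := hf.pos 0 (left_mem_Icc.2 hT0) hf0
  have hx := h.height_le_dist (φ.extend (𝓡∂ (n + 1)) (f 0))
  rw [le_div_iff₀ (by positivity)] at hd
  have := hf.confined (q₀ := φ.extend (𝓡∂ (n + 1)) y₀) (δ := δ) (M := 2 * C)
    (fun q hq hqd => hball q hq (hqd.trans (min_le_left _ _))) hf0 (fun t ht htr => ?_)
    (by positivity) (by nlinarith)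
  · refine ⟨this.1 t ht, ?_⟩
    have h1 := (this.2.mono_radius (min_le_right δ₀ δ₁)).descent_height h.limit.model hη hcl hs ht
    refine h1.trans (mul_le_of_le_one_left hp.le (Real.exp_le_one_iff.2 ?_))
    linarith [ht.1]
  · exact htr.descent_displacement h.limit.model hη
      (fun q hq hqd => hcl q hq (hqd.trans (min_le_right _ _)))
      (fun q hq hqd => hB q hq (hqd.trans (min_le_left _ _))) hC0.le hs ⟨ht.1, le_rfl⟩

end IsFrontModel

end

/-! ### Descent to a small fraction of the initial height. -/

section

variable {n : ℕ}

lemma exists_le_invHeight {w : ℝ} (hw : |w| ≤ 1) (hw1 : w < 1) {m : ℝ} (hm : 0 ≤ m) :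
    ∃ T ≥ 0, m ≤ invHeight w T := by
  have h1 : 0 < 1 - w := by linarith
  -- With this time, `(1 - w) exp(2T) / 2 ≥ (1 - w)(2T + 1) / 2 ≥ m`.
  refine ⟨m / (1 - w), by positivity, ?_⟩
  have h2 := Real.add_one_le_exp (2 * (m / (1 - w)))
  have h3 := Real.exp_pos (-(2 * (m / (1 - w))))
  have h4 : (1 - w) * (m / (1 - w)) = m := by field_simp
  rw [invHeight, Real.cosh_eq, Real.sinh_eq]
  nlinarith [(abs_le.1 hw).1, mul_le_mul_of_nonneg_left h2 h1.le,
    mul_nonneg (by linarith [(abs_le.1 hw).1] : 0 ≤ 1 + w) h3.le]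

/-- The slope at time `t` is `-1 + (1 + w) exp(-2t) / invHeight w t`, and the last term is at most
`2 / 8`. -/
lemma IsModelOp.apply_modelMom_zero_le {k : Coord n →L[ℝ] Coord n} (hk : IsModelOp k) {P : Coord n}
    (hP : inner ℝ (k P) P = 1) {t : ℝ} (ht : 0 ≤ t) (hD : 8 ≤ invHeight (modelSlope k P) t) :
    (k (modelMom k P t)) 0 ≤ -(3 / 4) := by
  rw [modelMom, map_smul, PiLp.smul_apply, hk.apply_modelCov_zero, smul_eq_mul,
    inv_mul_le_iff₀ (by linarith)]
  have hw := abs_le.1 (hk.abs_slope_le hP)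
  set w := modelSlope k P
  have h1 : Real.exp (-(2 * t)) ≤ 1 := Real.exp_le_one_iff.2 (by linarith)
  have h2 : w * Real.cosh (2 * t) - Real.sinh (2 * t) =
      -invHeight w t + (1 + w) * Real.exp (-(2 * t)) := by
    rw [invHeight, Real.cosh_eq, Real.sinh_eq]; ring
  rw [h2]
  nlinarith [mul_le_mul_of_nonneg_left h1 (by linarith : 0 ≤ 1 + w)]

lemma rescaled_apply_zero {a b : Coord n} (ha : a 0 ≠ 0) :
    ((a 0)⁻¹ • (b - a) + basisVec 0 : Coord n) 0 = b 0 / a 0 := by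
  simp
  field_simp
  ring

variable {X : Type*} [TopologicalSpace X] [ChartedSpace (EuclideanHalfSpace (n + 1)) X]
  [IsManifold (𝓡∂ (n + 1)) ∞ X] {g : BilinField n X}
  {φ : OpenPartialHomeomorph X (EuclideanHalfSpace (n + 1))} {y₀ : X}
  {K : Coord n → Coord n →L[ℝ] Coord n} {k : Coord n →L[ℝ] Coord n}

/-- Trajectories near the boundary, not vertically ascending at the start, fall to any given
fraction of their initial height, and do not rise again. -/
lemma IsFrontModel.fall [T2Space X] (h : IsFrontModel g φ y₀ K k) {P : Coord n}
    (hP : inner ℝ (k P) P = 1) (hs : modelSlope k P < 1) {η : ℝ} (hη : 0 < η) :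
    ∃ T₀ ≥ 0, ∃ ε > 0, ∃ ρ > 0, ∀ (T : ℝ) (f : ℝ → X) (π : ℝ → Coord n), ManTraj K φ T f π →
      f 0 ∈ φ.source → ‖φ.extend (𝓡∂ (n + 1)) (f 0) - φ.extend (𝓡∂ (n + 1)) y₀‖ ≤ ρ →
      ‖π 0 - P‖ ≤ ε → T₀ ≤ T →
        φ.extend (𝓡∂ (n + 1)) (f T) 0 ≤ η * φ.extend (𝓡∂ (n + 1)) (f 0) 0 := by
  have hk := h.limit.model
  -- The value `8` makes the explicit curve steep at time `T₀`, and `2 / η` brings its height below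
  -- `η / 2`.
  obtain ⟨T₀, hT₀, hD⟩ := exists_le_invHeight (hk.abs_slope_le hP) hs (m := max 8 (2 / η))
    (by positivity)
  have hD8 := (le_max_left _ _).trans hD
  have hDη := (le_max_right _ _).trans hD
  obtain ⟨ρ₁, hρ₁, htrap⟩ := h.trap
  -- A tracking error that keeps the slope below `-3/4 + 1/4` and the relative height below `η / 2 +
  -- η / 2`.
  set η' := min (1 / (4 * (1 + ‖k‖))) (η / 2) with hη'
  have hη'0 : 0 < η' := lt_min (by positivity) (by positivity)
  obtain ⟨δ, hδ, ε, hε, htr⟩ := h.limit.tracks hP T₀ hη'0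
  obtain ⟨ρ, hρ, hstay⟩ := h.stay T₀ (lt_min hδ hρ₁)
  refine ⟨T₀, hT₀, ε, hε, ρ, hρ, fun T f π hf hf0 hd hπ hTT => ?_⟩
  obtain ⟨hsrc, hz⟩ := hstay T₀ le_rfl f π (hf.restrict hTT) hf0 hT₀ hd
  have hm : T₀ ∈ Icc 0 T₀ := ⟨hT₀, le_rfl⟩
  have h0 : (0 : ℝ) ∈ Icc 0 T₀ := ⟨le_rfl, hT₀⟩
  obtain ⟨e1, e2⟩ := htr T₀ le_rfl _ π (hz.mono_radius (min_le_left _ _)) hπ T₀ hm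
  have hx0 := hz.pos 0 h0
  have hslope : (k (π T₀)) 0 ≤ -(1 / 2) := by
    have h1 : |(k (π T₀ - modelMom k P T₀)) 0| ≤ ‖k‖ * η' :=
      (PiLp.norm_apply_le _ 0).trans ((k.le_opNorm _).trans
        (mul_le_mul_of_nonneg_left e2 (norm_nonneg _)))
    have h2 : ‖k‖ * η' ≤ 1 / 4 := by
      have h3 : ‖k‖ * η' ≤ ‖k‖ * (1 / (4 * (1 + ‖k‖))) :=
        mul_le_mul_of_nonneg_left (min_le_left _ _) (norm_nonneg _)
      refine h3.trans ?_
      have : 0 ≤ ‖k‖ := norm_nonneg _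
      rw [mul_one_div, div_le_iff₀ (by positivity)]
      linarith
    rw [map_sub, PiLp.sub_apply] at h1
    have h4 := hk.apply_modelMom_zero_le hP hT₀ hD8
    have h5 := (abs_le.1 h1).2
    linarith
  have hheight : φ.extend (𝓡∂ (n + 1)) (f T₀) 0 ≤ η * φ.extend (𝓡∂ (n + 1)) (f 0) 0 := by
    have h1 := (PiLp.norm_apply_le _ 0).trans e1
    rw [PiLp.sub_apply, rescaled_apply_zero hx0.ne', hk.modelPos_apply_zero] at h1
    have h2 := (abs_le.1 h1).2
    have h3 : (invHeight (modelSlope k P) T₀)⁻¹ ≤ η / 2 := by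
      rw [inv_le_comm₀ (by linarith) (by positivity), inv_div]
      exact hDη
    have h4 : η' ≤ η / 2 := min_le_right _ _
    rw [← div_le_iff₀ hx0]
    linarith
  -- From time `T₀` on, the trajectory is trapped, for however long it lasts.
  have hsh := htrap (T - T₀) _ _ (hf.shift hT₀) (by simpa using hsrc T₀ hm)
    (by simpa using (hz.near T₀ hm).trans (min_le_right _ _)) (by simpa using hslope) (T - T₀)
    ⟨by linarith, le_rfl⟩
  have h6 := hsh.2
  simp only [add_zero, add_sub_cancel] at h6
  exact h6.trans hheight

end

/-! ### Existence of trajectories near the boundary. -/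

section

/-- Global existence for a compactly supported vector field. -/
lemma exists_solution_of_hasCompactSupport {E : Type*} [NormedAddCommGroup E] [NormedSpace ℝ E]
    [FiniteDimensional ℝ E] {v : E → E} (hv : ContDiff ℝ 1 v) (hs : HasCompactSupport v) (x₀ : E)
    {T : ℝ} (hT : 0 ≤ T) :
    ∃ γ : ℝ → E, γ 0 = x₀ ∧ ∀ t ∈ Icc 0 T, HasDerivWithinAt γ (v (γ t)) (Icc 0 T) t := by
  have : CompleteSpace E := FiniteDimensional.complete ℝ E
  obtain ⟨L, hL⟩ := hv.lipschitzWith_of_hasCompactSupport hs one_ne_zero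
  obtain ⟨B, hB⟩ := hs.exists_bound_of_continuous hv.continuous
  have hB0 : 0 ≤ B := (norm_nonneg _).trans (hB x₀)
  lift B to NNReal using hB0
  lift T to NNReal using hT
  have hPL : IsPicardLindelof (fun _ => v) (tmin := 0) (tmax := (T : ℝ))
      ⟨0, left_mem_Icc.2 T.2⟩ x₀ (B * T) 0 B L :=
    { lipschitzOnWith := fun _ _ => hL.lipschitzOnWith
      continuousOn := fun _ _ => continuousOn_const
      norm_le := fun _ _ x _ => hB x
      mul_max_le := by simp }
  exact hPL.exists_eq_forall_mem_Icc_hasDerivWithinAt₀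

/-- Existence of solutions which, for a priori reasons, do not leave an open set `V`. -/
lemma exists_solution_of_apriori {E : Type*} [NormedAddCommGroup E] [NormedSpace ℝ E]
    [FiniteDimensional ℝ E] {v : E → E} {O V Z : Set E} (hO : IsOpen O) (hv : ContDiffOn ℝ 1 v O)
    (hV : IsOpen V) (hZ : IsCompact Z) (hVZ : V ⊆ Z) (hZO : Z ⊆ O) {x₀ : E} (h0 : x₀ ∈ V) {T : ℝ}
    (hT : 0 ≤ T)
    (step : ∀ γ : ℝ → E, γ 0 = x₀ → ∀ t ∈ Icc 0 T,
      (∀ τ ∈ Icc 0 t, γ τ ∈ Z ∧ HasDerivWithinAt γ (v (γ τ)) (Icc 0 t) τ) → γ t ∈ V) :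
    ∃ γ : ℝ → E, γ 0 = x₀ ∧
      ∀ t ∈ Icc 0 T, γ t ∈ V ∧ HasDerivWithinAt γ (v (γ t)) (Icc 0 T) t := by
  obtain ⟨W, hW, hZW, hWO⟩ := exists_compact_between hZ hO hZO
  -- The cut-off field has global solutions and agrees with `v` on `Z`; the a priori estimate then
  -- shows that the solution never feels the cut-off.
  obtain ⟨χ, hχ0, hχ1, -⟩ := exists_contMDiffMap_zero_one_of_isClosed 𝓘(ℝ, E) (n := 1)
    isOpen_interior.isClosed_compl hZ.isClosed (disjoint_compl_left_iff.2 hZW)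
  have hχ : ContDiff ℝ 1 χ := χ.contMDiff.contDiff
  have hsupp : tsupport (fun z => χ z • v z) ⊆ W := by
    refine closure_minimal (fun z hz => ?_) hW.isClosed
    by_contra hn
    have : χ z = 0 := hχ0 fun h => hn (interior_subset h)
    exact hz (by simp [this])
  obtain ⟨γ, hγ0, hγ⟩ := exists_solution_of_hasCompactSupport (v := fun z => χ z • v z)
    (contMDiff_iff_contDiff.1 (contMDiff_of_tsupport fun z hz => contMDiffAt_iff_contDiffAt.2
      (hχ.contDiffAt.smul (hv.contDiffAt (hO.mem_nhds (hWO (hsupp hz)))))))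
    (hW.of_isClosed_subset (isClosed_tsupport _) hsupp) x₀ hT
  have hder : ∀ t ∈ Icc 0 T, γ t ∈ Z → HasDerivWithinAt γ (v (γ t)) (Icc 0 T) t := fun t ht hz => by
    have h1 : χ (γ t) = 1 := hχ1 hz
    simpa [h1] using hγ t ht
  have key := mem_of_bootstrap (fun t ht => (hγ t ht).continuousWithinAt) hV hZ.isClosed hVZ
    (hγ0 ▸ h0) fun t ht hst => step γ hγ0 t ht fun τ hτ =>
      ⟨hst τ hτ, (hder τ ⟨hτ.1, hτ.2.trans ht.2⟩ (hst τ hτ)).mono (Icc_subset_Icc_right ht.2)⟩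
  exact ⟨γ, hγ0, fun t ht => ⟨key t ht, hder t ht (hVZ (key t ht))⟩⟩

variable {n : ℕ}

/-- The Hamilton vector field. -/
def hamField (H : Coord n → Coord n → ℝ) (z : Coord n × Coord n) : Coord n × Coord n :=
  ((InnerProductSpace.toDual ℝ (Coord n)).symm ((fderiv ℝ (Function.uncurry H) z).comp
      (ContinuousLinearMap.inr ℝ (Coord n) (Coord n))),
    -(InnerProductSpace.toDual ℝ (Coord n)).symm ((fderiv ℝ (Function.uncurry H) z).comp
      (ContinuousLinearMap.inl ℝ (Coord n) (Coord n))))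

lemma hamField_contDiffOn {H : Coord n → Coord n → ℝ} {O : Set (Coord n × Coord n)}
    (hO : IsOpen O) (hH : ContDiffOn ℝ ∞ (Function.uncurry H) O) :
    ContDiffOn ℝ 1 (hamField H) O := by
  have h1 : ContDiffOn ℝ 1 (fderiv ℝ (Function.uncurry H)) O :=
    (contDiffOn_infty.1 hH 2).fderiv_of_isOpen hO (by norm_num)
  have h2 (L : Coord n →L[ℝ] Coord n × Coord n) : ContDiffOn ℝ 1 (fun z =>
      (InnerProductSpace.toDual ℝ (Coord n)).symm ((fderiv ℝ (Function.uncurry H) z).comp L)) O :=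
    (InnerProductSpace.toDual ℝ (Coord n)).symm.toContinuousLinearEquiv.contDiff.comp_contDiffOn
      (h1.clm_comp contDiffOn_const)
  exact (h2 _).prodMk (h2 _).neg

lemma hamiltonAt_of_hamField {H : Coord n → Coord n → ℝ} {S : Set ℝ} {γ : ℝ → Coord n × Coord n}
    {t : ℝ} (h : DifferentiableAt ℝ (Function.uncurry H) (γ t))
    (hγ : HasDerivWithinAt γ (hamField H (γ t)) S t) :
    HamiltonAt H S (fun τ => (γ τ).1) (fun τ => (γ τ).2) t := by
  refine (hamiltonAt_iff h).2 ⟨_, _, hγ.fst, hγ.snd, fun v w => ?_⟩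
  simp only [hamField, inner_neg_left, InnerProductSpace.toDual_symm_apply, sub_neg_eq_add]
  rw [ContinuousLinearMap.comp_apply, ContinuousLinearMap.comp_apply, ← map_add]
  simp

variable {Ω : Set (Coord n)} {K : Coord n → Coord n →L[ℝ] Coord n} {k : Coord n →L[ℝ] Coord n}
  {q₀ : Coord n}

lemma zeroTraj_of_hamiltonAt (hK : IsZeroFamily Ω K) {δ T : ℝ} {q p : ℝ → Coord n}
    (hq : ∀ t ∈ Icc 0 T, q t ∈ Ω) (hH : ∀ t ∈ Icc 0 T, HamiltonAt (zeroHam K) (Icc 0 T) q p t)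
    (hd : ∀ t ∈ Icc 0 T, ‖q t - q₀‖ ≤ δ) (h0 : inner ℝ (K (q 0) (q 0 0 • p 0)) (q 0 0 • p 0) = 1) :
    ZeroTraj K q₀ δ T q (fun t => q t 0 • p t) := by
  have hz (t : ℝ) : inner ℝ (K (q t) (q t 0 • p t)) (q t 0 • p t) = zeroHam K (q t) (p t) + 1 := by
    rw [zeroHam, map_smul, real_inner_smul_left, real_inner_smul_right]
    ring
  refine ⟨fun t ht => hK.pos _ (hq t ht), hd, fun t ht => ((hH t ht).rescaled hK (hq t ht)).1,
    fun t ht => ((hH t ht).rescaled hK (hq t ht)).2, fun t ht => ?_⟩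
  have h := (convex_Icc 0 T).norm_image_sub_le_of_norm_hasDerivWithin_le (C := 0)
    (fun τ hτ => (hH τ hτ).energy (zeroHam_differentiableAt hK (hq τ hτ) (p τ)))
    (fun τ _ => by simp) (left_mem_Icc.2 (ht.1.trans ht.2)) ht
  have h' : zeroHam K (q t) (p t) = zeroHam K (q 0) (p 0) := by simpa [sub_eq_zero] using h
  rw [hz, h', ← hz, h0]

/-- The a priori bounds for height, displacement and momentum confine the phase point to a compact
set. The radius is uniform in the starting data, although the unscaled momenta blow up at the
boundary. -/
lemma IsZeroLimit.exists_trajectory (h : IsZeroLimit Ω K q₀ k) (hK : IsZeroFamily Ω K) {T : ℝ}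
    (hT : 0 ≤ T) {δ : ℝ} (hδ : 0 < δ) :
    ∃ r > 0, ∀ a : Coord n, 0 < a 0 → ‖a - q₀‖ ≤ r → ∀ b : Coord n,
      inner ℝ (K a (a 0 • b)) (a 0 • b) = 1 →
        ∃ q p : ℝ → Coord n, q 0 = a ∧ p 0 = b ∧
          (∀ t ∈ Icc 0 T, q t ∈ Ω ∧ HamiltonAt (zeroHam K) (Icc 0 T) q p t) ∧
          ZeroTraj K q₀ δ T q (fun t => q t 0 • p t) := by
  obtain ⟨δ₀, hδ₀, C, hC, hB, hΩ⟩ := h.exists_boundedNear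
  have hC0 : 0 < C := by linarith
  set M := C * Real.exp (C * T) * T with hM
  have hM0 : 0 ≤ M := by positivity
  set δ' := min δ δ₀ with hδ'
  have hδ'0 : 0 < δ' := lt_min hδ hδ₀
  refine ⟨δ' / (2 * (1 + M)), by positivity, fun a ha had b hb => ?_⟩
  rw [le_div_iff₀ (by positivity)] at had
  have hx : a 0 ≤ ‖a - q₀‖ := by
    have := PiLp.norm_apply_le (a - q₀) 0
    rw [PiLp.sub_apply, h.zero, sub_zero] at this
    exact (le_abs_self _).trans this
  -- A lower bound for the height up to time `T`; with it, the bound `C` for `π` bounds `p` by `C /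
  -- m`. The sets `V` and `Z` below leave a margin in both.
  set m := Real.exp (-(C * T)) * a 0 with hm
  have hm0 : 0 < m := by positivity
  have hnorm : ∀ q p : Coord n, m ≤ q 0 → ‖q 0 • p‖ ≤ C → ‖p‖ ≤ C / m := fun q p h1 h2 => by
    rw [norm_smul, Real.norm_eq_abs, abs_of_pos (hm0.trans_le h1)] at h2
    rw [le_div_iff₀ hm0]
    nlinarith [norm_nonneg p]
  have hc0 : Continuous fun z : Coord n × Coord n => z.1 0 :=
    ((EuclideanSpace.proj 0 : Coord n →L[ℝ] ℝ).continuous).comp continuous_fst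
  have hstart : ‖a - q₀‖ + M * a 0 < δ' := by nlinarith
  have key := exists_solution_of_apriori (O := Ω ×ˢ univ) (v := hamField (zeroHam K))
    (V := (Metric.ball q₀ δ' ×ˢ Metric.ball 0 (C / m + 1)) ∩ {z | m / 2 < z.1 0})
    (Z := (Metric.closedBall q₀ δ' ×ˢ Metric.closedBall 0 (C / m + 1)) ∩ {z | m / 2 ≤ z.1 0})
    (x₀ := (a, b)) hK.isOpen_prod (hamField_contDiffOn hK.isOpen_prod (zeroHam_contDiffOn hK))
    ((Metric.isOpen_ball.prod Metric.isOpen_ball).inter (isOpen_lt continuous_const hc0))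
    (((isCompact_closedBall _ _).prod (isCompact_closedBall _ _)).inter_right
      (isClosed_le continuous_const hc0))
    (fun z hz => ⟨⟨Metric.ball_subset_closedBall hz.1.1, Metric.ball_subset_closedBall hz.1.2⟩,
      show m / 2 ≤ z.1 0 from le_of_lt (show m / 2 < z.1 0 from hz.2)⟩)
    (fun z hz => ⟨hΩ _ ((half_pos hm0).trans_le hz.2)
      ((mem_closedBall_iff_norm.1 hz.1.1).trans (min_le_right _ _)), mem_univ _⟩)
    ?_ hT ?_
  · obtain ⟨γ, hγ0, hγ⟩ := key
    have hq : ∀ t ∈ Icc 0 T, (γ t).1 ∈ Ω := fun t ht => by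
      obtain ⟨h1, h2⟩ := (hγ t ht).1
      exact hΩ _ ((half_pos hm0).trans h2)
        ((mem_ball_iff_norm.1 h1.1).le.trans (min_le_right _ _))
    have hH : ∀ t ∈ Icc 0 T, HamiltonAt (zeroHam K) (Icc 0 T) (fun τ => (γ τ).1)
        (fun τ => (γ τ).2) t := fun t ht =>
      hamiltonAt_of_hamField (zeroHam_differentiableAt hK (hq t ht) _) (hγ t ht).2
    exact ⟨_, _, by rw [hγ0], by rw [hγ0], fun t ht => ⟨hq t ht, hH t ht⟩,
      zeroTraj_of_hamiltonAt hK hq hH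
        (fun t ht => (mem_ball_iff_norm.1 (hγ t ht).1.1.1).le.trans (min_le_left _ _))
        (by simpa only [hγ0] using hb)⟩
  · have h1 : m ≤ a 0 := mul_le_of_le_one_left ha.le (Real.exp_le_one_iff.2 (by
      have := mul_nonneg hC0.le hT
      linarith))
    have h2 := hnorm a b h1 (hB a ha (by
      have := min_le_right δ δ₀
      nlinarith [mul_nonneg hM0 ha.le]) _ hb).1
    refine ⟨⟨mem_ball_iff_norm.2 (by nlinarith [mul_nonneg hM0 ha.le]), ?_⟩, ?_⟩
    · rw [mem_ball_zero_iff]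
      linarith
    · change m / 2 < a 0
      linarith
  · intro γ hγ0 t ht hst
    have hq : ∀ τ ∈ Icc 0 t, (γ τ).1 ∈ Ω := fun τ hτ => by
      obtain ⟨h1, h2⟩ := (hst τ hτ).1
      exact hΩ _ ((half_pos hm0).trans_le h2)
        ((mem_closedBall_iff_norm.1 h1.1).trans (min_le_right _ _))
    have htr := zeroTraj_of_hamiltonAt (q₀ := q₀) (δ := δ') hK hq (fun τ hτ =>
      hamiltonAt_of_hamField (zeroHam_differentiableAt hK (hq τ hτ) _) (hst τ hτ).2)
      (fun τ hτ => mem_closedBall_iff_norm.1 (hst τ hτ).1.1.1) (by simpa only [hγ0] using hb)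
    have htr0 := htr.mono_radius (min_le_right δ δ₀)
    have htt : t ∈ Icc 0 t := ⟨ht.1, le_rfl⟩
    have h1 := htr0.displacement_le hB hC0.le htt
    have h2 := htr0.le_height hB htt
    have h3 := htr0.mom_le hB htt
    simp only [hγ0] at h1 h2
    have h4 : m ≤ (γ t).1 0 := by
      refine le_trans (mul_le_mul_of_nonneg_right (Real.exp_le_exp.2 ?_) ha.le) h2
      have := mul_le_mul_of_nonneg_left ht.2 hC0.le
      linarith
    have h5 : C * Real.exp (C * t) * t * a 0 ≤ M * a 0 := by
      refine mul_le_mul_of_nonneg_right ?_ ha.le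
      exact mul_le_mul (mul_le_mul_of_nonneg_left (Real.exp_le_exp.2
        (mul_le_mul_of_nonneg_left ht.2 hC0.le)) hC0.le) ht.2 ht.1 (by positivity)
    have h6 := hnorm _ _ h4 h3
    refine ⟨⟨mem_ball_iff_norm.2 ?_, ?_⟩, ?_⟩
    · have := norm_sub_le_norm_sub_add_norm_sub (γ t).1 a q₀
      linarith
    · rw [mem_ball_zero_iff]
      linarith
    · change m / 2 < (γ t).1 0
      linarith

variable {X : Type*} [TopologicalSpace X] [ChartedSpace (EuclideanHalfSpace (n + 1)) X]
  [IsManifold (𝓡∂ (n + 1)) ∞ X] {g : BilinField n X}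
  {φ : OpenPartialHomeomorph X (EuclideanHalfSpace (n + 1))} {y₀ : X}

lemma IsFrontModel.isHamiltonCurve (h : IsFrontModel g φ y₀ K k) {S : Set ℝ} {q p : ℝ → Coord n}
    (hq : ∀ t ∈ S, q t ∈ interior (φ.extend (𝓡∂ (n + 1))).target ∧
      HamiltonAt (zeroHam K) S q p t) : IsHamiltonCurve g S fun t => ofCoord φ (q t) (p t) :=
  fun t ht => ⟨φ, h.chart, q, p, (hq t ht).1, Eventually.of_forall fun _ => rfl,
    (h.symbol_hamiltonAt_iff (hq t ht).1).2 (hq t ht).2⟩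

end

/-! ### Convergence to the front face in rescaled variables. -/

section

variable {n : ℕ}

/-- The reflection `(s, Y) ↦ (s, -Y)`. -/
def reflect (v : Coord n) : Coord n := (2 * v 0) • basisVec 0 - v

@[simp] lemma reflect_apply_zero (v : Coord n) : reflect v 0 = v 0 := by
  simp [reflect]; ring

@[simp] lemma reflect_apply_succ (v : Coord n) (i : Fin n) : reflect v i.succ = -v i.succ := by
  simp [reflect]

@[simp] lemma reflect_reflect (v : Coord n) : reflect (reflect v) = v := by
  conv_lhs => rw [reflect, reflect_apply_zero, reflect]
  abel

lemma inner_reflect (v w : Coord n) : inner ℝ (reflect v) (reflect w) = inner ℝ v w := by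
  simp only [reflect, inner_sub_left, inner_sub_right, real_inner_smul_left, real_inner_smul_right,
    basisVec_inner, inner_basisVec]
  simp
  ring

lemma reflect_smul (a : ℝ) (v : Coord n) : reflect (a • v) = a • reflect v := by
  simp only [reflect, PiLp.smul_apply, smul_eq_mul]
  module

@[simp] lemma reflect_basisVec_zero : reflect (basisVec 0 : Coord n) = basisVec 0 := by
  simp only [reflect, PiLp.single_apply, if_true]
  module

/-- The scattering covector at the start of a geodesic which arrives at `(z, ζ)`. -/
def startCov (z ζ : Coord n) : Coord n := reflect ζ + (inner ℝ z ζ - ζ 0) • basisVec 0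

/-- Conservation of the momentum of the dilations, which are symmetries of the limiting Hamiltonian.
-/
lemma IsModelOp.inner_modelPos_modelCov {k : Coord n →L[ℝ] Coord n} (hk : IsModelOp k) {P : Coord n}
    (hP : inner ℝ (k P) P = 1) (t : ℝ) : inner ℝ (modelPos k P t) (modelCov k P t) = P 0 := by
  have hD := (invHeight_pos (hk.abs_slope_le hP) t).ne'
  have h3 : inner ℝ (k (basisVec 0)) P = modelSlope k P := by
    rw [real_inner_comm, ← hk.apply_zero, modelSlope]
  have h4 : inner ℝ (k P) (basisVec 0) = modelSlope k P := by rw [inner_basisVec]; rfl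
  have h5 : inner ℝ (basisVec 0 : Coord n) (basisVec 0) = 1 := by simp
  simp only [modelPos, modelCov, inner_add_left, inner_add_right, inner_sub_left,
    real_inner_smul_left, real_inner_smul_right, hP, h3, h4, hk.normal, basisVec_inner, h5]
  field_simp
  rw [invHeight]
  ring

/-- The tangential components of the momentum and the dilation momentum are conserved; at the start
point `basisVec 0` the latter is the transversal component, so together they recover `P`. -/
lemma IsModelOp.startCov_model {k : Coord n →L[ℝ] Coord n} (hk : IsModelOp k) {P : Coord n}
    (hP : inner ℝ (k P) P = 1) (t : ℝ) :
    startCov (reflect (modelPos k P t)) (reflect (modelCov k P t)) = P := by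
  rw [startCov, inner_reflect, reflect_reflect, reflect_apply_zero, hk.inner_modelPos_modelCov hP]
  have : (modelCov k P t) 0 = P 0 +
      (modelSlope k P * Real.cosh (2 * t) - Real.sinh (2 * t) - modelSlope k P) := by
    simp [modelCov]
  rw [this, modelCov]
  module

lemma tendsto_coord_iff {ι : Type*} {l : Filter ι} {f : ι → Coord n} {v : Coord n} :
    Tendsto f l (𝓝 v) ↔ Tendsto (fun j => f j 0) l (𝓝 (v 0)) ∧
      ∀ i : Fin n, Tendsto (fun j => f j i.succ) l (𝓝 (v i.succ)) := by
  constructor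
  · intro h
    have h1 (i : Fin (n + 1)) : Tendsto (fun j => f j i) l (𝓝 (v i)) :=
      ((EuclideanSpace.proj i : Coord n →L[ℝ] ℝ).continuous.tendsto v).comp h
    exact ⟨h1 0, fun i => h1 i.succ⟩
  · rintro ⟨h0, h1⟩
    have h2 : Tendsto (fun j => (f j).ofLp) l (𝓝 v.ofLp) :=
      tendsto_pi_nhds.2 fun i => Fin.cases h0 h1 i
    exact ((PiLp.continuous_toLp 2 fun _ : Fin (n + 1) => ℝ).tendsto v.ofLp).comp h2

variable {X : Type*} [TopologicalSpace X] [ChartedSpace (EuclideanHalfSpace (n + 1)) X]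
  {φ : OpenPartialHomeomorph X (EuclideanHalfSpace (n + 1))} {y₀ : X}

lemma tendsto_phiCoord_iff {ι : Type*} {l : Filter ι}
    {w : ι → (Coord n × Coord n) × (Coord n × Coord n)} {z ζ : Coord n} :
    Tendsto (fun j => phiCoord (w j)) l (𝓝 (frontPoint φ y₀ z ζ)) ↔
      ((Tendsto (fun j => (w j).2.1 0) l (𝓝 (φ.extend (𝓡∂ (n + 1)) y₀ 0)) ∧
        ∀ i : Fin n, Tendsto (fun j => (w j).1.1 i.succ) l
          (𝓝 (φ.extend (𝓡∂ (n + 1)) y₀ i.succ))) ∧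
      (Tendsto (fun j => (w j).1.1 0 / (w j).2.1 0) l (𝓝 (z 0)) ∧
        ∀ i : Fin n, Tendsto (fun j => ((w j).2.1 i.succ - (w j).1.1 i.succ) / (w j).2.1 0) l
          (𝓝 (z i.succ)))) ∧
      ((Tendsto (fun j => (w j).1.1 0 * (w j).1.2 0 + (w j).2.1 0 * (w j).2.2 0 +
          ∑ i : Fin n, ((w j).2.1 i.succ - (w j).1.1 i.succ) * (w j).2.2 i.succ) l (𝓝 0) ∧
        ∀ i : Fin n, Tendsto (fun j => (w j).2.1 0 * ((w j).1.2 i.succ + (w j).2.2 i.succ)) l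
          (𝓝 0)) ∧
      (Tendsto (fun j => (w j).2.1 0 * (w j).1.2 0) l (𝓝 (ζ 0)) ∧
        ∀ i : Fin n, Tendsto (fun j => (w j).2.1 0 * (w j).2.2 i.succ) l (𝓝 (ζ i.succ)))) := by
  rw [frontPoint, nhds_prod_eq, nhds_prod_eq, nhds_prod_eq, tendsto_prod_iff', tendsto_prod_iff',
    tendsto_prod_iff', tendsto_coord_iff, tendsto_coord_iff, tendsto_coord_iff, tendsto_coord_iff]
  simp only [phiCoord, Fin.cons_zero, Fin.cons_succ, PiLp.zero_apply]

lemma inner_coord (v w : Coord n) :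
    inner ℝ v w = v 0 * w 0 + ∑ i : Fin n, v i.succ * w i.succ := by
  rw [PiLp.inner_apply, Fin.sum_univ_succ]
  simp [mul_comm]

/-- In terms of positions and rescaled momenta, convergence to a point of the front face. -/
lemma rescaled_of_tendsto_phiCoord {ι : Type*} {l : Filter ι}
    {w : ι → (Coord n × Coord n) × (Coord n × Coord n)} {z ζ : Coord n}
    (hq : φ.extend (𝓡∂ (n + 1)) y₀ 0 = 0) (hw : ∀ᶠ j in l, 0 < (w j).2.1 0)
    (h : Tendsto (fun j => phiCoord (w j)) l (𝓝 (frontPoint φ y₀ z ζ))) :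
    Tendsto (fun j => (w j).2.1) l (𝓝 (φ.extend (𝓡∂ (n + 1)) y₀)) ∧
      Tendsto (fun j => (w j).1.1) l (𝓝 (φ.extend (𝓡∂ (n + 1)) y₀)) ∧
      Tendsto (fun j => ((w j).2.1 0)⁻¹ • ((w j).1.1 - (w j).2.1) + basisVec 0) l
        (𝓝 (reflect z)) ∧
      Tendsto (fun j => (w j).2.1 0 • (-(w j).2.2)) l (𝓝 (startCov z ζ)) ∧
      Tendsto (fun j => (w j).1.1 0 • (w j).1.2) l (𝓝 (z 0 • reflect ζ)) := by
  obtain ⟨⟨⟨b0, b1⟩, z0, z1⟩, ⟨o0, o1⟩, s0, s1⟩ := tendsto_phiCoord_iff.1 h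
  refine ⟨tendsto_coord_iff.2 ⟨b0, fun i => ?_⟩, tendsto_coord_iff.2 ⟨?_, b1⟩,
    tendsto_coord_iff.2 ⟨?_, fun i => ?_⟩, tendsto_coord_iff.2 ⟨?_, fun i => ?_⟩,
    tendsto_coord_iff.2 ⟨?_, fun i => ?_⟩⟩
  · have h1 := (b1 i).add (b0.mul (z1 i))
    rw [hq, zero_mul, add_zero] at h1
    refine h1.congr' ?_
    filter_upwards [hw] with j hj
    field_simp
    ring
  · have h1 := z0.mul b0
    rw [hq, mul_zero, ← hq] at h1
    refine h1.congr' ?_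
    filter_upwards [hw] with j hj
    field_simp
  · rw [reflect_apply_zero]
    refine z0.congr' ?_
    filter_upwards [hw] with j hj
    rw [rescaled_apply_zero hj.ne']
  · rw [reflect_apply_succ]
    refine (z1 i).neg.congr' ?_
    filter_upwards [hw] with j hj
    simp
    field_simp
    ring
  -- Vanishing of the `dρ/ρ` component is used here: it determines the transversal part of the
  -- starting momentum.
  · have h1 := ((z0.mul s0).add (tendsto_finsetSum Finset.univ fun i _ => (z1 i).mul (s1 i))).sub o0
    have h2 : startCov z ζ 0 = z 0 * ζ 0 + ∑ i : Fin n, z i.succ * ζ i.succ - 0 := by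
      simp [startCov, inner_coord]
    rw [h2]
    refine h1.congr' ?_
    filter_upwards [hw] with j hj
    have h3 : ∀ i : Fin n, ((w j).2.1 i.succ - (w j).1.1 i.succ) / (w j).2.1 0 *
        ((w j).2.1 0 * (w j).2.2 i.succ) = ((w j).2.1 i.succ - (w j).1.1 i.succ) *
          (w j).2.2 i.succ := fun i => by field_simp
    simp only [h3, PiLp.smul_apply, PiLp.neg_apply, smul_eq_mul]
    field_simp
    ring
  · have h2 : startCov z ζ i.succ = -ζ i.succ := by simp [startCov]
    rw [h2]
    refine (s1 i).neg.congr' (Eventually.of_forall fun j => ?_)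
    simp
  · rw [PiLp.smul_apply, reflect_apply_zero, smul_eq_mul]
    refine (z0.mul s0).congr' ?_
    filter_upwards [hw] with j hj
    simp
    field_simp
  · rw [PiLp.smul_apply, reflect_apply_succ, smul_eq_mul]
    -- Vanishing of the `dy/ρ` components: the tangential momentum at the end equals that at the
    -- start.
    have h1 := z0.mul ((o1 i).sub (s1 i))
    rw [zero_sub] at h1
    refine h1.congr' ?_
    filter_upwards [hw] with j hj
    simp
    field_simp
    ring

/-- Converse of `rescaled_of_tendsto_phiCoord`. The unscaled end momentum is recovered by dividing
by the ratio of heights, whence the condition on `z 0`. -/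
lemma tendsto_phiCoord_of_rescaled {ι : Type*} {l : Filter ι}
    {w : ι → (Coord n × Coord n) × (Coord n × Coord n)} {z ζ : Coord n}
    (hq : φ.extend (𝓡∂ (n + 1)) y₀ 0 = 0) (hw : ∀ᶠ j in l, 0 < (w j).2.1 0)
    (hw' : ∀ᶠ j in l, 0 < (w j).1.1 0) (hz : 0 < z 0)
    (h1 : Tendsto (fun j => (w j).2.1) l (𝓝 (φ.extend (𝓡∂ (n + 1)) y₀)))
    (h2 : Tendsto (fun j => ((w j).2.1 0)⁻¹ • ((w j).1.1 - (w j).2.1) + basisVec 0) l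
      (𝓝 (reflect z)))
    (h3 : Tendsto (fun j => (w j).2.1 0 • (-(w j).2.2)) l (𝓝 (startCov z ζ)))
    (h4 : Tendsto (fun j => (w j).1.1 0 • (w j).1.2) l (𝓝 (z 0 • reflect ζ))) :
    Tendsto (fun j => phiCoord (w j)) l (𝓝 (frontPoint φ y₀ z ζ)) := by
  obtain ⟨b0, b1⟩ := tendsto_coord_iff.1 h1
  obtain ⟨u0, u1⟩ := tendsto_coord_iff.1 h2
  obtain ⟨m0, m1⟩ := tendsto_coord_iff.1 h3
  obtain ⟨p0, p1⟩ := tendsto_coord_iff.1 h4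
  have hs (i : Fin n) : startCov z ζ i.succ = -ζ i.succ := by simp [startCov]
  have hs0 : startCov z ζ 0 = z 0 * ζ 0 + ∑ i : Fin n, z i.succ * ζ i.succ := by
    simp [startCov, inner_coord]
  simp only [hs, hs0, reflect_apply_zero, reflect_apply_succ, PiLp.smul_apply, smul_eq_mul,
    PiLp.neg_apply] at u0 u1 m0 m1 p0 p1
  have z0 : Tendsto (fun j => (w j).1.1 0 / (w j).2.1 0) l (𝓝 (z 0)) := by
    refine u0.congr' ?_
    filter_upwards [hw] with j hj
    rw [rescaled_apply_zero hj.ne']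
  have z1 (i : Fin n) : Tendsto (fun j => ((w j).2.1 i.succ - (w j).1.1 i.succ) / (w j).2.1 0) l
      (𝓝 (z i.succ)) := by
    have := (u1 i).neg
    rw [neg_neg] at this
    refine this.congr' ?_
    filter_upwards [hw] with j hj
    simp
    field_simp
    ring
  have s1 (i : Fin n) : Tendsto (fun j => (w j).2.1 0 * (w j).2.2 i.succ) l (𝓝 (ζ i.succ)) := by
    have := (m1 i).neg
    rw [neg_neg] at this
    exact this.congr fun j => by ring
  refine tendsto_phiCoord_iff.2 ⟨⟨⟨b0, fun i => ?_⟩, z0, z1⟩, ⟨?_, fun i => ?_⟩, ?_, s1⟩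
  · have := (b1 i).sub (b0.mul (z1 i))
    rw [hq, zero_mul, sub_zero] at this
    refine this.congr' ?_
    filter_upwards [hw] with j hj
    field_simp
    ring
  · have := (p0.sub m0).add (tendsto_finsetSum Finset.univ fun i _ => (z1 i).mul (s1 i))
    rw [sub_add_eq_sub_sub, sub_self, zero_sub, neg_add_cancel] at this
    refine this.congr' ?_
    filter_upwards [hw] with j hj
    have h3 : ∀ i : Fin n, ((w j).2.1 i.succ - (w j).1.1 i.succ) / (w j).2.1 0 *
        ((w j).2.1 0 * (w j).2.2 i.succ) = ((w j).2.1 i.succ - (w j).1.1 i.succ) *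
          (w j).2.2 i.succ := fun i => by field_simp
    simp only [h3]
    ring
  · have := ((p1 i).div z0 hz.ne').add (s1 i)
    rw [mul_neg, neg_div, mul_div_cancel_left₀ _ hz.ne', neg_add_cancel] at this
    refine this.congr' ?_
    filter_upwards [hw, hw'] with j hj hj'
    simp only [Pi.div_apply]
    field_simp
  · have := p0.div z0 hz.ne'
    rw [mul_div_cancel_left₀ _ hz.ne'] at this
    refine this.congr' ?_
    filter_upwards [hw, hw'] with j hj hj'
    simp only [Pi.div_apply]
    field_simp

end

/-! ### The front Lagrangian consists of the explicit curves. -/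

section

variable {n : ℕ} {X : Type*} [TopologicalSpace X] [ChartedSpace (EuclideanHalfSpace (n + 1)) X]
  [IsManifold (𝓡∂ (n + 1)) ∞ X] {g : BilinField n X}
  {φ : OpenPartialHomeomorph X (EuclideanHalfSpace (n + 1))} {y₀ : X}
  {K : Coord n → Coord n →L[ℝ] Coord n} {k : Coord n →L[ℝ] Coord n}

lemma tendsto_clm_apply {ι : Type*} {l : Filter ι} {L : ι → Coord n →L[ℝ] Coord n}
    {L₀ : Coord n →L[ℝ] Coord n} {v : ι → Coord n} {v₀ : Coord n} (hL : Tendsto L l (𝓝 L₀))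
    (hv : Tendsto v l (𝓝 v₀)) : Tendsto (fun j => L j (v j)) l (𝓝 (L₀ v₀)) :=
  (isBoundedBilinearMap_apply.continuous.tendsto (L₀, v₀)).comp (hL.prodMk_nhds hv)

lemma ofCoord_neg (φ : OpenPartialHomeomorph X (EuclideanHalfSpace (n + 1))) (q p : Coord n) :
    ofCoord φ q (-p) = (⟨(ofCoord φ q p).proj, -(ofCoord φ q p).snd⟩ : Cotangent n X) := by
  have h : covec (-p) = -covec p := map_neg (innerSL ℝ) p
  simp only [ofCoord, h]
  rfl

namespace IsFrontModel

/-- The relation records minus the starting covector, hence the sign in the initial momentum.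
Between its end points the trajectory may leave the chart. -/
lemma exists_manTraj (h : IsFrontModel g φ y₀ K k)
    {w : (Coord n × Coord n) × (Coord n × Coord n)} (hw : w ∈ coordDomain φ)
    (hr : (ofCoord φ w.1.1 w.1.2, ofCoord φ w.2.1 w.2.2) ∈ forwardRelation g) :
    ∃ T ≥ 0, ∃ (f : ℝ → X) (π : ℝ → Coord n), ManTraj K φ T f π ∧ f 0 ∈ φ.source ∧
      f T ∈ φ.source ∧ φ.extend (𝓡∂ (n + 1)) (f 0) = w.2.1 ∧ π 0 = w.2.1 0 • (-w.2.2) ∧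
      φ.extend (𝓡∂ (n + 1)) (f T) = w.1.1 ∧ π T = w.1.1 0 • w.1.2 := by
  obtain ⟨T, hT, c, hc, hc0, h1, h2⟩ := hr
  simp only at h1 h2
  have hq := interior_subset hw.1
  have hq' := interior_subset hw.2
  have h3 : c 0 = ofCoord φ w.2.1 (-w.2.2) := by
    rw [ofCoord_neg, h2, neg_neg]
  have e1 : φ.extend (𝓡∂ (n + 1)) (c T).proj = w.1.1 := by
    rw [← h1]; exact (φ.extend (𝓡∂ (n + 1))).right_inv hq
  have e2 : φ.extend (𝓡∂ (n + 1)) (c 0).proj = w.2.1 := by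
    rw [h3]; exact (φ.extend (𝓡∂ (n + 1))).right_inv hq'
  refine ⟨T, hT, _, _, h.manTraj hc hc0, ?_, ?_, e2, ?_, e1, ?_⟩
  · rw [h3]; exact extend_symm_mem_source hq'
  · rw [← h1]; exact extend_symm_mem_source hq
  · rw [e2, h3, chartMom_ofCoord h.chart hq']
  · rw [e1, ← h1, chartMom_ofCoord h.chart hq]

lemma mem_interior_target_pos {q : Coord n}
    (hq : q ∈ interior (φ.extend (𝓡∂ (n + 1))).target) : 0 < q 0 := by
  rw [interior_extend_target] at hq
  exact hq.2

/-- The travel times of trajectories which converge to a point of the front face are bounded. -/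
lemma exists_time_bound [T2Space X] (h : IsFrontModel g φ y₀ K k) {z ζ : Coord n} (hz : 0 < z 0)
    (hP : inner ℝ (k (startCov z ζ)) (startCov z ζ) = 1) {T : ℕ → ℝ} {f : ℕ → ℝ → X}
    {π : ℕ → ℝ → Coord n} (hT : ∀ j, 0 ≤ T j) (hf : ∀ j, ManTraj K φ (T j) (f j) (π j))
    (hf0 : ∀ j, f j 0 ∈ φ.source) (hfT : ∀ j, f j (T j) ∈ φ.source)
    (h1 : Tendsto (fun j => φ.extend (𝓡∂ (n + 1)) (f j 0)) atTop
      (𝓝 (φ.extend (𝓡∂ (n + 1)) y₀)))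
    (h2 : Tendsto (fun j => φ.extend (𝓡∂ (n + 1)) (f j (T j))) atTop
      (𝓝 (φ.extend (𝓡∂ (n + 1)) y₀)))
    (h3 : Tendsto (fun j => φ.extend (𝓡∂ (n + 1)) (f j (T j)) 0 /
      φ.extend (𝓡∂ (n + 1)) (f j 0) 0) atTop (𝓝 (z 0)))
    (h4 : Tendsto (fun j => π j 0) atTop (𝓝 (startCov z ζ)))
    (h5 : Tendsto (fun j => π j (T j)) atTop (𝓝 (z 0 • reflect ζ))) :
    ∃ T₀ ≥ 0, ∀ᶠ j in atTop, T j ≤ T₀ := by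
  have hk := h.limit.model
  have hp0 (j : ℕ) := (hf j).pos 0 ⟨le_rfl, hT j⟩ (hf0 j)
  have hpT (j : ℕ) := (hf j).pos (T j) ⟨hT j, le_rfl⟩ (hfT j)
  have hclose {v : ℕ → Coord n} {a : Coord n} (hv : Tendsto v atTop (𝓝 a)) {ε : ℝ} (hε : 0 < ε) :
      ∀ᶠ j in atTop, ‖v j - a‖ ≤ ε := by
    filter_upwards [hv.eventually (Metric.closedBall_mem_nhds a hε)] with j hj
    exact mem_closedBall_iff_norm.1 hj
  -- Slope less than `1`: a long trajectory would end below half of the limiting ratio of heights.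
  -- Slope `1` is vertical ascent, where the reversed trajectory is used.
  rcases (abs_le.1 (hk.abs_slope_le hP)).2.lt_or_eq with hs | hs
  · obtain ⟨T₀, hT₀, ε, hε, ρ, hρ, hfall⟩ := h.fall hP hs (half_pos hz)
    refine ⟨T₀, hT₀, ?_⟩
    filter_upwards [hclose h1 hρ, hclose h4 hε, h3.eventually (lt_mem_nhds (half_lt_self hz))]
      with j e1 e2 e3
    by_contra! hTj
    have := hfall (T j) (f j) (π j) (hf j) (hf0 j) e1 e2 hTj.le
    rw [lt_div_iff₀ (hp0 j)] at e3
    linarith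
  · have hPe := hk.eq_of_slope_eq_one hP hs
    -- If the starting covector is vertical, so is `ζ`, say `c • basisVec 0`. The definition of
    -- `startCov` then forces `z 0 * c = 1`, so the arrival momentum is the upward unit covector as
    -- well.
    have h6 : z 0 • reflect ζ = basisVec 0 := by
      set c : ℝ := 1 - (inner ℝ z ζ - ζ 0) with hc
      have e1 : reflect ζ = c • basisVec 0 := by
        rw [startCov] at hPe
        rw [eq_sub_of_add_eq hPe, hc]
        module
      have e2 : ζ = c • basisVec 0 := by
        rw [← reflect_reflect ζ, e1, reflect_smul, reflect_basisVec_zero]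
      have e3 : z 0 * c = 1 := by
        have e4 : inner ℝ z ζ = z 0 * c := by
          rw [e2, real_inner_smul_right, inner_basisVec, mul_comm]
        have e5 : ζ 0 = c := by rw [e2]; simp
        rw [e4, e5] at hc
        linarith
      rw [e1, smul_smul, e3, one_smul]
    have hneg : inner ℝ (k (-basisVec 0)) (-basisVec 0 : Coord n) = 1 := by
      rw [map_neg, inner_neg_neg, hk.normal]
    have hsneg : modelSlope k (-basisVec 0) < 1 := by
      rw [modelSlope, map_neg, PiLp.neg_apply, hk.normal_apply]
      norm_num
    -- The reversed trajectory starts straight down. With this `η`, its fall would make the ratio of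
    -- heights at least `2 z 0`, against its limit `z 0`.
    obtain ⟨T₀, hT₀, ε, hε, ρ, hρ, hfall⟩ := h.fall hneg hsneg
      (η := 1 / (2 * z 0)) (by positivity)
    rw [h6] at h5
    refine ⟨T₀, hT₀, ?_⟩
    filter_upwards [hclose h2 hρ, hclose h5 hε, h3.eventually (gt_mem_nhds
      (show z 0 < 2 * z 0 by linarith))] with j e1 e2 e3
    by_contra! hTj
    have := hfall (T j) _ _ (hf j).reverse (by simpa using hfT j) (by simpa using e1)
      (by
        rw [sub_zero, ← norm_neg]
        convert! e2 using 2
        abel) hTj.le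
    simp only [sub_self, sub_zero] at this
    rw [div_lt_iff₀ (hp0 j)] at e3
    rw [one_div, le_inv_mul_iff₀ (by positivity)] at this
    linarith

/-- The points of the Lagrangian lie on the explicit curves. -/
lemma exists_model_of_mem [T2Space X] (h : IsFrontModel g φ y₀ K k) {z ζ : Coord n}
    (hmem : (z, ζ) ∈ frontLagrangian g φ y₀) :
    ∃ P, inner ℝ (k P) P = 1 ∧ ∃ T ≥ 0, modelPos k P T = reflect z ∧
      modelCov k P T = reflect ζ := by
  obtain ⟨hz, hcl⟩ := hmem
  simp only at hz hcl
  obtain ⟨v, hv, hvlim⟩ := mem_closure_iff_seq_limit.1 hcl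
  choose w hw hwv using hv
  obtain rfl : (fun j => phiCoord (w j)) = v := funext hwv
  choose T hT f π hf hf0 hfT e0 m0 eT mT using fun j => h.exists_manTraj (hw j).1 (hw j).2
  have hpos (j : ℕ) : 0 < (w j).2.1 0 := mem_interior_target_pos (hw j).1.2
  obtain ⟨l1, l2, l3, l4, l5⟩ := rescaled_of_tendsto_phiCoord h.limit.zero
    (Eventually.of_forall hpos) hvlim
  simp only [← m0, ← mT] at l4 l5
  simp only [← e0, ← eT] at l1 l2 l3
  have hk := h.limit.model
  set P := startCov z ζ with hPdef
  have hp0 (j : ℕ) := (hf j).pos 0 ⟨le_rfl, hT j⟩ (hf0 j)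
  have hP : inner ℝ (k P) P = 1 := by
    have t1 : Tendsto (fun j => φ.extend (𝓡∂ (n + 1)) (f j 0)) atTop
        (𝓝[{q : Coord n | 0 < q 0}] φ.extend (𝓡∂ (n + 1)) y₀) :=
      tendsto_nhdsWithin_iff.2 ⟨l1, Eventually.of_forall hp0⟩
    have t2 := (tendsto_clm_apply (h.limit.tendsto.comp t1) l4).inner (𝕜 := ℝ) l4
    refine tendsto_nhds_unique t2 (tendsto_const_nhds.congr fun j => ?_)
    exact ((hf j).energy 0 ⟨le_rfl, hT j⟩ (hf0 j)).symm
  have hratio : Tendsto (fun j => φ.extend (𝓡∂ (n + 1)) (f j (T j)) 0 /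
      φ.extend (𝓡∂ (n + 1)) (f j 0) 0) atTop (𝓝 (z 0)) := by
    have := (tendsto_coord_iff.1 l3).1
    rw [reflect_apply_zero] at this
    exact this.congr fun j => rescaled_apply_zero (hp0 j).ne'
  obtain ⟨T₀, hT₀, hTb⟩ := h.exists_time_bound hz hP hT hf hf0 hfT l1 l2 hratio l4 l5
  have key : ∀ η > 0, ∀ᶠ j in atTop,
      ‖(φ.extend (𝓡∂ (n + 1)) (f j 0) 0)⁻¹ • (φ.extend (𝓡∂ (n + 1)) (f j (T j)) -
        φ.extend (𝓡∂ (n + 1)) (f j 0)) + basisVec 0 - modelPos k P (T j)‖ ≤ η ∧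
      ‖π j (T j) - modelMom k P (T j)‖ ≤ η := by
    intro η hη
    obtain ⟨δ, hδ, ε, hε, htr⟩ := h.limit.tracks hP T₀ hη
    obtain ⟨ρ, hρ, hstay⟩ := h.stay T₀ hδ
    filter_upwards [hTb, l1.eventually (Metric.closedBall_mem_nhds _ hρ),
      l4.eventually (Metric.closedBall_mem_nhds _ hε)] with j j1 j2 j3
    exact htr (T j) j1 _ _ (hstay (T j) j1 _ _ (hf j) (hf0 j) (hT j)
      (mem_closedBall_iff_norm.1 j2)).2 (mem_closedBall_iff_norm.1 j3) (T j) ⟨hT j, le_rfl⟩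
  have lim0 {F : ℕ → Coord n} (hF : ∀ η > 0, ∀ᶠ j in atTop, ‖F j‖ ≤ η) :
      Tendsto F atTop (𝓝 0) := by
    rw [Metric.tendsto_nhds]
    intro η hη
    filter_upwards [hF (η / 2) (half_pos hη)] with j hj
    rw [dist_zero_right]
    linarith
  -- Only the travel times need a subsequence: positions and momenta at the end converge already,
  -- and they approach the explicit curve at time `T j`.
  obtain ⟨T', hT', ψ, hψ, hlim⟩ := isCompact_Icc.tendsto_subseq'
    (hTb.mono fun j hj => (⟨hT j, hj⟩ : T j ∈ Icc 0 T₀)).frequently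
  have c1 := ((h.limit.model.hasDerivAt_modelPos hP T').continuousAt.tendsto.comp hlim)
  have c2 := ((h.limit.model.hasDerivAt_modelMom hP T').continuousAt.tendsto.comp hlim)
  have d1 := (lim0 fun η hη => (key η hη).mono fun j hj => hj.1).comp hψ.tendsto_atTop
  have d2 := (lim0 fun η hη => (key η hη).mono fun j hj => hj.2).comp hψ.tendsto_atTop
  have r1 : modelPos k P T' = reflect z := by
    refine tendsto_nhds_unique c1 ?_
    have := (l3.comp hψ.tendsto_atTop).sub d1
    rw [sub_zero] at this
    exact this.congr fun j => by simp
  have r2 : modelMom k P T' = z 0 • reflect ζ := by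
    refine tendsto_nhds_unique c2 ?_
    have := (l5.comp hψ.tendsto_atTop).sub d2
    rw [sub_zero] at this
    exact this.congr fun j => by simp
  refine ⟨P, hP, T', hT'.1, r1, ?_⟩
  -- Both rescaled momenta carry the same height factor, which can be cancelled.
  have r3 : (invHeight (modelSlope k P) T')⁻¹ = z 0 := by
    rw [← hk.modelPos_apply_zero, r1, reflect_apply_zero]
  rw [modelMom, r3] at r2
  exact smul_right_injective _ hz.ne' r2

/-- The points of the explicit curves belong to the Lagrangian. -/
lemma model_mem [T2Space X] (h : IsFrontModel g φ y₀ K k) {P : Coord n}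
    (hP : inner ℝ (k P) P = 1) {T : ℝ} (hT : 0 ≤ T) :
    (reflect (modelPos k P T), reflect (modelCov k P T)) ∈ frontLagrangian g φ y₀ := by
  have hk := h.limit.model
  have hz : 0 < (reflect (modelPos k P T)) 0 := by
    rw [reflect_apply_zero, hk.modelPos_apply_zero]
    exact inv_pos.2 (invHeight_pos (hk.abs_slope_le hP) T)
  refine ⟨hz, ?_⟩
  set q₀ := φ.extend (𝓡∂ (n + 1)) y₀ with hq₀
  have key : ∀ η > 0, ∃ w : (Coord n × Coord n) × (Coord n × Coord n), (w ∈ coordDomain φ ∧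
      (ofCoord φ w.1.1 w.1.2, ofCoord φ w.2.1 w.2.2) ∈ forwardRelation g) ∧
      ‖w.2.1 - q₀‖ ≤ η ∧
      ‖(w.2.1 0)⁻¹ • (w.1.1 - w.2.1) + basisVec 0 - modelPos k P T‖ ≤ η ∧
      ‖w.2.1 0 • (-w.2.2) - P‖ ≤ η ∧ ‖w.1.1 0 • w.1.2 - modelMom k P T‖ ≤ η := by
    intro η hη
    obtain ⟨δ, hδ, ε, hε, htr⟩ := h.limit.tracks hP T hη
    obtain ⟨r, hr, hex⟩ := h.limit.exists_trajectory h.family hT hδ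
    have ha0 (s : ℝ) : (q₀ + s • basisVec 0 : Coord n) 0 = s := by
      have h00 : q₀ 0 = 0 := h.limit.zero
      simp [h00]
    have ha (s : ℝ) : ‖(q₀ + s • basisVec 0 : Coord n) - q₀‖ = |s| := by
      rw [add_sub_cancel_left, norm_smul]; simp
    have t1 : Tendsto (fun s : ℝ => q₀ + s • basisVec 0) (𝓝[>] 0)
        (𝓝[{q : Coord n | 0 < q 0}] q₀) := by
      refine tendsto_nhdsWithin_iff.2 ⟨?_, ?_⟩
      · have : Continuous fun s : ℝ => q₀ + s • (basisVec 0 : Coord n) := by fun_prop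
        have h2 := (this.tendsto 0).mono_left (nhdsWithin_le_nhds (s := Ioi (0 : ℝ)))
        simpa using h2
      · filter_upwards [self_mem_nhdsWithin] with s hs
        change 0 < (q₀ + s • basisVec 0 : Coord n) 0
        rw [ha0]
        exact hs
    have t2 : Tendsto (fun s : ℝ => inner ℝ (K (q₀ + s • basisVec 0) P) P) (𝓝[>] 0) (𝓝 1) := by
      rw [← hP]
      exact (tendsto_clm_apply (h.limit.tendsto.comp t1) tendsto_const_nhds).inner tendsto_const_nhds
    have t3 : Tendsto (fun s : ℝ => (√(inner ℝ (K (q₀ + s • basisVec 0) P) P))⁻¹ • P) (𝓝[>] 0)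
        (𝓝 P) := by
      have := ((Real.continuous_sqrt.tendsto 1).comp t2).inv₀ (by simp)
      rw [Real.sqrt_one, inv_one] at this
      simpa using this.smul_const P
    have t4 : Tendsto (fun s : ℝ => |s|) (𝓝[>] 0) (𝓝 0) := by
      simpa using (continuous_abs.tendsto (0 : ℝ)).mono_left (nhdsWithin_le_nhds (s := Ioi (0 : ℝ)))
    obtain ⟨s, hs, s1, s2, s3, s4⟩ := ((show ∀ᶠ s in 𝓝[>] (0 : ℝ), s ∈ Ioi 0 from
      self_mem_nhdsWithin).and
      ((t2.eventually (lt_mem_nhds one_pos)).and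
      ((t3.eventually (Metric.closedBall_mem_nhds _ (lt_min hε hη))).and
      ((t4.eventually (gt_mem_nhds hr)).and (t4.eventually (gt_mem_nhds hη)))))).exists
    have hs0 : 0 < s := hs
    set a : Coord n := q₀ + s • basisVec 0 with hadef
    -- At the point `a` the vector `P` has energy `1` only in the limit; dividing by `lam` puts the
    -- start exactly on the characteristic variety.
    set lam := √(inner ℝ (K a P) P) with hlam
    have hlam0 : 0 < lam := Real.sqrt_pos.2 s1
    set b : Coord n := s⁻¹ • lam⁻¹ • P with hb
    have hab : a 0 • b = lam⁻¹ • P := by rw [ha0, hb, smul_inv_smul₀ hs0.ne']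
    have hen : inner ℝ (K a (a 0 • b)) (a 0 • b) = 1 := by
      rw [hab, map_smul, real_inner_smul_left, real_inner_smul_right, ← Real.sq_sqrt s1.le, ← hlam]
      field_simp
    obtain ⟨q, p, hq0, hp0, hH, htraj⟩ := hex a (by rw [ha0]; exact hs0) (by rw [ha]; exact s3.le)
      b hen
    have h0T : (0 : ℝ) ∈ Icc 0 T := ⟨le_rfl, hT⟩
    have hTT : T ∈ Icc 0 T := ⟨hT, le_rfl⟩
    have hclose : ‖lam⁻¹ • P - P‖ ≤ min ε η := mem_closedBall_iff_norm.1 s2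
    have htrack := htr T le_rfl q _ htraj (by
      simp only [hq0, hp0, hab]
      exact hclose.trans (min_le_left _ _)) T hTT
    -- The starting covector enters the relation with the opposite sign.
    refine ⟨((q T, p T), (a, -b)), ⟨⟨(hH T hTT).1, ?_⟩, T, hT, _, h.isHamiltonCurve hH, ?_, rfl,
      ?_⟩, ?_, ?_, ?_, htrack.2⟩
    · rw [← hq0]; exact (hH 0 h0T).1
    · rw [hq0, hp0, h.energy_iff (by rw [← hq0]; exact (hH 0 h0T).1)]
      exact hen
    · rw [hq0, hp0]
      exact ofCoord_neg φ a b
    · rw [ha]; exact s4.le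
    · simpa only [hq0] using htrack.1
    · simp only [neg_neg, hab]
      exact hclose.trans (min_le_right _ _)
  choose! w hw using key
  have hη (j : ℕ) : (0 : ℝ) < 1 / ((j : ℝ) + 1) := by positivity
  have lim {F : ℕ → Coord n} {a : Coord n} (hF : ∀ j : ℕ, ‖F j - a‖ ≤ 1 / ((j : ℝ) + 1)) :
      Tendsto F atTop (𝓝 a) := by
    rw [tendsto_iff_norm_sub_tendsto_zero]
    exact squeeze_zero (fun _ => norm_nonneg _) hF tendsto_one_div_add_atTop_nhds_zero_nat
  have hr : (invHeight (modelSlope k P) T)⁻¹ = (reflect (modelPos k P T)) 0 := by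
    rw [reflect_apply_zero, hk.modelPos_apply_zero]
  refine mem_closure_of_tendsto (f := fun j : ℕ => phiCoord (w (1 / ((j : ℝ) + 1)))) (b := atTop)
    (tendsto_phiCoord_of_rescaled h.limit.zero
      (Eventually.of_forall fun j => mem_interior_target_pos (hw _ (hη j)).1.1.2)
      (Eventually.of_forall fun j => mem_interior_target_pos (hw _ (hη j)).1.1.1) hz
      (lim fun j => (hw _ (hη j)).2.1) ?_ ?_ ?_)
    (Eventually.of_forall fun j => mem_image_of_mem _ (hw _ (hη j)).1)
  · rw [reflect_reflect]
    exact lim fun j => (hw _ (hη j)).2.2.1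
  · rw [hk.startCov_model hP]
    exact lim fun j => (hw _ (hη j)).2.2.2.1
  · rw [reflect_reflect, ← hr]
    exact lim fun j => (hw _ (hη j)).2.2.2.2

end IsFrontModel

end

section

variable {n : ℕ} {k : Coord n →L[ℝ] Coord n}

/-! ### The model metric -/

lemma IsModelOp.injective (hk : IsModelOp k) : Function.Injective (k : Coord n →ₗ[ℝ] Coord n) := by
  rw [← LinearMap.ker_eq_bot, LinearMap.ker_eq_bot']
  intro v hv
  by_contra hne
  have h1 := hk.pos v hne
  have h2 : k v = 0 := hv
  rw [h2, inner_zero_left] at h1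
  exact lt_irrefl _ h1

lemma IsModelOp.exists_apply_eq (hk : IsModelOp k) (v : Coord n) : ∃ x, k x = v :=
  LinearMap.injective_iff_surjective.1 hk.injective v

/-- A square root of a symmetric positive definite operator. -/
lemma IsModelOp.exists_root (hk : IsModelOp k) :
    ∃ S : Coord n →ₗ[ℝ] Coord n, ∀ v w, inner ℝ (S v) (S w) = inner ℝ (k v) w := by
  have hT : (k : Coord n →ₗ[ℝ] Coord n).IsSymmetric := fun v w => hk.symm v w
  have hn : Module.finrank ℝ (Coord n) = n + 1 := finrank_euclideanSpace_fin
  set b := hT.eigenvectorBasis hn with hb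
  set ev := hT.eigenvalues hn with hev
  have hbk (i : Fin (n + 1)) : k (b i) = ev i • b i := by
    exact hT.apply_eigenvectorBasis hn i
  have hev0 (i : Fin (n + 1)) : 0 ≤ ev i := by
    have h1 := hk.pos (b i) (b.orthonormal.ne_zero i)
    rw [hbk, real_inner_smul_left, real_inner_self_eq_norm_sq, b.norm_eq_one] at h1
    linarith
  refine ⟨{ toFun := fun v => WithLp.toLp 2 fun i => √(ev i) * inner ℝ (b i) v
            map_add' := fun v w => by ext i; simp [inner_add_right, mul_add]
            map_smul' := fun a v => by ext i; simp [inner_smul_right]; ring }, fun v w => ?_⟩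
  rw [PiLp.inner_apply, ← b.sum_inner_mul_inner (k v) w]
  refine Finset.sum_congr rfl fun i _ => ?_
  rw [hk.symm, hbk, real_inner_smul_right, real_inner_comm (b i) v]
  change √(ev i) * inner ℝ (b i) w * (√(ev i) * inner ℝ (b i) v) = _
  linear_combination (inner ℝ (b i) v * inner ℝ (b i) w) * Real.mul_self_sqrt (hev0 i)

/-- The second condition says `AᵀA = k⁻¹`, which leaves the freedom of an orthogonal factor. Since
`k₀₀ = 1`, a root `S` of `k` sends `basisVec 0` to a unit vector, a reflection `U` brings it back,
and `A = U S k⁻¹` preserves the height. -/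
lemma IsModelOp.exists_frame (hk : IsModelOp k) :
    ∃ A : Coord n ≃L[ℝ] Coord n, (∀ z, A z 0 = z 0) ∧
      ∀ v w, inner ℝ (A (k v)) (A w) = inner ℝ v w := by
  obtain ⟨S, hS⟩ := hk.exists_root
  have hSe : ‖S (basisVec 0)‖ = ‖(basisVec 0 : Coord n)‖ := by
    have h1 := hS (basisVec 0) (basisVec 0)
    rw [hk.normal, real_inner_self_eq_norm_sq] at h1
    have h2 : ‖(basisVec 0 : Coord n)‖ = 1 := by simp
    rw [h2]
    nlinarith [norm_nonneg (S (basisVec 0))]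
  set U := (Submodule.span ℝ {S (basisVec 0) - (basisVec 0 : Coord n)})ᗮ.reflection with hU
  have hUe : U (S (basisVec 0)) = basisVec 0 := Submodule.reflection_sub hSe
  set M : Coord n →ₗ[ℝ] Coord n := U.toLinearEquiv.toLinearMap ∘ₗ S with hM
  have hMM (v w : Coord n) : inner ℝ (M v) (M w) = inner ℝ (k v) w := by
    rw [← hS]
    exact U.inner_map_map _ _
  have hMe : M (basisVec 0) = basisVec 0 := hUe
  have hMinj : Function.Injective M := by
    rw [← LinearMap.ker_eq_bot, LinearMap.ker_eq_bot']
    intro v hv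
    by_contra hne
    have h1 := hk.pos v hne
    rw [← hMM, hv, inner_zero_left] at h1
    exact lt_irrefl _ h1
  set A := (LinearEquiv.ofInjectiveEndo _ hk.injective).symm.trans
    (LinearEquiv.ofInjectiveEndo M hMinj) with hA
  have hAk (v : Coord n) : A (k v) = M v := by
    have h1 : (LinearEquiv.ofInjectiveEndo _ hk.injective).symm (k v) = v :=
      (LinearEquiv.ofInjectiveEndo _ hk.injective).symm_apply_apply v
    rw [hA, LinearEquiv.trans_apply, h1]
    rfl
  refine ⟨A.toContinuousLinearEquiv, fun z => ?_, fun v w => ?_⟩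
  · obtain ⟨x, rfl⟩ := hk.exists_apply_eq z
    change A (k x) 0 = (k x) 0
    rw [hAk, ← inner_basisVec, ← inner_basisVec, ← hMM, hMe]
  · obtain ⟨x, rfl⟩ := hk.exists_apply_eq w
    change inner ℝ (A (k v)) (A (k x)) = _
    rw [hAk, hAk, hMM, hk.symm]

/-- The pull-back of the metric of the upper half space by `A`, if `A` preserves the height. -/
def frontMetric (A : Coord n ≃L[ℝ] Coord n) (z : Coord n) : Coord n →L[ℝ] Coord n →L[ℝ] ℝ :=
  ((z 0) ^ 2)⁻¹ • (innerSL ℝ).bilinearComp (A : Coord n →L[ℝ] Coord n) (A : Coord n →L[ℝ] Coord n)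

lemma frontMetric_apply (A : Coord n ≃L[ℝ] Coord n) (z v w : Coord n) :
    frontMetric A z v w = inner ℝ (A v) (A w) / z 0 ^ 2 := by
  rw [frontMetric, div_eq_inv_mul]
  rfl

lemma frontMetric_isHyperbolic (A : Coord n ≃L[ℝ] Coord n) (hA : ∀ z, A z 0 = z 0) :
    IsHyperbolic (frontMetric A) :=
  ⟨A, hA, fun z _ v w => by rw [frontMetric_apply, hA]⟩

/-- From `AᵀA = k⁻¹`, the inverse of the metric at `z` is `(z 0)² k`. -/
lemma halfSpaceHam_frontMetric (A : Coord n ≃L[ℝ] Coord n)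
    (hk : ∀ v w, inner ℝ (A (k v)) (A w) = inner ℝ v w) {z : Coord n} (hz : 0 < z 0)
    (ζ : Coord n) : halfSpaceHam (frontMetric A) z ζ = zeroHam (fun _ => k) z ζ := by
  have hs (v w : Coord n) : frontMetric A z v w = frontMetric A z w v := by
    rw [frontMetric_apply, frontMetric_apply, real_inner_comm]
  have hp (v : Coord n) (hv : v ≠ 0) : 0 < frontMetric A z v v := by
    rw [frontMetric_apply, real_inner_self_eq_norm_sq]
    have : 0 < ‖A v‖ := norm_pos_iff.2 (by simpa using hv)
    positivity
  have h1 : sharpOp (frontMetric A z) ζ = z 0 ^ 2 • k ζ := by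
    have h2 (w : Coord n) : frontMetric A z (sharpOp (frontMetric A z) ζ - z 0 ^ 2 • k ζ) w = 0 := by
      rw [map_sub, map_smul, sub_apply, smul_apply, apply_sharpOp hp,
        frontMetric_apply, hk, smul_eq_mul]
      field_simp
      ring
    by_contra hne
    exact (hp _ (sub_ne_zero.2 hne)).ne' (h2 _)
  rw [halfSpaceHam, coNormSq_covec hs hp, h1, zeroHam, real_inner_smul_left]

/-! ### The flowout -/

lemma isOpen_halfSpace : IsOpen {q : Coord n | 0 < q 0} :=
  isOpen_lt continuous_const (EuclideanSpace.proj 0 : Coord n →L[ℝ] ℝ).continuous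

lemma IsModelOp.isZeroFamily (hk : IsModelOp k) :
    IsZeroFamily {q : Coord n | 0 < q 0} fun _ => k where
  isOpen := isOpen_halfSpace
  pos _ hq := hq
  smooth := contDiffOn_const
  symm _ _ := hk.symm

lemma zeroForce_const (q π : Coord n) : zeroForce (fun _ => k) q π = modelForce k π := by
  have : residualForce (fun _ => k) q π = 0 := by
    refine ext_inner_right ℝ fun v => ?_
    rw [inner_residualForce]
    simp
  rw [zeroForce, modelForce, this, sub_zero]

lemma hamiltonAt_frontMetric_iff (A : Coord n ≃L[ℝ] Coord n)
    (hA : ∀ v w, inner ℝ (A (k v)) (A w) = inner ℝ v w) {S : Set ℝ} {q p : ℝ → Coord n} {t : ℝ}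
    (hq : 0 < q t 0) :
    HamiltonAt (halfSpaceHam (frontMetric A)) S q p t ↔
      HamiltonAt (zeroHam fun _ => k) S q p t := by
  have h : ∀ᶠ q' in 𝓝 (q t), ∀ p', halfSpaceHam (frontMetric A) q' p' =
      zeroHam (fun _ => k) q' p' := by
    filter_upwards [isOpen_halfSpace.mem_nhds hq] with q' hq' p'
    exact halfSpaceHam_frontMetric A hA hq' p'
  exact ⟨fun hH => hH.congr h, fun hH => hH.congr (h.mono fun q' h' p' => (h' p').symm)⟩

lemma IsModelOp.modelPos_pos (hk : IsModelOp k) {P : Coord n} (hP : inner ℝ (k P) P = 1) (t : ℝ) :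
    0 < (modelPos k P t) 0 := by
  rw [hk.modelPos_apply_zero]
  exact inv_pos.2 (invHeight_pos (hk.abs_slope_le hP) t)

lemma IsModelOp.modelPos_smul_modelCov (hk : IsModelOp k) {P : Coord n} (t : ℝ) :
    (modelPos k P t) 0 • modelCov k P t = modelMom k P t := by
  rw [hk.modelPos_apply_zero, modelMom]

lemma IsModelOp.hamiltonAt_model (hk : IsModelOp k) {P : Coord n} (hP : inner ℝ (k P) P = 1)
    (S : Set ℝ) (t : ℝ) : HamiltonAt (zeroHam fun _ => k) S (modelPos k P) (modelCov k P) t := by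
  have hq := hk.modelPos_pos hP t
  refine (hamiltonAt_iff (zeroHam_differentiableAt hk.isZeroFamily hq _)).2
    ⟨_, _, (hk.hasDerivAt_modelPos hP t).hasDerivWithinAt, hasDerivAt_modelCov t |>.hasDerivWithinAt,
      fun v w => ?_⟩
  rw [fderiv_zeroHam hk.isZeroFamily hq, hk.inner_modelCov hP, ← hk.modelPos_smul_modelCov]
  have hD : invHeight (modelSlope k P) t ≠ 0 := (invHeight_pos (hk.abs_slope_le hP) t).ne'
  simp only [map_smul, real_inner_smul_left, basisVec_inner, hk.modelPos_apply_zero]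
  simp
  field_simp
  ring

/-- In rescaled variables both curves solve the same smooth autonomous system and stay in a compact
set, where the field is Lipschitz. Dividing by the positive height returns the momentum. -/
lemma IsModelOp.flow_unique (hk : IsModelOp k) {T : ℝ} (hT : 0 ≤ T) {q p : ℝ → Coord n}
    (hq : ∀ t ∈ Icc 0 T, 0 < q t 0 ∧ HamiltonAt (zeroHam fun _ => k) (Icc 0 T) q p t)
    (h0 : q 0 = basisVec 0) (hP : inner ℝ (k (p 0)) (p 0) = 1) :
    q T = modelPos k (p 0) T ∧ p T = modelCov k (p 0) T := by
  set f : ℝ → Coord n × Coord n := fun t => (q t, q t 0 • p t) with hf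
  set m : ℝ → Coord n × Coord n := fun t => (modelPos k (p 0) t, modelMom k (p 0) t) with hm
  have hfd : ∀ t ∈ Icc 0 T, HasDerivWithinAt f (modelField k (f t)) (Icc 0 T) t := fun t ht => by
    have h1 := (hq t ht).2.rescaled hk.isZeroFamily (hq t ht).1
    rw [zeroForce_const] at h1
    exact h1.1.prodMk h1.2
  have hmd : ∀ t, HasDerivAt m (modelField k (m t)) t := fun t =>
    (hk.hasDerivAt_modelPos hP t).prodMk (hk.hasDerivAt_modelMom hP t)
  have hfc : ContinuousOn f (Icc 0 T) := fun t ht => (hfd t ht).continuousWithinAt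
  have hmc : ContinuousOn m (Icc 0 T) := fun t _ => (hmd t).continuousAt.continuousWithinAt
  obtain ⟨R, hR⟩ := ((isCompact_Icc.image_of_continuousOn hfc).union
    (isCompact_Icc.image_of_continuousOn hmc)).isBounded.subset_closedBall 0
  obtain ⟨L, -, hL⟩ := ContDiff.exists_lipschitzOnWith_closedBall (modelField_contDiff k) R
  have h0T : (0 : ℝ) ∈ Icc 0 T := ⟨le_rfl, hT⟩
  have key := ODE_solution_unique_of_mem_Icc_right (v := fun _ => modelField k)
    (s := fun _ => Metric.closedBall 0 R) (fun _ _ => hL) hfc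
    (fun t ht => HasDerivWithinAt.ici_of_Icc (hfd t (Ico_subset_Icc_self ht)) ht)
    (fun t ht => hR (Or.inl (mem_image_of_mem _ (Ico_subset_Icc_self ht)))) hmc
    (fun t _ => (hmd t).hasDerivWithinAt)
    (fun t ht => hR (Or.inr (mem_image_of_mem _ (Ico_subset_Icc_self ht))))
    (by simp [hf, hm, h0]) (right_mem_Icc.2 hT)
  have e1 : q T = modelPos k (p 0) T := congrArg Prod.fst key
  have e2 : q T 0 • p T = modelMom k (p 0) T := congrArg Prod.snd key
  refine ⟨e1, ?_⟩
  rw [← hk.modelPos_smul_modelCov, ← e1] at e2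
  exact smul_right_injective _ (hq T (right_mem_Icc.2 hT)).1.ne' e2

lemma IsModelOp.mem_flowout_iff (hk : IsModelOp k) (A : Coord n ≃L[ℝ] Coord n)
    (hA : ∀ v w, inner ℝ (A (k v)) (A w) = inner ℝ v w) (z ζ : Coord n) :
    (z, ζ) ∈ flowout (frontMetric A) (diagPoint n) ↔
      ∃ P, inner ℝ (k P) P = 1 ∧ ∃ T ≥ 0, modelPos k P T = z ∧ modelCov k P T = ζ := by
  have he : 0 < (diagPoint n) 0 := by simp
  have hunit (p : Coord n) : halfSpaceHam (frontMetric A) (diagPoint n) p = 0 ↔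
      inner ℝ (k p) p = 1 := by
    rw [halfSpaceHam_frontMetric A hA he, zeroHam]
    simp [sub_eq_zero]
  constructor
  · rintro ⟨T, hT, q, p, hqp, hq0, hp0, rfl, rfl⟩
    have h := hk.flow_unique hT (fun t ht => ⟨(hqp t ht).1,
      (hamiltonAt_frontMetric_iff A hA (hqp t ht).1).1 (hqp t ht).2⟩) hq0 ((hunit _).1 hp0)
    exact ⟨p 0, (hunit _).1 hp0, T, hT, h.1.symm, h.2.symm⟩
  · rintro ⟨P, hP, T, hT, rfl, rfl⟩
    refine ⟨T, hT, modelPos k P, modelCov k P, fun t _ => ⟨hk.modelPos_pos hP t,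
      (hamiltonAt_frontMetric_iff A hA (hk.modelPos_pos hP t)).2 (hk.hamiltonAt_model hP _ t)⟩,
      modelPos_zero k P, ?_, rfl, rfl⟩
    rw [modelCov_zero, hunit]
    exact hP

/-! ### Reflection -/

/-- The reflection, as a linear map. -/
def reflectL (n : ℕ) : Coord n →L[ℝ] Coord n :=
  (2 : ℝ) • (EuclideanSpace.proj 0 : Coord n →L[ℝ] ℝ).smulRight (basisVec 0) -
    ContinuousLinearMap.id ℝ (Coord n)

lemma reflectL_apply (v : Coord n) : reflectL n v = reflect v := by
  simp [reflectL, reflect, smul_smul]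

/-- The reflected operator. -/
def reflectOp (k : Coord n →L[ℝ] Coord n) : Coord n →L[ℝ] Coord n :=
  (reflectL n).comp (k.comp (reflectL n))

lemma reflectOp_apply (k : Coord n →L[ℝ] Coord n) (v : Coord n) :
    reflectOp k v = reflect (k (reflect v)) := by
  simp [reflectOp, reflectL_apply]

lemma inner_reflect_left (v w : Coord n) : inner ℝ (reflect v) w = inner ℝ v (reflect w) := by
  rw [← inner_reflect, reflect_reflect]

lemma IsModelOp.reflectOp (hk : IsModelOp k) : IsModelOp (reflectOp k) where
  symm v w := by
    rw [reflectOp_apply, reflectOp_apply, inner_reflect_left, hk.symm, inner_reflect_left]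
  pos v hv := by
    rw [reflectOp_apply, inner_reflect_left]
    refine hk.pos _ fun h => hv ?_
    rw [← reflect_reflect v, h, ← reflectL_apply, map_zero]
  normal := by
    rw [reflectOp_apply, inner_reflect_left, reflect_basisVec_zero, hk.normal]

lemma modelSlope_reflectOp (k : Coord n →L[ℝ] Coord n) (P : Coord n) :
    modelSlope (reflectOp k) (reflect P) = modelSlope k P := by
  rw [modelSlope, reflectOp_apply, reflect_reflect, reflect_apply_zero, modelSlope]

lemma modelPos_reflectOp (k : Coord n →L[ℝ] Coord n) (P : Coord n) (t : ℝ) :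
    modelPos (reflectOp k) (reflect P) t = reflect (modelPos k P t) := by
  rw [modelPos, modelPos, modelSlope_reflectOp]
  simp only [reflectOp_apply, ← reflectL_apply, map_add, map_smul, map_sub]
  simp only [reflectL_apply, reflect_basisVec_zero, reflect_reflect]

lemma modelCov_reflectOp (k : Coord n →L[ℝ] Coord n) (P : Coord n) (t : ℝ) :
    modelCov (reflectOp k) (reflect P) t = reflect (modelCov k P t) := by
  rw [modelCov, modelCov, modelSlope_reflectOp]
  simp only [← reflectL_apply, map_add, map_smul]
  simp only [reflectL_apply, reflect_basisVec_zero]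

/-! ### The front Lagrangian as a flowout, and the limit of the symbol. -/

variable {X : Type*} [TopologicalSpace X] [ChartedSpace (EuclideanHalfSpace (n + 1)) X]
  [IsManifold (𝓡∂ (n + 1)) ∞ X] {g : BilinField n X}
  {φ : OpenPartialHomeomorph X (EuclideanHalfSpace (n + 1))} {y₀ : X}
  {K : Coord n → Coord n →L[ℝ] Coord n}

namespace IsFrontModel

/-- The Lagrangian consists of reflected curves of `k`, because `Y` is minus the rescaled tangential
displacement; these are the curves of the reflected operator. -/
lemma frontLagrangian_eq_flowout [T2Space X] (h : IsFrontModel g φ y₀ K k)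
    (A : Coord n ≃L[ℝ] Coord n)
    (hA : ∀ v w, inner ℝ (A (reflectOp k v)) (A w) = inner ℝ v w) :
    frontLagrangian g φ y₀ = flowout (frontMetric A) (diagPoint n) := by
  have hk := h.limit.model
  ext ⟨z, ζ⟩
  rw [hk.reflectOp.mem_flowout_iff A hA]
  constructor
  · intro hmem
    obtain ⟨P, hP, T, hT, e1, e2⟩ := h.exists_model_of_mem hmem
    refine ⟨reflect P, ?_, T, hT, ?_, ?_⟩
    · rw [reflectOp_apply, inner_reflect, reflect_reflect, hP]
    · rw [modelPos_reflectOp, e1, reflect_reflect]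
    · rw [modelCov_reflectOp, e2, reflect_reflect]
  · rintro ⟨P, hP, T, hT, rfl, rfl⟩
    have hP' : inner ℝ (k (reflect P)) (reflect P) = 1 := by
      rw [← hP, reflectOp_apply, inner_reflect_left]
    have := h.model_mem hP' hT
    rwa [← modelPos_reflectOp, ← modelCov_reflectOp, reflect_reflect] at this

/-- The symbol is `⟪Kπ, π⟫ - 1` with `π` the rescaled left momentum, which converges to `z 0 •
reflect ζ`, while `K` converges to `k`. -/
lemma tendsto_symbol (h : IsFrontModel g φ y₀ K k) (A : Coord n ≃L[ℝ] Coord n)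
    (hA : ∀ v w, inner ℝ (A (reflectOp k v)) (A w) = inner ℝ v w) {z : Coord n} (hz : 0 < z 0)
    (ζ : Coord n) :
    Tendsto (fun w => symbol g (ofCoord φ w.1.1 w.1.2)) (towardsFront φ y₀ z ζ)
      (𝓝 (halfSpaceHam (frontMetric A) z ζ)) := by
  have hdom : ∀ᶠ w in towardsFront φ y₀ z ζ, w ∈ coordDomain φ :=
    mem_inf_of_right (mem_principal_self _)
  have hlim : Tendsto (fun w => phiCoord w) (towardsFront φ y₀ z ζ)
      (𝓝 (frontPoint φ y₀ z ζ)) := tendsto_comap.mono_left inf_le_left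
  obtain ⟨-, l2, -, -, l5⟩ := rescaled_of_tendsto_phiCoord h.limit.zero
    (hdom.mono fun w hw => mem_interior_target_pos hw.2) hlim
  have t1 := h.limit.tendsto.comp (tendsto_nhdsWithin_iff.2
    ⟨l2, hdom.mono fun w hw => mem_interior_target_pos hw.1⟩)
  have t2 := ((tendsto_clm_apply t1 l5).inner (𝕜 := ℝ) l5).sub_const 1
  have e : inner ℝ (k (z 0 • reflect ζ)) (z 0 • reflect ζ) - 1 =
      halfSpaceHam (frontMetric A) z ζ := by
    rw [halfSpaceHam_frontMetric A hA hz, zeroHam, reflectOp_apply, inner_reflect_left, map_smul,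
      real_inner_smul_left, real_inner_smul_right]
    ring
  rw [← e]
  refine t2.congr' ?_
  filter_upwards [hdom] with w hw
  rw [h.symbol_eq _ hw.1, zeroHam]
  simp only [Function.comp_apply, map_smul, real_inner_smul_left, real_inner_smul_right]
  ring

end IsFrontModel

end

section

variable {n : ℕ} {k : Coord n →L[ℝ] Coord n} {A : Coord n ≃L[ℝ] Coord n}

/-! ### The distance to the point `e` -/

/-- The hyperbolic cosine of the distance to `e`. -/
def coshDist (A : Coord n ≃L[ℝ] Coord n) (z : Coord n) : ℝ :=
  1 + ‖A (z - basisVec 0)‖ ^ 2 * (2 * z 0)⁻¹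

lemma one_le_coshDist {z : Coord n} (hz : 0 < z 0) : 1 ≤ coshDist A z := by
  have : 0 ≤ ‖A (z - basisVec 0)‖ ^ 2 * (2 * z 0)⁻¹ := by positivity
  rw [coshDist]
  linarith

lemma one_lt_coshDist {z : Coord n} (hz : 0 < z 0) (hne : z ≠ basisVec 0) : 1 < coshDist A z := by
  have h : 0 < ‖A (z - basisVec 0)‖ := norm_pos_iff.2 (by simpa [sub_eq_zero] using hne)
  have : 0 < ‖A (z - basisVec 0)‖ ^ 2 * (2 * z 0)⁻¹ := by positivity
  rw [coshDist]
  linarith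

lemma norm_sq_eq_coshDist {z : Coord n} (hz : 0 < z 0) :
    ‖A (z - basisVec 0)‖ ^ 2 = 2 * z 0 * (coshDist A z - 1) := by
  rw [coshDist]
  field_simp
  ring

/-- The differential of `coshDist`. -/
def coshDistDeriv (A : Coord n ≃L[ℝ] Coord n) (z : Coord n) : Coord n →L[ℝ] ℝ :=
  (z 0)⁻¹ • ((innerSL ℝ (A (z - basisVec 0))).comp (A : Coord n →L[ℝ] Coord n) -
    (coshDist A z - 1) • (EuclideanSpace.proj 0 : Coord n →L[ℝ] ℝ))

lemma coshDistDeriv_apply (z v : Coord n) : coshDistDeriv A z v =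
    (z 0)⁻¹ * (inner ℝ (A (z - basisVec 0)) (A v) - (coshDist A z - 1) * v 0) := by
  rfl

lemma hasFDerivAt_coshDist {z : Coord n} (hz : 0 < z 0) :
    HasFDerivAt (coshDist A) (coshDistDeriv A z) z := by
  have h1 : HasFDerivAt (fun z : Coord n => A (z - basisVec 0)) (A : Coord n →L[ℝ] Coord n) z :=
    (A : Coord n →L[ℝ] Coord n).hasFDerivAt.comp z ((hasFDerivAt_id z).sub_const (basisVec 0))
  have h2 : HasFDerivAt (fun z : Coord n => 2 * z 0)
      ((2 : ℝ) • (EuclideanSpace.proj 0 : Coord n →L[ℝ] ℝ)) z :=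
    (EuclideanSpace.proj 0 : Coord n →L[ℝ] ℝ).hasFDerivAt.const_mul 2
  have h3 := (h1.norm_sq.mul ((hasDerivAt_inv (by positivity : 2 * z 0 ≠ 0)).comp_hasFDerivAt z
    h2)).const_add 1
  refine h3.congr_fderiv ?_
  ext v
  rw [coshDistDeriv_apply]
  have hp : (EuclideanSpace.proj 0 : Coord n →L[ℝ] ℝ) v = v 0 := rfl
  simp only [add_apply, smul_apply, ContinuousLinearMap.comp_apply, smul_eq_mul,
    ContinuousLinearEquiv.coe_coe, innerSL_apply_apply, norm_sq_eq_coshDist hz,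
    hp, Function.comp_apply, nsmul_eq_mul]
  push_cast
  field_simp
  ring

lemma coshDist_contDiffOn : ContDiffOn ℝ ∞ (coshDist A) {z | 0 < z 0} := by
  have h1 : ContDiff ℝ ∞ fun z : Coord n => A (z - basisVec 0) :=
    A.contDiff.comp (contDiff_id.sub contDiff_const)
  have h2 : ContDiff ℝ ∞ fun z : Coord n => 2 * z 0 :=
    contDiff_const.mul (EuclideanSpace.proj 0 : Coord n →L[ℝ] ℝ).contDiff
  refine contDiffOn_const.add ((h1.norm_sq ℝ).contDiffOn.mul (h2.contDiffOn.inv fun z hz => ?_))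
  have : 0 < z 0 := hz
  positivity

/-- The differential of `cosh d` has norm `sinh d`: it is represented by `u / z 0`, and `‖u‖² = C² -
1`. The inequality is Cauchy–Schwarz. -/
lemma abs_coshDistDeriv_le (hA : ∀ z, A z 0 = z 0) {z : Coord n} (hz : 0 < z 0) (v : Coord n) :
    |coshDistDeriv A z v| ≤ √(coshDist A z ^ 2 - 1) * (‖A v‖ / z 0) := by
  set u := A (z - basisVec 0) - (coshDist A z - 1) • (basisVec 0 : Coord n) with hu
  have h1 : coshDistDeriv A z v = (z 0)⁻¹ * inner ℝ u (A v) := by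
    rw [coshDistDeriv_apply, hu, inner_sub_left, real_inner_smul_left, basisVec_inner, hA]
  have h2 : ‖u‖ ^ 2 = coshDist A z ^ 2 - 1 := by
    rw [hu, norm_sub_sq_real, norm_sq_eq_coshDist hz, real_inner_smul_right, inner_basisVec, hA,
      norm_smul, mul_pow, Real.norm_eq_abs, sq_abs]
    simp
    ring
  rw [h1, abs_mul, abs_of_pos (inv_pos.2 hz), ← h2, Real.sqrt_sq (norm_nonneg u),
    mul_div_assoc', inv_mul_eq_div]
  exact div_le_div_of_nonneg_right (abs_real_inner_le_norm _ _) hz.le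

namespace IsModelOp

variable {P : Coord n}

lemma inner_apply_basisVec (hk : IsModelOp k) (P : Coord n) :
    inner ℝ (k (basisVec 0)) P = modelSlope k P := by
  rw [real_inner_comm, ← hk.apply_zero, modelSlope]

/-- The explicit solution, relative to the point `e`. -/
lemma modelPos_sub (k : Coord n →L[ℝ] Coord n) (P : Coord n) (t : ℝ) :
    modelPos k P t - basisVec 0 = k (((invHeight (modelSlope k P) t)⁻¹ - 1) • basisVec 0 +
      (Real.sinh (2 * t) / invHeight (modelSlope k P) t) • (P - modelSlope k P • basisVec 0)) := by
  simp only [modelPos, map_add, map_smul, map_sub]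
  abel

lemma coshDist_modelPos (hk : IsModelOp k) (hA : ∀ v w, inner ℝ (A (k v)) (A w) = inner ℝ v w)
    (hP : inner ℝ (k P) P = 1) (t : ℝ) : coshDist A (modelPos k P t) = Real.cosh (2 * t) := by
  have hD := (invHeight_pos (hk.abs_slope_le hP) t).ne'
  have h4 : inner ℝ (k P) (basisVec 0) = modelSlope k P := by rw [inner_basisVec]; rfl
  rw [coshDist, modelPos_sub, ← real_inner_self_eq_norm_sq, hA, ← hk.symm, hk.modelPos_apply_zero]
  simp only [map_add, map_smul, map_sub, inner_add_left, inner_add_right, inner_sub_left,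
    inner_sub_right, real_inner_smul_left, real_inner_smul_right, hP, h4, hk.normal,
    hk.inner_apply_basisVec]
  field_simp
  rw [invHeight]
  linear_combination (-1) * Real.cosh_sq (2 * t)

/-- With distance `2t` along the curve, the chain rule for `cosh d` turns this into the statement
that the covector of the geodesic is the differential of the distance. -/
lemma coshDistDeriv_modelPos (hk : IsModelOp k)
    (hA : ∀ v w, inner ℝ (A (k v)) (A w) = inner ℝ v w)
    (hP : inner ℝ (k P) P = 1) (t : ℝ) :
    coshDistDeriv A (modelPos k P t) = Real.sinh (2 * t) • covec (modelCov k P t) := by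
  have hD := (invHeight_pos (hk.abs_slope_le hP) t).ne'
  ext v
  rw [coshDistDeriv_apply, hk.coshDist_modelPos hA hP, modelPos_sub, hA, hk.modelPos_apply_zero]
  simp only [smul_apply, covec, innerSL_apply_apply, modelCov, inner_add_left, inner_sub_left,
    real_inner_smul_left, basisVec_inner, smul_eq_mul]
  field_simp
  rw [invHeight]
  linear_combination (-v 0) * Real.cosh_sq (2 * t)

/-- Every point of the half space is reached by an explicit solution. -/
lemma exists_modelPos_eq (hk : IsModelOp k) (hA : ∀ v w, inner ℝ (A (k v)) (A w) = inner ℝ v w)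
    {z : Coord n} (hz : 0 < z 0) :
    ∃ P, inner ℝ (k P) P = 1 ∧ ∃ T ≥ 0, modelPos k P T = z := by
  rcases eq_or_ne z (basisVec 0) with rfl | hne
  · exact ⟨basisVec 0, hk.normal, 0, le_rfl, modelPos_zero _ _⟩
  have hC := one_lt_coshDist (A := A) hz hne
  set C := coshDist A z with hCdef
  set S := √(C ^ 2 - 1) with hS
  have hS2 : S ^ 2 = C ^ 2 - 1 := Real.sq_sqrt (by nlinarith)
  have hS0 : 0 < S := Real.sqrt_pos.2 (by nlinarith)
  obtain ⟨x, hx⟩ := hk.exists_apply_eq (z - basisVec 0)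
  have hx0 : inner ℝ (k (basisVec 0)) x = z 0 - 1 := by
    rw [hk.inner_apply_basisVec, modelSlope, hx]
    simp
  have hx0' : inner ℝ (k x) (basisVec 0) = z 0 - 1 := by
    rw [hk.symm, real_inner_comm, hx0]
  have hxx : inner ℝ (k x) x = 2 * z 0 * (C - 1) := by
    rw [hk.symm, ← hA, hx, real_inner_self_eq_norm_sq, norm_sq_eq_coshDist hz]
  -- Solves `C - w S = (z 0)⁻¹`, the height equation with `cosh 2T = C` and `sinh 2T = S`; `P` then
  -- comes from inverting `modelPos_sub`.
  set w := (C - (z 0)⁻¹) / S with hw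
  set P := w • basisVec 0 + ((z 0)⁻¹ / S) • (x - (z 0 - 1) • basisVec 0) with hPdef
  have hP : inner ℝ (k P) P = 1 := by
    simp only [hPdef, map_add, map_smul, map_sub, inner_add_left, inner_add_right, inner_sub_left,
      inner_sub_right, real_inner_smul_left, real_inner_smul_right, hxx, hx0, hx0', hk.normal]
    rw [hw]
    field_simp
    linear_combination (-z 0 ^ 2) * hS2
  have hslope : modelSlope k P = w := by
    rw [← hk.inner_apply_basisVec, hPdef]
    simp only [inner_add_right, inner_sub_right, real_inner_smul_right, hx0, hk.normal]
    ring
  refine ⟨P, hP, Real.arcosh C / 2, div_nonneg (Real.arcosh_nonneg hC.le) two_pos.le, ?_⟩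
  have ht : 2 * (Real.arcosh C / 2) = Real.arcosh C := by ring
  have hD : invHeight w (Real.arcosh C / 2) = (z 0)⁻¹ := by
    rw [invHeight, ht, Real.cosh_arcosh hC.le, Real.sinh_arcosh hC.le, ← hS, hw]
    field_simp
    ring
  rw [← sub_add_cancel (modelPos k P (Real.arcosh C / 2)) (basisVec 0), modelPos_sub, hslope, hD,
    ht, Real.sinh_arcosh hC.le, ← hS, inv_inv]
  have : (z 0 - 1) • basisVec 0 + (S / (z 0)⁻¹) • (P - w • basisVec 0) = x := by
    rw [hPdef, add_sub_cancel_left, smul_smul]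
    have : S / (z 0)⁻¹ * ((z 0)⁻¹ / S) = 1 := by field_simp
    rw [this, one_smul]
    abel
  rw [this, hx, sub_add_cancel]

end IsModelOp

lemma sqrt_frontMetric {z : Coord n} (hz : 0 < z 0) (v : Coord n) :
    √(frontMetric A z v v) = ‖A v‖ / z 0 := by
  rw [frontMetric_apply, real_inner_self_eq_norm_sq, ← div_pow, Real.sqrt_sq (by positivity)]

/-- A lower bound for the length of a curve. -/
lemma arcosh_coshDist_le_length (hA : ∀ z, A z 0 = z 0) {c : ℝ → Coord n}
    (hc : ContDiffOn ℝ 1 c (Icc 0 1)) (hpos : ∀ t ∈ Icc (0 : ℝ) 1, 0 < c t 0)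
    (h0 : c 0 = diagPoint n) :
    Real.arcosh (coshDist A (c 1)) ≤ ∫ t in (0 : ℝ)..1,
      √(frontMetric A (c t) (derivWithin c (Icc 0 1) t) (derivWithin c (Icc 0 1) t)) := by
  set len := ∫ t in (0 : ℝ)..1,
      √(frontMetric A (c t) (derivWithin c (Icc 0 1) t) (derivWithin c (Icc 0 1) t)) with hlen
  have hcd : ∀ t ∈ Icc (0 : ℝ) 1, HasDerivWithinAt c (derivWithin c (Icc 0 1) t) (Icc 0 1) t :=
    fun t ht => ((hc t ht).differentiableWithinAt one_ne_zero).hasDerivWithinAt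
  have hFd : ∀ t ∈ Icc (0 : ℝ) 1, HasDerivWithinAt (fun τ => coshDist A (c τ))
      (coshDistDeriv A (c t) (derivWithin c (Icc 0 1) t)) (Icc 0 1) t := fun t ht =>
    (hasFDerivAt_coshDist (hpos t ht)).comp_hasDerivWithinAt t (hcd t ht)
  have hdc : ContinuousOn (derivWithin c (Icc 0 1)) (Icc 0 1) :=
    hc.continuousOn_derivWithin (uniqueDiffOn_Icc one_pos) le_rfl
  have hspeed : ContinuousOn (fun t => √(frontMetric A (c t) (derivWithin c (Icc 0 1) t)
      (derivWithin c (Icc 0 1) t))) (Icc 0 1) := by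
    have h1 : ContinuousOn (fun t => ‖A (derivWithin c (Icc 0 1) t)‖ / c t 0) (Icc 0 1) :=
      (A.continuous.comp_continuousOn hdc).norm.div
        ((EuclideanSpace.proj 0 : Coord n →L[ℝ] ℝ).continuous.comp_continuousOn hc.continuousOn)
        fun t ht => (hpos t ht).ne'
    exact h1.congr fun t ht => sqrt_frontMetric (hpos t ht) _
  -- The shift by `δ` is needed because `arcosh` is not differentiable at `1`, the value at the
  -- start and at any return to `e`.
  have key : ∀ δ > 0, Real.arcosh (coshDist A (c 1) + δ) - Real.arcosh (1 + δ) ≤ len := by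
    intro δ hδ
    have hgt : ∀ t ∈ Icc (0 : ℝ) 1, coshDist A (c t) + δ ∈ Ioi (1 : ℝ) := fun t ht => by
      have := one_le_coshDist (A := A) (hpos t ht)
      exact mem_Ioi.2 (by linarith)
    have hd : ∀ t ∈ Icc (0 : ℝ) 1, HasDerivWithinAt
        (fun τ => Real.arcosh (coshDist A (c τ) + δ))
        ((√((coshDist A (c t) + δ) ^ 2 - 1))⁻¹ *
          coshDistDeriv A (c t) (derivWithin c (Icc 0 1) t)) (Icc 0 1) t := fun t ht =>
      HasDerivAt.comp_hasDerivWithinAt (h₂ := Real.arcosh)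
        (h := fun τ => coshDist A (c τ) + δ) t (Real.hasDerivAt_arcosh (hgt t ht)) ((hFd t ht).add_const δ)
    have h1 := intervalIntegral.sub_le_integral_of_hasDeriv_right_of_le (zero_le_one' ℝ)
      (fun t ht => (hd t ht).continuousWithinAt)
      (fun t ht => (hd t (Ioo_subset_Icc_self ht)).mono_of_mem_nhdsWithin
        (mem_of_superset (Ioo_mem_nhdsGT ht.2) fun τ hτ => ⟨ht.1.le.trans hτ.1.le, hτ.2.le⟩))
      (hspeed.integrableOn_compact isCompact_Icc) (fun t ht => ?_)
    · have h2 : coshDist A (c 0) = 1 := by simp [h0, coshDist]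
      simp only [h2] at h1
      exact h1
    · have ht' := Ioo_subset_Icc_self ht
      have h2 := one_le_coshDist (A := A) (hpos t ht')
      have h3 := hgt t ht'
      have h3' : 1 < coshDist A (c t) + δ := h3
      have h4 : 0 < √((coshDist A (c t) + δ) ^ 2 - 1) := Real.sqrt_pos.2 (by nlinarith)
      have h5 : √(coshDist A (c t) ^ 2 - 1) ≤ √((coshDist A (c t) + δ) ^ 2 - 1) :=
        Real.sqrt_le_sqrt (by nlinarith)
      rw [sqrt_frontMetric (hpos t ht'), inv_mul_le_iff₀ h4]
      refine (le_abs_self _).trans ((abs_coshDistDeriv_le hA (hpos t ht') _).trans ?_)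
      exact mul_le_mul_of_nonneg_right h5 (div_nonneg (norm_nonneg _) (hpos t ht').le)
  have h1mem : (1 : ℝ) ∈ Icc (0 : ℝ) 1 := right_mem_Icc.2 zero_le_one
  have hlim {a : ℝ} (ha : 1 ≤ a) :
      Tendsto (fun δ => Real.arcosh (a + δ)) (𝓝[>] 0) (𝓝 (Real.arcosh a)) := by
    refine (Real.continuousOn_arcosh a ha).tendsto.comp (tendsto_nhdsWithin_iff.2 ⟨?_, ?_⟩)
    · have : Continuous fun δ : ℝ => a + δ := by fun_prop
      simpa using (this.tendsto 0).mono_left (nhdsWithin_le_nhds (s := Ioi (0 : ℝ)))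
    · filter_upwards [self_mem_nhdsWithin] with δ hδ
      have : 0 < δ := hδ
      change 1 ≤ a + δ
      linarith
  have h2 := (hlim (one_le_coshDist (A := A) (hpos 1 h1mem))).sub (hlim le_rfl)
  rw [Real.arcosh_zero, sub_zero] at h2
  refine le_of_tendsto h2 ?_
  filter_upwards [self_mem_nhdsWithin] with δ hδ
  exact key δ hδ

/-- The explicit solution realizes the distance. -/
lemma mem_lengths (hk : IsModelOp k) (hA : ∀ v w, inner ℝ (A (k v)) (A w) = inner ℝ v w)
    {P : Coord n} (hP : inner ℝ (k P) P = 1) {T : ℝ} (hT : 0 ≤ T) :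
    ∃ c : ℝ → Coord n, ContDiffOn ℝ 1 c (Icc 0 1) ∧ (∀ t ∈ Icc (0 : ℝ) 1, 0 < c t 0) ∧
      c 0 = diagPoint n ∧ c 1 = modelPos k P T ∧ 2 * T = ∫ t in (0 : ℝ)..1,
        √(frontMetric A (c t) (derivWithin c (Icc 0 1) t) (derivWithin c (Icc 0 1) t)) := by
  have hd : ∀ t, HasDerivAt (fun τ => modelPos k P (τ * T))
      (T • ((modelPos k P (t * T)) 0 • ((2 : ℝ) • k (modelMom k P (t * T))))) t := fun t => by
    have h := (hk.hasDerivAt_modelPos hP (t * T)).scomp t ((hasDerivAt_id t).mul_const T)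
    rw [one_mul] at h
    exact h
  have hdw : ∀ t ∈ Icc (0 : ℝ) 1, derivWithin (fun τ => modelPos k P (τ * T)) (Icc 0 1) t =
      T • ((modelPos k P (t * T)) 0 • ((2 : ℝ) • k (modelMom k P (t * T)))) := fun t ht =>
    (hd t).hasDerivWithinAt.derivWithin (uniqueDiffOn_Icc one_pos t ht)
  -- The flow of `|ζ|² - 1` has speed `2` on the unit cosphere, here reparametrised to unit time.
  have hspeed : ∀ t ∈ Icc (0 : ℝ) 1, √(frontMetric A (modelPos k P (t * T))
      (derivWithin (fun τ => modelPos k P (τ * T)) (Icc 0 1) t)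
      (derivWithin (fun τ => modelPos k P (τ * T)) (Icc 0 1) t)) = 2 * T := fun t ht => by
    have hpos := hk.modelPos_pos hP (t * T)
    have h1 : ‖A (k (modelMom k P (t * T)))‖ = 1 := by
      rw [← sq_eq_sq₀ (norm_nonneg _) zero_le_one, ← real_inner_self_eq_norm_sq, hA, ← hk.symm,
        hk.inner_modelMom hP, one_pow]
    rw [hdw t ht, sqrt_frontMetric hpos]
    simp only [map_smul, norm_smul, h1, Real.norm_eq_abs, abs_of_pos hpos, abs_of_nonneg hT]
    rw [abs_two, mul_one, mul_div_assoc, mul_div_cancel_left₀ _ hpos.ne', mul_comm]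
  refine ⟨fun τ => modelPos k P (τ * T), ?_, fun t _ => hk.modelPos_pos hP _, by simp, by simp, ?_⟩
  · have hc : Differentiable ℝ (fun τ => modelPos k P (τ * T)) := fun t => (hd t).differentiableAt
    refine (contDiff_one_iff_deriv.2 ⟨hc, ?_⟩).contDiffOn
    rw [show deriv (fun τ => modelPos k P (τ * T)) = fun t =>
      T • ((modelPos k P (t * T)) 0 • ((2 : ℝ) • k (modelMom k P (t * T)))) from
      funext fun t => (hd t).deriv]
    have h1 : Continuous fun t => (modelPos k P (t * T)) 0 :=
      (EuclideanSpace.proj 0 : Coord n →L[ℝ] ℝ).continuous.comp hc.continuous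
    have h2 : Continuous fun t => modelMom k P (t * T) :=
      (continuous_iff_continuousAt.2 fun t =>
        (hk.hasDerivAt_modelMom hP t).continuousAt).comp (continuous_id.mul continuous_const)
    have h3 : Continuous fun t => k (modelMom k P (t * T)) := k.continuous.comp h2
    exact ((h1.smul (h3.const_smul (2 : ℝ))).const_smul T).congr fun _ => rfl
  · rw [intervalIntegral.integral_congr (g := fun _ => 2 * T) fun t ht =>
      hspeed t (by rwa [uIcc_of_le zero_le_one] at ht)]
    simp

lemma riemDist_eq (hk : IsModelOp k) (hA0 : ∀ z, A z 0 = z 0)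
    (hA : ∀ v w, inner ℝ (A (k v)) (A w) = inner ℝ v w) {z : Coord n} (hz : 0 < z 0) :
    riemDist (frontMetric A) (diagPoint n) z = Real.arcosh (coshDist A z) := by
  obtain ⟨P, hP, T, hT, rfl⟩ := hk.exists_modelPos_eq hA hz
  obtain ⟨c, hc⟩ := mem_lengths hk hA hP hT
  have heq : Real.arcosh (coshDist A (modelPos k P T)) = 2 * T := by
    rw [hk.coshDist_modelPos hA hP, Real.arcosh_cosh (by positivity)]
  have hle : ∀ L ∈ {L : ℝ | ∃ c : ℝ → Coord n, ContDiffOn ℝ 1 c (Icc 0 1) ∧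
      (∀ t ∈ Icc (0 : ℝ) 1, 0 < c t 0) ∧ c 0 = diagPoint n ∧ c 1 = modelPos k P T ∧
      L = ∫ t in (0 : ℝ)..1, √(frontMetric A (c t) (derivWithin c (Icc 0 1) t)
        (derivWithin c (Icc 0 1) t))}, Real.arcosh (coshDist A (modelPos k P T)) ≤ L := by
    rintro L ⟨c, hc, hpos, h0, h1, rfl⟩
    rw [← h1]
    exact arcosh_coshDist_le_length hA0 hc hpos h0
  refine le_antisymm ((csInf_le ⟨_, hle⟩ ⟨c, hc⟩).trans_eq heq.symm) (le_csInf ⟨_, c, hc⟩ hle)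

lemma riemDist_contDiffOn (hk : IsModelOp k) (hA0 : ∀ z, A z 0 = z 0)
    (hA : ∀ v w, inner ℝ (A (k v)) (A w) = inner ℝ v w) :
    ContDiffOn ℝ ∞ (riemDist (frontMetric A) (diagPoint n)) {z | 0 < z 0 ∧ z ≠ diagPoint n} := by
  refine ContDiffOn.congr (f := Real.arcosh ∘ coshDist A) (fun z hz => ?_)
    fun z hz => riemDist_eq hk hA0 hA hz.1
  exact (Real.contDiffAt_arcosh (one_lt_coshDist hz.1 hz.2)).comp_contDiffWithinAt z
    ((coshDist_contDiffOn z hz.1).mono fun w hw => hw.1)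

lemma gradient_riemDist (hk : IsModelOp k) (hA0 : ∀ z, A z 0 = z 0)
    (hA : ∀ v w, inner ℝ (A (k v)) (A w) = inner ℝ v w) {P : Coord n}
    (hP : inner ℝ (k P) P = 1) {T : ℝ} (hT : 0 < T) :
    ∇ (riemDist (frontMetric A) (diagPoint n)) (modelPos k P T) = modelCov k P T := by
  have hpos := hk.modelPos_pos hP T
  have hs : 0 < Real.sinh (2 * T) := Real.sinh_pos_iff.2 (by positivity)
  have hC : 1 < coshDist A (modelPos k P T) := by
    rw [hk.coshDist_modelPos hA hP, Real.one_lt_cosh]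
    positivity
  have h1 := HasDerivAt.comp_hasFDerivAt (h₂ := Real.arcosh) _ (Real.hasDerivAt_arcosh hC)
    (hasFDerivAt_coshDist hpos)
  rw [hk.coshDistDeriv_modelPos hA hP, hk.coshDist_modelPos hA hP, ← Real.sinh_sq,
    Real.sqrt_sq hs.le, inv_smul_smul₀ hs.ne'] at h1
  have h2 : HasGradientAt (riemDist (frontMetric A) (diagPoint n)) (modelCov k P T)
      (modelPos k P T) := by
    rw [hasGradientAt_iff_hasFDerivAt]
    refine h1.congr_of_eventuallyEq ?_
    filter_upwards [isOpen_halfSpace.mem_nhds hpos] with z hz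
    exact riemDist_eq hk hA0 hA hz
  exact h2.gradient

lemma mem_flowout_iff_eq_gradient (hk : IsModelOp k) (hA0 : ∀ z, A z 0 = z 0)
    (hA : ∀ v w, inner ℝ (A (k v)) (A w) = inner ℝ v w) {z : Coord n} (hz : 0 < z 0)
    (hne : z ≠ diagPoint n) (ζ : Coord n) : (z, ζ) ∈ flowout (frontMetric A) (diagPoint n) ↔
      ζ = ∇ (riemDist (frontMetric A) (diagPoint n)) z := by
  have hTpos {P : Coord n} {T : ℝ} (hT : 0 ≤ T) (h : modelPos k P T = z) : 0 < T :=
    hT.lt_of_ne fun h0 => hne (by rw [← h, ← h0, modelPos_zero])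
  rw [hk.mem_flowout_iff A hA]
  constructor
  · rintro ⟨P, hP, T, hT, h1, rfl⟩
    rw [← gradient_riemDist hk hA0 hA hP (hTpos hT h1), h1]
  · rintro rfl
    obtain ⟨P, hP, T, hT, h1⟩ := hk.exists_modelPos_eq hA hz
    exact ⟨P, hP, T, hT, h1, by rw [← gradient_riemDist hk hA0 hA hP (hTpos hT h1), h1]⟩

lemma mem_flowout_diagPoint_iff (hk : IsModelOp k)
    (hA : ∀ v w, inner ℝ (A (k v)) (A w) = inner ℝ v w) (ζ : Coord n) :
    (diagPoint n, ζ) ∈ flowout (frontMetric A) (diagPoint n) ↔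
      halfSpaceHam (frontMetric A) (diagPoint n) ζ = 0 := by
  have h0 : 0 < diagPoint n 0 := by simp
  have hham : halfSpaceHam (frontMetric A) (diagPoint n) ζ = inner ℝ (k ζ) ζ - 1 := by
    rw [halfSpaceHam_frontMetric A hA h0]
    simp [zeroHam]
  rw [hk.mem_flowout_iff A hA, hham, sub_eq_zero]
  constructor
  · rintro ⟨P, hP, T, hT, h1, rfl⟩
    have h2 := hk.coshDist_modelPos hA hP T
    rw [h1] at h2
    -- An explicit curve does not return to `e`, since `cosh (2T) = 1` only at `T = 0`; nothing but
    -- the initial cosphere lies over `e`.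
    have h3 : T = 0 := by
      have : ¬ 1 < Real.cosh (2 * T) := by
        rw [← h2]
        simp [coshDist]
      rw [Real.one_lt_cosh, not_not] at this
      linarith
    rw [h3, modelCov_zero, hP]
  · intro h
    exact ⟨ζ, h, 0, le_rfl, modelPos_zero _ _, modelCov_zero _ _⟩

end

end ZeroGeometry

end

theorem mainTheorem7 {n : ℕ} {X : Type*} [TopologicalSpace X] [T2Space X] [CompactSpace X]
    [ChartedSpace (EuclideanHalfSpace (n + 1)) X] [IsManifold (𝓡∂ (n + 1)) ∞ X]
    (g : ZeroGeometry.BilinField n X) (hg : ZeroGeometry.IsAsymptoticallyHyperbolic g)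
    (y₀ : X) (hy₀ : y₀ ∈ (𝓡∂ (n + 1)).boundary X)
    (φ : OpenPartialHomeomorph X (EuclideanHalfSpace (n + 1)))
    (hφ : φ ∈ IsManifold.maximalAtlas (𝓡∂ (n + 1)) ∞ X) (hy₀φ : y₀ ∈ φ.source) :
    ∃ G : ZeroGeometry.Coord n → ZeroGeometry.Coord n →L[ℝ] ZeroGeometry.Coord n →L[ℝ] ℝ,
      -- the left Hamiltonian extends to `T^*F_{y₀}°`, as the Hamiltonian of the metric `G`
      (∀ z ζ : ZeroGeometry.Coord n, 0 < z 0 →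
        Tendsto (fun w => ZeroGeometry.symbol g (ZeroGeometry.ofCoord φ w.1.1 w.1.2))
          (ZeroGeometry.towardsFront φ y₀ z ζ) (𝓝 (ZeroGeometry.halfSpaceHam G z ζ))) ∧
      ZeroGeometry.IsHyperbolic G ∧
      -- the distance to `e` is smooth away from `e`
      ContDiffOn ℝ ∞ (ZeroGeometry.riemDist G (ZeroGeometry.diagPoint n))
        {z | 0 < z 0 ∧ z ≠ ZeroGeometry.diagPoint n} ∧
      -- away from `e`, the Lagrangian is the graph of the differential of the distance to `e`
      (∀ z ζ : ZeroGeometry.Coord n, 0 < z 0 → z ≠ ZeroGeometry.diagPoint n →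
        ((z, ζ) ∈ ZeroGeometry.frontLagrangian g φ y₀ ↔
          ζ = ∇ (ZeroGeometry.riemDist G (ZeroGeometry.diagPoint n)) z)) ∧
      -- over `e`, it is the unit cosphere
      (∀ ζ : ZeroGeometry.Coord n,
        (ZeroGeometry.diagPoint n, ζ) ∈ ZeroGeometry.frontLagrangian g φ y₀ ↔
          ZeroGeometry.halfSpaceHam G (ZeroGeometry.diagPoint n) ζ = 0) ∧
      -- it is the forward flowout from the unit cosphere over `e`
      ZeroGeometry.frontLagrangian g φ y₀ =
        ZeroGeometry.flowout G (ZeroGeometry.diagPoint n) := by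
  obtain ⟨K, k, h⟩ := ZeroGeometry.exists_isFrontModel hg hy₀ hφ hy₀φ
  -- The metric is built from the reflected operator, in accordance with the sign of `Y`.
  have hk := h.limit.model.reflectOp
  obtain ⟨A, hA0, hA⟩ := hk.exists_frame
  have hΛ := h.frontLagrangian_eq_flowout A hA
  refine ⟨ZeroGeometry.frontMetric A, fun z ζ hz => h.tendsto_symbol A hA hz ζ,
    ZeroGeometry.frontMetric_isHyperbolic A hA0, ZeroGeometry.riemDist_contDiffOn hk hA0 hA,
    fun z ζ hz hne => ?_, fun ζ => ?_, hΛ⟩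
  · rw [hΛ]
    exact ZeroGeometry.mem_flowout_iff_eq_gradient hk hA0 hA hz hne ζ
  · rw [hΛ]
    exact ZeroGeometry.mem_flowout_diagPoint_iff hk hA ζ
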